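/- **Setting.** Let $\mathcal H_{\rm in}=\ell^2(I)$, $\mathcal H_{\rm out}=\ell^2(O)$ be complex Hilbert spaces of arbitrary dimension (every Hilbert space has this form once an orthonormal basis is chosen). A *state* is a density operator; a *channel* is a completely positive trace preserving linear map between trace classes. Let $\Phi$ be a channel from $\mathcal H_{\rm in}$ to $\mathcal H_{\rm out}$, and let $\Delta$ be a tangent vector to the convex set of channels, i.e. $\Delta=c(\Phi_1-\Phi_2)$ with $c\in\mathbb R$ and channels $\Phi_1,\Phi_2$ (in finite dimension: any Hermiticity preserving linear map with trace-zero values). For a probability measure $p$ and a signed measure $\delta$ with total mass $0$, $J_p(\delta)=\int (d\delta/dp)^2\,dp$ is the Fisher information, with $J_p(\delta)=\infty$ if $\delta\not\ll p$. A measurement $M$ sends a trace class operator $T$ to the measure $B\mapsto \mathrm{tr}(T E(B))$, where $E$ is a POVM on a measurable space. All metrics below take values in $[0,\infty]$. **Single copy.** $G^{\min}_\Phi(\Delta)=\sup J_p(d)$ with $p=M((\Phi\otimes\mathbf I)(\rho))$, $d=M((\Delta\otimes\mathbf I)(\rho))$, over all ancillas $\mathcal K$, states $\rho$ on $\mathcal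 H_{\rm in}\otimes\mathcal K$ and measurements $M$ on $\mathcal H_{\rm out}\otimes\mathcal K$. $G^{\max}_\Phi(\Delta)=\inf J_q(\delta)$ over all classical tangent simulations: a measurable space $X$, a probability measure $q$ and a signed measure $\delta$ of mass $0$ on $X$, and a measurable family of channels $(\Lambda_x)_{x\in X}$ with $\Phi=\int\Lambda_x\,dq(x)$ and $\Delta=\int\Lambda_x\,d\delta(x)$ (i.e. $\Phi=\Lambda\circ(\mathbf I\otimes q)$, $\Delta=\Lambda\circ(\mathbf I\otimes\delta)$). **Parallel.** With $\Delta^{(n)}=\sum_{k=1}^n\Phi^{\otimes k-1}\otimes\Delta\otimes\Phi^{\otimes n-k}$, $$G^{\min,p}_\Phi(\Delta)=\lim_n\tfrac1n G^{\min}_{\Phi^{\otimes n}}(\Delta^{(n)}),\qquad G^{\max,p}_\Phi(\Delta)=\lim_n\tfrac1n G^{\max}_{\Phi^{\otimes n}}(\Delta^{(n)}).$$ **Adaptive.** For channels $\Psi_1$ on $\mathcal H_{\rm in}\otimes\mathcal K$ and $\Psi_2,\dots,\Psi_n$ from $\mathcal H_{\rm out}\otimes\mathcal K$ to $\mathcal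 H_{\rm in}\otimes\mathcal K$ put $\Phi^{\#n}(\Psi)=(\Phi\otimes\mathbf I)\circ\Psi_n\circ\cdots\circ(\Phi\otimes\mathbf I)\circ\Psi_1$, and let $\Delta^{(\#n)}(\Psi)$ be the sum of the $n$ maps obtained by replacing one of the $n$ factors $\Phi$ by $\Delta$. $G^{\min}_{\Phi^{\#n}}(\Delta^{(\#n)})$ is the supremum of $J_p(d)$, $p=M(\Phi^{\#n}(\Psi)(\rho))$, $d=M(\Delta^{(\#n)}(\Psi)(\rho))$, over all $\mathcal K,\rho,\Psi,M$. $G^{\max}_{\Phi^{\#n}}(\Delta^{(\#n)})$ is the infimum of $J_q(\delta)$ over all $(q,\delta)$ as above for which there are a memory space $\mathcal R$ with an initial state $\tau$ and, for each $x\in X$, channels $\Lambda_{1,x},\dots,\Lambda_{n,x}$ from $\mathcal H_{\rm in}\otimes\mathcal R$ to $\mathcal H_{\rm out}\otimes\mathcal R$ such that, for all $\mathcal K,\Psi,\rho$, the operator $$\sigma_x=\mathrm{tr}_{\mathcal R}\,(\Lambda_{n,x}\otimes\mathbf I)\circ(\Psi_n\otimes\mathbf I)\circ\cdots\circ(\Lambda_{1,x}\otimes\mathbf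 I)\circ(\Psi_1\otimes\mathbf I)(\rho\otimes\tau)$$ depends measurably on $x$ and $\int\sigma_x\,dq(x)=\Phi^{\#n}(\Psi)(\rho)$, $\int\sigma_x\,d\delta(x)=\Delta^{(\#n)}(\Psi)(\rho)$. Finally $$G^{\min,a}_\Phi(\Delta)=\lim_n\tfrac1n G^{\min}_{\Phi^{\#n}}(\Delta^{(\#n)}),\qquad G^{\max,a}_\Phi(\Delta)=\lim_n\tfrac1n G^{\max}_{\Phi^{\#n}}(\Delta^{(\#n)}).$$ (Measurability in $x$ and the integrals are understood matrix entry by matrix entry, measurability up to $q$-null sets.) **Proposition.** For every channel $\Phi$ and every tangent vector $\Delta$, the four limits exist in $[0,\infty]$, and $$G^{\min}_\Phi(\Delta)\le G^{\min,p}_\Phi(\Delta)\le G^{\min,a}_\Phi(\Delta)\le G^{\max,p}_\Phi(\Delta)\le G^{\max,a}_\Phi(\Delta)\le G^{\max}_\Phi(\Delta).$$ Moreover $G^{\min,a}$ is weakly additive: for every $m\ge1$ the limit defining $G^{\min,a}_{\Phi^{\otimes m}}(\Delta^{(m)})$ exists, and $\frac1m G^{\min,a}_{\Phi^{\otimes m}}(\Delta^{(m)})=G^{\min,a}_\Phi(\Delta)$.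 -/

import Mathlib

open MeasureTheory Filter Topology
open scoped ENNReal ComplexOrder Kronecker

universe u

noncomputable section

namespace ChannelMetric

/-! Operators.

The Hilbert space with an orthonormal basis indexed by `α` (finite, countable or arbitrary) is
`ℓ²(α)`, and an operator on it is represented by its matrix. The space `ℓ²(α) ⊗ ℓ²(β)` is
`ℓ²(α × β)`. -/

/-- Matrices (of operators) on `ℓ²(α)`. -/
abbrev Op (α : Type u) : Type u := Matrix α α ℂ

/-- Linear maps sending operators on `ℓ²(α)` to operators on `ℓ²(β)`. Only the restriction of such
a map to the trace class (the linear span of the positive trace class operators) is ever used;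
every linear map defined on the trace class is such a restriction. -/
abbrev OpMap (α β : Type u) : Type u := Op α →ₗ[ℂ] Op β

/-- Trace (an absolutely convergent series for a trace class operator). -/
def opTrace {α : Type u} (T : Op α) : ℂ := ∑' a, T a a

/-- `T` is a positive trace class operator on `ℓ²(α)`: all its finite sections are positive
semidefinite and its diagonal is summable. -/
def IsPosTraceClass {α : Type u} (T : Op α) : Prop :=
  T.PosSemidef ∧ Summable fun a => T a a

/-- `ρ` is a density operator on `ℓ²(α)`, that is, a state. -/
def IsDensity {α : Type u} (ρ : Op α) : Prop :=
  IsPosTraceClass ρ ∧ opTrace ρ = 1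

/-! Tensor products of maps. -/

/-- `Φ ⊗ Ψ`, acting blockwise: `Ψ` acts on the `β`-blocks, and `Φ` acts on the resulting
`α`-matrices. On an elementary tensor `A ⊗ B` the value is `Φ A ⊗ Ψ B`. -/
def tensor {α α' β β' : Type u} (Φ : OpMap α α') (Ψ : OpMap β β') :
    OpMap (α × β) (α' × β') where
  toFun T := Matrix.of fun x y =>
    Φ (Matrix.of fun a a' => Ψ (Matrix.of fun b b' => T (a, b) (a', b')) x.2 y.2) x.1 y.1
  map_add' S T := by
    ext x y
    have h : (Matrix.of fun a a' =>
          Ψ (Matrix.of fun b b' => (S + T) (a, b) (a', b')) x.2 y.2) =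
        (Matrix.of fun a a' => Ψ (Matrix.of fun b b' => S (a, b) (a', b')) x.2 y.2) +
          Matrix.of fun a a' => Ψ (Matrix.of fun b b' => T (a, b) (a', b')) x.2 y.2 := by
      ext a a'
      exact congrFun (congrFun (map_add Ψ (Matrix.of fun b b' => S (a, b) (a', b'))
        (Matrix.of fun b b' => T (a, b) (a', b'))) x.2) y.2
    simp only [Matrix.of_apply, Matrix.add_apply] at h ⊢
    rw [h, map_add, Matrix.add_apply]
  map_smul' c T := by
    ext x y
    have h : (Matrix.of fun a a' =>
          Ψ (Matrix.of fun b b' => (c • T) (a, b) (a', b')) x.2 y.2) =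
        c • Matrix.of fun a a' => Ψ (Matrix.of fun b b' => T (a, b) (a', b')) x.2 y.2 := by
      ext a a'
      exact congrFun (congrFun (map_smul Ψ c (Matrix.of fun b b' => T (a, b) (a', b'))) x.2) y.2
    simp only [Matrix.of_apply, Matrix.smul_apply, RingHom.id_apply] at h ⊢
    rw [h, map_smul, Matrix.smul_apply]

/-- `Φ ⊗ 𝐈`, with an ancilla `ℓ²(κ)`. -/
def withId {α α' : Type u} (κ : Type u) (Φ : OpMap α α') : OpMap (α × κ) (α' × κ) :=
  tensor Φ LinearMap.id

/-- Index type of a basis of the `n`-th tensor power of `ℓ²(α)`. -/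
def Pow (α : Type u) : ℕ → Type u
  | 0 => PUnit
  | n + 1 => α × Pow α n

/-- `Φ^{⊗ n}`. -/
def tensorPow {α β : Type u} (Φ : OpMap α β) : (n : ℕ) → OpMap (Pow α n) (Pow β n)
  | 0 => (LinearMap.id : OpMap PUnit PUnit)
  | n + 1 => tensor Φ (tensorPow Φ n)

/-- `Δ^{(n)} = Δ ⊗ Φ^{⊗ (n-1)} + Φ ⊗ Δ ⊗ Φ^{⊗ (n-2)} + ⋯ + Φ^{⊗ (n-1)} ⊗ Δ`. -/
def tensorDeriv {α β : Type u} (Φ Δ : OpMap α β) : (n : ℕ) → OpMap (Pow α n) (Pow β n)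
  | 0 => (0 : OpMap PUnit PUnit)
  | n + 1 => tensor Δ (tensorPow Φ n) + tensor Φ (tensorDeriv Φ Δ n)

/-! Channels and tangent vectors. -/

/-- `Φ` is a quantum channel: completely positive and trace preserving on the trace class. -/
def IsChannel {α β : Type u} (Φ : OpMap α β) : Prop :=
  (∀ (n : ℕ) (T : Op (α × ULift.{u} (Fin n))),
    IsPosTraceClass T → IsPosTraceClass (withId (ULift.{u} (Fin n)) Φ T)) ∧
  ∀ T : Op α, IsPosTraceClass T → opTrace (Φ T) = opTrace T

/-- `Δ` is a tangent vector to the convex set of channels: it lies in the real linear span of the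
differences of channels (by convexity, every element of that span is a real multiple of one
difference). In finite dimension these are all the Hermiticity preserving maps with trace zero
values; in general, all such maps that are completely bounded on the trace class. -/
def IsTangent {α β : Type u} (Δ : OpMap α β) : Prop :=
  ∃ (c : ℝ) (Φ₁ Φ₂ : OpMap α β), IsChannel Φ₁ ∧ IsChannel Φ₂ ∧
    ∀ ρ : Op α, IsDensity ρ → Δ ρ = (c : ℂ) • (Φ₁ ρ - Φ₂ ρ)

/-! Classical Fisher information and measurements. -/

open Classical in
/-- Classical Fisher information `J_p(δ) = ∫ (dδ/dp)² dp`, and `∞` unless `δ ≪ p`. -/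
def fisherInfo {X : Type u} [MeasurableSpace X] (p : Measure X) (δ : SignedMeasure X) : ℝ≥0∞ :=
  if δ ≪ᵥ p.toENNRealVectorMeasure then ∫⁻ x, ENNReal.ofReal ((δ.rnDeriv p x) ^ 2) ∂p else ⊤

/-- `M` is a measurement on `ℓ²(α)` with outcomes in the measurable space `Ω`, given as the channel
with classical output that sends a state to the distribution of the outcome. In terms of the
associated POVM `E`, it is `M T B = tr (T * E B)`. -/
def IsMeasurement {α Ω : Type u} [MeasurableSpace Ω] (M : Op α →ₗ[ℂ] ComplexMeasure Ω) : Prop :=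
  ∀ T : Op α, IsPosTraceClass T →
    (∀ B : Set Ω, 0 ≤ M T B) ∧ M T Set.univ = opTrace T

/-- `p = M σ` and `d = M δ`, as a probability measure and a (real) signed measure. -/
def IsOutcome {α Ω : Type u} [MeasurableSpace Ω] (M : Op α →ₗ[ℂ] ComplexMeasure Ω)
    (σ δ : Op α) (p : Measure Ω) (d : SignedMeasure Ω) : Prop :=
  IsProbabilityMeasure p ∧
  (∀ B : Set Ω, MeasurableSet B → M σ B = ((p.real B : ℝ) : ℂ)) ∧
  ∀ B : Set Ω, MeasurableSet B → M δ B = ((d B : ℝ) : ℂ)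

/-! The minimal metric. -/

/-- `G^min_Φ(Δ)`: the supremum of `J_p(d)`, `p = M ∘ (Φ ⊗ 𝐈)(ρ)`, `d = M ∘ (Δ ⊗ 𝐈)(ρ)`, over all
ancillas `ℓ²(κ)`, input states `ρ` and measurements `M`. -/
def GMin {ι o : Type u} (Φ Δ : OpMap ι o) : ℝ≥0∞ :=
  sSup {j | ∃ (κ Ω : Type u) (_ : MeasurableSpace Ω) (ρ : Op (ι × κ))
    (M : Op (o × κ) →ₗ[ℂ] ComplexMeasure Ω) (p : Measure Ω) (d : SignedMeasure Ω),
    IsDensity ρ ∧ IsMeasurement M ∧ IsOutcome M (withId κ Φ ρ) (withId κ Δ ρ) p d ∧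
    j = fisherInfo p d}

/-! The maximal metric. -/

/-- `∫ g dδ` for a signed measure `δ`. -/
def signedIntegral {X : Type u} [MeasurableSpace X] (δ : SignedMeasure X) (g : X → ℂ) : ℂ :=
  (∫ x, g x ∂δ.toJordanDecomposition.posPart) - ∫ x, g x ∂δ.toJordanDecomposition.negPart

/-- `q` is a probability measure on `X` and `δ` a tangent vector at `q` to the set of probability
measures, that is, a signed measure of total mass zero. -/
def IsProgram {X : Type u} [MeasurableSpace X] (q : Measure X) (δ : SignedMeasure X) : Prop :=
  IsProbabilityMeasure q ∧ δ Set.univ = 0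

/-- `{Λ, q, δ}` is a classical tangent simulation of `{Φ, Δ}`: `Φ = Λ ∘ (𝐈 ⊗ q)` and
`Δ = Λ ∘ (𝐈 ⊗ δ)`. A channel `Λ` with an additional classical input `x ∈ X` is a measurable family
of channels `Λ x`, and `Λ ∘ (𝐈 ⊗ q)` is the mixture `∫ Λ x dq(x)`, taken matrix entry by
matrix entry. -/
def IsTangentSimulation {ι o X : Type u} [MeasurableSpace X] (Φ Δ : OpMap ι o)
    (q : Measure X) (δ : SignedMeasure X) (Λ : X → OpMap ι o) : Prop :=
  IsProgram q δ ∧ (∀ x, IsChannel (Λ x)) ∧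
  ∀ ρ : Op ι, IsDensity ρ → ∀ i j : o,
    AEMeasurable (fun x => Λ x ρ i j) q ∧
    Φ ρ i j = ∫ x, Λ x ρ i j ∂q ∧
    Δ ρ i j = signedIntegral δ fun x => Λ x ρ i j

/-- `G^max_Φ(Δ)`: the infimum of `J_q(δ)` over all classical tangent simulations of `{Φ, Δ}`. -/
def GMax {ι o : Type u} (Φ Δ : OpMap ι o) : ℝ≥0∞ :=
  sInf {j | ∃ (X : Type u) (_ : MeasurableSpace X) (q : Measure X) (δ : SignedMeasure X)
    (Λ : X → OpMap ι o), IsTangentSimulation Φ Δ q δ Λ ∧ j = fisherInfo q δ}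

/-! Adaptive repetition. -/

/-- `Φ^{#(n+1)}(Ψ) = (Φ ⊗ 𝐈) ∘ Ψₙ ∘ ⋯ ∘ (Φ ⊗ 𝐈) ∘ Ψ₁ ∘ (Φ ⊗ 𝐈) ∘ Ψ₀`, where `Ψ₀` is `init` and
`Ψ₁, Ψ₂, …` are `Ψ 0, Ψ 1, …`. There are `n + 1` uses of `Φ`. -/
def adaptive {ι o κ : Type u} (Φ : OpMap ι o) (init : OpMap (ι × κ) (ι × κ))
    (Ψ : ℕ → OpMap (o × κ) (ι × κ)) : ℕ → OpMap (ι × κ) (o × κ)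
  | 0 => withId κ Φ ∘ₗ init
  | n + 1 => withId κ Φ ∘ₗ Ψ n ∘ₗ adaptive Φ init Ψ n

/-- `Δ^{(#(n+1))}(Ψ)`: the sum of the `n + 1` compositions obtained from `Φ^{#(n+1)}(Ψ)` by
replacing one of the `n + 1` uses of `Φ` by `Δ`. -/
def adaptiveDeriv {ι o κ : Type u} (Φ Δ : OpMap ι o) (init : OpMap (ι × κ) (ι × κ))
    (Ψ : ℕ → OpMap (o × κ) (ι × κ)) : ℕ → OpMap (ι × κ) (o × κ)
  | 0 => withId κ Δ ∘ₗ init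
  | n + 1 => withId κ Δ ∘ₗ Ψ n ∘ₗ adaptive Φ init Ψ n +
      withId κ Φ ∘ₗ Ψ n ∘ₗ adaptiveDeriv Φ Δ init Ψ n

/-- An adaptive protocol for `n + 1` uses: the input state and the intermediate channels. -/
def IsProtocol {ι o κ : Type u} (n : ℕ) (ρ : Op (ι × κ)) (init : OpMap (ι × κ) (ι × κ))
    (Ψ : ℕ → OpMap (o × κ) (ι × κ)) : Prop :=
  IsDensity ρ ∧ IsChannel init ∧ ∀ k < n, IsChannel (Ψ k)

/-- `G^min_{Φ^{#(n+1)}}(Δ^{(#(n+1))})`. -/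
def GMinAdaptive {ι o : Type u} (Φ Δ : OpMap ι o) (n : ℕ) : ℝ≥0∞ :=
  sSup {j | ∃ (κ Ω : Type u) (_ : MeasurableSpace Ω) (ρ : Op (ι × κ))
    (init : OpMap (ι × κ) (ι × κ)) (Ψ : ℕ → OpMap (o × κ) (ι × κ))
    (M : Op (o × κ) →ₗ[ℂ] ComplexMeasure Ω) (p : Measure Ω) (d : SignedMeasure Ω),
    IsProtocol n ρ init Ψ ∧ IsMeasurement M ∧
    IsOutcome M (adaptive Φ init Ψ n ρ) (adaptiveDeriv Φ Δ init Ψ n ρ) p d ∧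
    j = fisherInfo p d}

/-- The map `L`, acting on the channel system and the simulator's memory `ℓ²(ω)`, tensored with the
identity of the ancilla `ℓ²(κ)` standing between them. -/
def onMemory {ι o ω : Type u} (κ : Type u) (L : OpMap (ι × ω) (o × ω)) :
    OpMap ((ι × κ) × ω) ((o × κ) × ω) where
  toFun T := Matrix.of fun x y =>
    L (Matrix.of fun a b => T ((a.1, x.1.2), a.2) ((b.1, y.1.2), b.2))
      (x.1.1, x.2) (y.1.1, y.2)
  map_add' S T := by
    ext x y
    exact congrFun (congrFun (map_add L
      (Matrix.of fun a b => S ((a.1, x.1.2), a.2) ((b.1, y.1.2), b.2))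
      (Matrix.of fun a b => T ((a.1, x.1.2), a.2) ((b.1, y.1.2), b.2)))
      (x.1.1, x.2)) (y.1.1, y.2)
  map_smul' c T := by
    ext x y
    exact congrFun (congrFun (map_smul L c
      (Matrix.of fun a b => T ((a.1, x.1.2), a.2) ((b.1, y.1.2), b.2)))
      (x.1.1, x.2)) (y.1.1, y.2)

/-- The protocol with its `k`-th use of the channel replaced by the action of `L k` on the channel
system and the memory:
`(Lₙ ⊗ 𝐈) ∘ (Ψₙ ⊗ 𝐈) ∘ ⋯ ∘ (L₁ ⊗ 𝐈) ∘ (Ψ₁ ⊗ 𝐈) ∘ (L₀ ⊗ 𝐈) ∘ (Ψ₀ ⊗ 𝐈)`. -/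
def adaptiveSim {ι o κ ω : Type u} (L : ℕ → OpMap (ι × ω) (o × ω))
    (init : OpMap (ι × κ) (ι × κ)) (Ψ : ℕ → OpMap (o × κ) (ι × κ)) :
    ℕ → OpMap ((ι × κ) × ω) ((o × κ) × ω)
  | 0 => onMemory κ (L 0) ∘ₗ withId ω init
  | n + 1 => onMemory κ (L (n + 1)) ∘ₗ withId ω (Ψ n) ∘ₗ adaptiveSim L init Ψ n

/-- Partial trace over the second factor. -/
def partialTrace {α ω : Type u} (T : Op (α × ω)) : Op α :=
  Matrix.of fun a b => ∑' w, T (a, w) (b, w)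

/-- `{Λ, q, δ}` is a classical tangent simulation of `{Φ^{#(n+1)}, Δ^{(#(n+1))}}`. The register that
the simulating channels `Λ₀, …, Λₙ` share consists of the classical program `x ∈ X`, drawn from
`q`, and of a quantum memory `ℓ²(ω)` with initial state `τ`, which is discarded at the end. One and
the same simulation has to work for all protocols. -/
def IsAdaptiveSimulation {ι o X ω : Type u} [MeasurableSpace X] (Φ Δ : OpMap ι o) (n : ℕ)
    (q : Measure X) (δ : SignedMeasure X) (τ : Op ω)
    (Λ : X → ℕ → OpMap (ι × ω) (o × ω)) : Prop :=
  IsProgram q δ ∧ IsDensity τ ∧ (∀ x, ∀ k ≤ n, IsChannel (Λ x k)) ∧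
  ∀ (κ : Type u) (ρ : Op (ι × κ)) (init : OpMap (ι × κ) (ι × κ))
    (Ψ : ℕ → OpMap (o × κ) (ι × κ)), IsProtocol n ρ init Ψ →
    ∀ i j : o × κ,
      AEMeasurable (fun x => partialTrace (adaptiveSim (Λ x) init Ψ n (ρ ⊗ₖ τ)) i j) q ∧
      adaptive Φ init Ψ n ρ i j =
        ∫ x, partialTrace (adaptiveSim (Λ x) init Ψ n (ρ ⊗ₖ τ)) i j ∂q ∧
      adaptiveDeriv Φ Δ init Ψ n ρ i j =
        signedIntegral δ fun x => partialTrace (adaptiveSim (Λ x) init Ψ n (ρ ⊗ₖ τ)) i j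

/-- `G^max_{Φ^{#(n+1)}}(Δ^{(#(n+1))})`. -/
def GMaxAdaptive {ι o : Type u} (Φ Δ : OpMap ι o) (n : ℕ) : ℝ≥0∞ :=
  sInf {j | ∃ (X ω : Type u) (_ : MeasurableSpace X) (q : Measure X) (δ : SignedMeasure X)
    (τ : Op ω) (Λ : X → ℕ → OpMap (ι × ω) (o × ω)),
    IsAdaptiveSimulation Φ Δ n q δ τ Λ ∧ j = fisherInfo q δ}

/-! Asymptotic metrics. The theorem asserts that the limits exist. -/

/-- The sequence `(1/(n+1)) G^min_{Φ^{⊗(n+1)}}(Δ^{(n+1)})`. -/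
def rateMinP {ι o : Type u} (Φ Δ : OpMap ι o) (n : ℕ) : ℝ≥0∞ :=
  GMin (tensorPow Φ (n + 1)) (tensorDeriv Φ Δ (n + 1)) / (n + 1 : ℕ)

/-- The sequence `(1/(n+1)) G^max_{Φ^{⊗(n+1)}}(Δ^{(n+1)})`. -/
def rateMaxP {ι o : Type u} (Φ Δ : OpMap ι o) (n : ℕ) : ℝ≥0∞ :=
  GMax (tensorPow Φ (n + 1)) (tensorDeriv Φ Δ (n + 1)) / (n + 1 : ℕ)

/-- The sequence `(1/(n+1)) G^min_{Φ^{#(n+1)}}(Δ^{(#(n+1))})`. -/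
def rateMinA {ι o : Type u} (Φ Δ : OpMap ι o) (n : ℕ) : ℝ≥0∞ :=
  GMinAdaptive Φ Δ n / (n + 1 : ℕ)

/-- The sequence `(1/(n+1)) G^max_{Φ^{#(n+1)}}(Δ^{(#(n+1))})`. -/
def rateMaxA {ι o : Type u} (Φ Δ : OpMap ι o) (n : ℕ) : ℝ≥0∞ :=
  GMaxAdaptive Φ Δ n / (n + 1 : ℕ)

/-- `G^{min,p}_Φ(Δ)`. -/
def GMinP {ι o : Type u} (Φ Δ : OpMap ι o) : ℝ≥0∞ := limUnder atTop (rateMinP Φ Δ)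

/-- `G^{max,p}_Φ(Δ)`. -/
def GMaxP {ι o : Type u} (Φ Δ : OpMap ι o) : ℝ≥0∞ := limUnder atTop (rateMaxP Φ Δ)

/-- `G^{min,a}_Φ(Δ)`. -/
def GMinA {ι o : Type u} (Φ Δ : OpMap ι o) : ℝ≥0∞ := limUnder atTop (rateMinA Φ Δ)

/-- `G^{max,a}_Φ(Δ)`. -/
def GMaxA {ι o : Type u} (Φ Δ : OpMap ι o) : ℝ≥0∞ := limUnder atTop (rateMaxA Φ Δ)

end ChannelMetric

end

/-!
The two minimal metrics are suprema over states that can be reached with `n` uses of the channel,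
and the two maximal metrics are infima over simulations. Both are rewritten in a form in which
composition is easy, and then the theorem follows from a few comparisons and from Fekete's lemma.

*Minimal metrics.* A `Comb` is a sequence of `n` uses of `Φ` with arbitrary channels and changing
ancillas in between. Such a sequence can be compiled into an adaptive protocol with one fixed
ancilla, the disjoint union of the given ones (`Comb.compile`), and the Fisher information is a
supremum of expressions `2 ∫ f dδ - ∫ f² dp` with simple `f`, so that only measurements with
finitely many outcomes are needed. Thus `GMin` and `GMinAdaptive` become one quantity `reachInfo`
(`GMin_eq_reachInfo`, `GMinAdaptive_eq_reachInfo`). Independent runs, one after the other or in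
parallel, add up their information (`reachInfo_seq`, `reachInfo_par`), whence superadditivity;
using `m` copies in parallel is a special case of using them one after the other
(`reachInfo_serialize`). The inequalities
`m * reachInfo Φ n ≤ reachInfo (Φ ^ m) n ≤ reachInfo Φ (n * m)` give weak additivity.

*Maximal metrics.* A simulation of finite cost is given by a square integrable score function
(`exists_score`). Channels are normal (`IsChannel.tendsto_mask`) and hence commute with mixtures,
even though these are defined by matrix entries only (`IsMixture.map_wavg`); therefore simulations
can be composed with channels and with each other, and the costs of independent programs add up
(`SimBy.comp`, `IsScore.prod`). This shows subadditivity for tensor powers (`GMax_tensor_le`) and,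
with a memory consisting of two independent parts, for adaptive protocols (`GMaxAdaptive_add_le`).
An adaptive simulation covers parallel use in particular (`GMax_tensorPow_le_GMaxAdaptive`).

*Minimal against maximal.* The output of a simulated protocol is a mixture labelled by the program,
so that by Jensen's inequality a measurement yields at most the Fisher information of the program
(`reachInfo_le_GMaxAdaptive`). Applied to the channel `Φ ^ m` and combined with subadditivity and
weak additivity, this bounds the adaptive minimal metric by `GMax (Φ ^ m) / m` for each `m`
(`GMinA_le_GMaxP`).
-/

noncomputable section

namespace ChannelMetric

section

variable {α β γ κ : Type u}

/-! ### Positive matrices -/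

/-- The sesquilinear form `⟨u, T v⟩` on finitely supported vectors. -/
def sesq (T : Op α) (u v : α →₀ ℂ) : ℂ :=
  u.sum fun i ui => v.sum fun j vj => star ui * T i j * vj

theorem sesq_add_right (T : Op α) (u v w : α →₀ ℂ) :
    sesq T u (v + w) = sesq T u v + sesq T u w := by
  classical
  unfold sesq
  rw [← Finsupp.sum_add]
  congr 1; ext i ui
  exact Finsupp.sum_add_index' (by simp) (by intros; ring)

theorem sesq_smul_right (T : Op α) (u v : α →₀ ℂ) (c : ℂ) :
    sesq T u (c • v) = sesq T u v * c := by
  classical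
  unfold sesq
  rw [Finsupp.sum_mul]
  congr 1; ext i ui
  rw [Finsupp.sum_smul_index (by simp), Finsupp.sum_mul]
  congr 1; ext j vj
  ring

theorem sesq_add_left (T : Op α) (u v w : α →₀ ℂ) :
    sesq T (u + v) w = sesq T u w + sesq T v w := by
  classical
  unfold sesq
  refine Finsupp.sum_add_index' (by simp) ?_
  intro a b c
  rw [← Finsupp.sum_add]
  congr 1; ext j vj
  simp [add_mul]

theorem sesq_smul_left (T : Op α) (u v : α →₀ ℂ) (c : ℂ) :
    sesq T (c • u) v = star c * sesq T u v := by
  classical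
  unfold sesq
  rw [Finsupp.sum_smul_index (by simp), Finsupp.mul_sum]
  congr 1; ext i ui
  rw [Finsupp.mul_sum]
  congr 1; ext j vj
  simp [mul_assoc]

@[simp] theorem sesq_zero_left (T : Op α) (v : α →₀ ℂ) : sesq T 0 v = 0 := by simp [sesq]

@[simp] theorem sesq_zero_right (T : Op α) (v : α →₀ ℂ) : sesq T v 0 = 0 := by simp [sesq]

@[simp] theorem sesq_single (T : Op α) (i j : α) (c d : ℂ) :
    sesq T (Finsupp.single i c) (Finsupp.single j d) = star c * T i j * d := by
  simp [sesq]

theorem sesq_sum_right {s : Type*} (F : Finset s) (T : Op α) (u : α →₀ ℂ) (v : s → α →₀ ℂ) :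
    sesq T u (∑ k ∈ F, v k) = ∑ k ∈ F, sesq T u (v k) := by
  classical
  induction F using Finset.induction_on with
  | empty => simp
  | insert a F ha ih => rw [Finset.sum_insert ha, Finset.sum_insert ha, sesq_add_right, ih]

theorem sesq_sum_left {s : Type*} (F : Finset s) (T : Op α) (u : α →₀ ℂ) (v : s → α →₀ ℂ) :
    sesq T (∑ k ∈ F, v k) u = ∑ k ∈ F, sesq T (v k) u := by
  classical
  induction F using Finset.induction_on with
  | empty => simp
  | insert a F ha ih => rw [Finset.sum_insert ha, Finset.sum_insert ha, sesq_add_left, ih]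

theorem star_sesq {T : Op α} (hT : T.IsHermitian) (u v : α →₀ ℂ) :
    star (sesq T u v) = sesq T v u := by
  unfold sesq Finsupp.sum
  rw [star_sum, Finset.sum_comm]
  simp only [star_sum]
  refine Finset.sum_congr rfl fun i _ => Finset.sum_congr rfl fun j _ => ?_
  rw [star_mul', star_mul', star_star, hT.apply]
  ring

/-- The compression `V* T V` of a positive matrix is positive; `V` is given by its columns. -/
theorem posSemidef_sandwich {T : Op α} (hT : T.PosSemidef) (V : β → α →₀ ℂ) :
    (Matrix.of fun y y' => sesq T (V y) (V y')).PosSemidef := by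
  refine ⟨?_, fun x => ?_⟩
  · ext y y'
    rw [Matrix.conjTranspose_apply, Matrix.of_apply, Matrix.of_apply, star_sesq hT.1]
  · have h := hT.2 (∑ y ∈ x.support, x y • V y)
    change 0 ≤ sesq T _ _ at h
    rw [sesq_sum_left] at h
    simp only [sesq_sum_right, sesq_smul_left, sesq_smul_right] at h
    simpa [Finsupp.sum, mul_assoc] using h

/-- Positivity of a matrix can be checked on pieces that cover every finite set of indices. -/
theorem posSemidef_of_cover {T : Op α}
    (h : ∀ F : Finset α, ∃ (β : Type u) (e : β → α), (↑F ⊆ Set.range e) ∧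
      (T.submatrix e e).PosSemidef) : T.PosSemidef := by
  classical
  refine ⟨?_, fun x => ?_⟩
  · ext i j
    obtain ⟨β, e, he, hp⟩ := h {i, j}
    obtain ⟨a, rfl⟩ := he (show i ∈ (↑({i, j} : Finset α) : Set α) by simp)
    obtain ⟨b, rfl⟩ := he (show j ∈ (↑({e a, j} : Finset α) : Set α) by simp)
    have := hp.1.apply a b
    simpa using this
  · obtain ⟨β, e, he, hp⟩ := h x.support
    choose s hs using fun i : x.support => he i.2
    have hx : x = Finsupp.mapDomain e
        (∑ i ∈ x.support.attach, Finsupp.single (s i) (x i)) := by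
      rw [Finsupp.mapDomain_finsetSum]
      simp only [Finsupp.mapDomain_single, hs]
      conv_lhs => rw [← Finsupp.sum_single x]
      rw [Finsupp.sum, ← Finset.sum_attach]
    have h2 := hp.2 (∑ i ∈ x.support.attach, Finsupp.single (s i) (x i))
    rw [hx]
    simpa [Finsupp.sum_mapDomain_index, add_mul, mul_add] using h2

theorem posSemidef_kron {A : Op α} {B : Op β} (hA : A.PosSemidef) (hB : B.PosSemidef) :
    (A ⊗ₖ B).PosSemidef := by
  classical
  refine posSemidef_of_cover fun F => ?_
  refine ⟨(F.image Prod.fst) × (F.image Prod.snd), fun p => (p.1, p.2), ?_, ?_⟩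
  · intro p hp
    exact ⟨(⟨p.1, Finset.mem_image_of_mem _ hp⟩, ⟨p.2, Finset.mem_image_of_mem _ hp⟩), rfl⟩
  · exact (hA.submatrix (Subtype.val : F.image Prod.fst → α)).kronecker
      (hB.submatrix (Subtype.val : F.image Prod.snd → β))

theorem diag_eq_re {T : Op α} (hT : T.PosSemidef) (i : α) : T i i = ((T i i).re : ℂ) := by
  have := hT.diag_nonneg (i := i)
  rw [Complex.le_def] at this
  exact Complex.ext rfl (by simpa using this.2.symm)

theorem diag_re_nonneg {T : Op α} (hT : T.PosSemidef) (i : α) : 0 ≤ (T i i).re := by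
  have := hT.diag_nonneg (i := i)
  rw [Complex.le_def] at this
  exact this.1

theorem norm_entry_le {T : Op α} (hT : T.PosSemidef) (i j : α) :
    ‖T i j‖ ≤ ((T i i).re + (T j j).re) / 2 := by
  classical
  by_cases h0 : T i j = 0
  · rw [h0, norm_zero]
    linarith [diag_re_nonneg hT i, diag_re_nonneg hT j]
  -- test positivity on `e_j - (T i j / |T i j|) e_i`
  set c : ℂ := T i j / ‖T i j‖ with hc
  have hn : (‖T i j‖ : ℂ) ≠ 0 := by simpa using h0
  have hcc : star c * T i j = ‖T i j‖ := by
    rw [hc, star_div₀, div_mul_eq_mul_div]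
    simp only [RCLike.star_def, Complex.conj_ofReal]
    rw [Complex.conj_mul', sq, mul_div_assoc, div_self hn, mul_one]
  have hc1 : star c * c = 1 := by
    rw [show star c * c = star c * T i j / ‖T i j‖ by rw [hc]; ring, hcc, div_self hn]
  have h := hT.2 (Finsupp.single j 1 + Finsupp.single i (-c))
  change 0 ≤ sesq T _ _ at h
  simp only [sesq_add_left, sesq_add_right, sesq_single] at h
  have hji : T j i = star (T i j) := (hT.1.apply j i).symm
  have e1 : star (T i j) * c = ‖T i j‖ := by
    have := congrArg star hcc
    simpa [mul_comm] using this
  have e2 : star (1:ℂ) * T j j * 1 + star (-c) * T i j * 1 +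
      (star 1 * T j i * -c + star (-c) * T i i * -c) = T j j + T i i - 2 * ‖T i j‖ := by
    rw [hji]
    simp only [star_one, star_neg]
    linear_combination -hcc - e1 + hc1 * T i i
  rw [e2, diag_eq_re hT i, diag_eq_re hT j, Complex.le_def] at h
  have := h.1
  simp at this
  linarith

/-! ### Positive trace class operators and the trace -/

theorem summable_re {T : Op α} (hT : IsPosTraceClass T) : Summable fun a => (T a a).re :=
  (Complex.hasSum_re hT.2.hasSum).summable

/-- The trace of a positive trace class operator, as a real number. -/
def tr (T : Op α) : ℝ := ∑' a, (T a a).re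

theorem opTrace_eq {T : Op α} (hT : IsPosTraceClass T) : opTrace T = (tr T : ℂ) := by
  rw [opTrace, tr, Complex.ofReal_tsum]
  exact tsum_congr fun a => diag_eq_re hT.1 a

theorem tr_nonneg {T : Op α} (hT : T.PosSemidef) : 0 ≤ tr T :=
  tsum_nonneg fun i => diag_re_nonneg hT i

theorem IsDensity.tr_eq {T : Op α} (hT : IsDensity T) : tr T = 1 := by
  have := hT.2
  rw [opTrace_eq hT.1] at this
  exact_mod_cast this

theorem isPosTraceClass_of_summable {T : Op α} (hT : T.PosSemidef)
    (h : Summable fun a => (T a a).re) : IsPosTraceClass T := by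
  refine ⟨hT, ?_⟩
  have := Complex.hasSum_ofReal.2 h.hasSum
  exact (this.congr_fun (fun a => diag_eq_re hT a)).summable

theorem isDensity_of_hasSum {T : Op α} (hT : T.PosSemidef)
    (h : HasSum (fun a => (T a a).re) 1) : IsDensity T := by
  have h1 := isPosTraceClass_of_summable hT h.summable
  refine ⟨h1, ?_⟩
  rw [opTrace_eq h1, tr, h.tsum_eq]; simp

theorem diag_le_tr {T : Op α} (hT : IsPosTraceClass T) (i : α) : (T i i).re ≤ tr T :=
  (summable_re hT).le_tsum i fun j _ => diag_re_nonneg hT.1 j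

theorem sum_diag_le_tr {T : Op α} (hT : IsPosTraceClass T) (F : Finset α) :
    ∑ i ∈ F, (T i i).re ≤ tr T :=
  (summable_re hT).sum_le_tsum F fun j _ => diag_re_nonneg hT.1 j

theorem norm_entry_le_tr {T : Op α} (hT : IsPosTraceClass T) (i j : α) : ‖T i j‖ ≤ tr T := by
  have := norm_entry_le hT.1 i j
  linarith [diag_le_tr hT i, diag_le_tr hT j]

theorem IsPosTraceClass.add {S T : Op α} (hS : IsPosTraceClass S) (hT : IsPosTraceClass T) :
    IsPosTraceClass (S + T) :=
  ⟨hS.1.add hT.1, hS.2.add hT.2⟩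

theorem IsPosTraceClass.smul {T : Op α} (hT : IsPosTraceClass T) {c : ℝ} (hc : 0 ≤ c) :
    IsPosTraceClass ((c : ℂ) • T) :=
  ⟨hT.1.smul (a := (c : ℂ)) (by exact_mod_cast hc), hT.2.mul_left (c : ℂ)⟩

theorem IsPosTraceClass.submatrix {T : Op α} (hT : IsPosTraceClass T) {e : β → α}
    (he : Function.Injective e) : IsPosTraceClass (T.submatrix e e) :=
  ⟨hT.1.submatrix e, hT.2.comp_injective he⟩

theorem IsPosTraceClass.kron {A : Op α} {B : Op β} (hA : IsPosTraceClass A)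
    (hB : IsPosTraceClass B) : IsPosTraceClass (A ⊗ₖ B) := by
  refine isPosTraceClass_of_summable (posSemidef_kron hA.1 hB.1) ?_
  have h := (summable_re hA).mul_of_nonneg (summable_re hB) (fun i => diag_re_nonneg hA.1 i)
    (fun i => diag_re_nonneg hB.1 i)
  refine h.congr fun p => ?_
  rw [Matrix.kroneckerMap_apply, diag_eq_re hA.1, diag_eq_re hB.1, ← Complex.ofReal_mul,
    Complex.ofReal_re]
  rfl

theorem opTrace_kron {A : Op α} {B : Op β} (hA : IsPosTraceClass A)
    (hB : IsPosTraceClass B) : opTrace (A ⊗ₖ B) = opTrace A * opTrace B := by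
  have h := (hA.kron hB).2
  unfold opTrace
  exact (hA.2.hasSum.mul hB.2.hasSum h).tsum_eq

theorem IsDensity.kron {A : Op α} {B : Op β} (hA : IsDensity A) (hB : IsDensity B) :
    IsDensity (A ⊗ₖ B) :=
  ⟨hA.1.kron hB.1, by rw [opTrace_kron hA.1 hB.1, hA.2, hB.2, one_mul]⟩

theorem exists_isDensity [Nonempty α] : ∃ ρ : Op α, IsDensity ρ := by
  classical
  obtain ⟨a⟩ := ‹Nonempty α›
  refine ⟨Matrix.diagonal (Pi.single a 1), ?_⟩
  refine isDensity_of_hasSum (Matrix.PosSemidef.diagonal ?_) ?_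
  · intro i
    by_cases h : i = a
    · subst h; simp
    · simp [h]
  · convert hasSum_single a (f := fun i => (Matrix.diagonal (Pi.single a (1:ℂ)) i i).re) ?_ using 1
    · simp
    · intro b hb; simp [hb]

theorem IsDensity.nonempty {ρ : Op α} (h : IsDensity ρ) : Nonempty α := by
  by_contra hα
  rw [not_nonempty_iff] at hα
  have := h.2
  simp [opTrace] at this

/-- A positive trace class operator is a nonnegative multiple of a density operator. -/
theorem exists_density_of_isPosTraceClass [Nonempty α] {T : Op α} (hT : IsPosTraceClass T) :
    ∃ ρ : Op α, IsDensity ρ ∧ T = (tr T : ℂ) • ρ := by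
  by_cases h0 : tr T = 0
  · obtain ⟨ρ, hρ⟩ := exists_isDensity (α := α)
    refine ⟨ρ, hρ, ?_⟩
    ext i j
    have := norm_entry_le_tr hT i j
    rw [h0] at this
    simpa [h0] using norm_le_zero_iff.1 this
  · have hn := tr_nonneg hT.1
    refine ⟨((tr T)⁻¹ : ℝ) • T, ?_, ?_⟩
    · have h1 := hT.smul (inv_nonneg.2 hn)
      refine ⟨h1, ?_⟩
      have : opTrace (((tr T)⁻¹ : ℝ) • T) = (((tr T)⁻¹ : ℝ) : ℂ) * opTrace T := by
        unfold opTrace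
        rw [← tsum_mul_left]; rfl
      rw [this, opTrace_eq hT, ← Complex.ofReal_mul, inv_mul_cancel₀ h0, Complex.ofReal_one]
    · ext i j
      simp [h0]

/-- The trace class: the linear span of the positive trace class operators. -/
def TC (α : Type u) : Submodule ℂ (Op α) := Submodule.span ℂ {T | IsPosTraceClass T}

theorem IsPosTraceClass.mem_TC {T : Op α} (hT : IsPosTraceClass T) : T ∈ TC α :=
  Submodule.subset_span hT

theorem map_eqOn_TC {M : Type*} [AddCommGroup M] [Module ℂ M] {f g : Op α →ₗ[ℂ] M}
    (h : ∀ T, IsPosTraceClass T → f T = g T) {T : Op α} (hT : T ∈ TC α) : f T = g T :=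
  LinearMap.eqOn_span (R := ℂ) (fun _ h' => h _ h') hT

theorem map_mem_TC {f : OpMap α β} (h : ∀ T, IsPosTraceClass T → f T ∈ TC β) {T : Op α}
    (hT : T ∈ TC α) : f T ∈ TC β :=
  (Submodule.span_le (p := (TC β).comap f)).2 (fun _ h' => h _ h') hT

/-- Matrices with summable diagonal. -/
def diagSummable (α : Type u) : Submodule ℂ (Op α) where
  carrier := {T | Summable fun a => T a a}
  add_mem' := fun hS hT => hS.add hT
  zero_mem' := by simp
  smul_mem' := fun c _ hT => hT.mul_left c

theorem exists_trace_extension (α : Type u) :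
    ∃ f : Op α →ₗ[ℂ] ℂ, ∀ T ∈ diagSummable α, f T = opTrace T := by
  let g : diagSummable α →ₗ[ℂ] ℂ :=
    { toFun := fun T => opTrace T.1
      map_add' := fun S T => Summable.tsum_add S.2 T.2
      map_smul' := fun c T => tsum_mul_left }
  obtain ⟨f, hf⟩ := LinearMap.exists_extend g
  exact ⟨f, fun T hT => congrArg (fun h => h ⟨T, hT⟩) hf⟩

/-- A linear functional on all matrices that extends the trace. Its values on matrices whose
diagonal is not summable are arbitrary. -/
def trFun (α : Type u) : Op α →ₗ[ℂ] ℂ := (exists_trace_extension α).choose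

theorem trFun_eq {T : Op α} (hT : Summable fun a => T a a) : trFun α T = opTrace T :=
  (exists_trace_extension α).choose_spec T hT

theorem TC_le_diagSummable : TC α ≤ diagSummable α :=
  Submodule.span_le.2 fun _ h => h.2

theorem trFun_eq_of_mem_TC {T : Op α} (hT : T ∈ TC α) : trFun α T = opTrace T :=
  trFun_eq (TC_le_diagSummable hT)

/-- Off-diagonal sums of a positive trace class operator on a product converge. -/
theorem summable_block {T : Op (α × β)} (hT : IsPosTraceClass T) (a a' : α) :
    Summable fun b => T (a, b) (a', b) := by
  have h1 := (summable_re hT).comp_injective (i := fun b => (a, b)) (Prod.mk_right_injective a)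
  have h2 := (summable_re hT).comp_injective (i := fun b => (a', b)) (Prod.mk_right_injective a')
  refine Summable.of_norm_bounded ((h1.add h2).div_const 2) fun b => ?_
  exact norm_entry_le hT.1 _ _

/-- Conjugation by a real diagonal matrix. -/
def scale (w : α → ℝ) (T : Op α) : Op α := Matrix.of fun i j => w i * T i j * w j

theorem posSemidef_scale {T : Op α} (hT : T.PosSemidef) (w : α → ℝ) :
    (scale w T).PosSemidef := by
  have := posSemidef_sandwich hT fun i => Finsupp.single i (w i : ℂ)
  simpa [scale] using this

end

section

variable {α α' α'' β β' γ κ κ' : Type u}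

/-! ### Completely positive maps and channels -/

/-- Complete positivity on the trace class, with ancillas of arbitrary dimension. -/
def IsCP (Φ : OpMap α β) : Prop :=
  ∀ (κ : Type u) (T : Op (α × κ)), IsPosTraceClass T → IsPosTraceClass (withId κ Φ T)

/-- The block of `T` at the indices `k`, `k'` of the second factor. -/
def block (T : Op (α × κ)) (k k' : κ) : Op α := Matrix.of fun a a' => T (a, k) (a', k')

theorem withId_apply (Φ : OpMap α β) (T : Op (α × κ)) (x y : β × κ) :
    withId κ Φ T x y = Φ (block T x.2 y.2) x.1 y.1 := rfl

theorem block_diag_posTC {T : Op (α × κ)} (hT : IsPosTraceClass T) (k : κ) :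
    IsPosTraceClass (block T k k) :=
  hT.submatrix (e := fun a => (a, k)) (Prod.mk_left_injective k)

theorem hasSum_tr_block {T : Op (α × κ)} (hT : IsPosTraceClass T) :
    HasSum (fun k => tr (block T k k)) (tr T) := by
  have h := (summable_re hT).hasSum
  rw [← (Equiv.prodComm κ α).hasSum_iff] at h
  exact h.prod_fiberwise fun k => (summable_re (block_diag_posTC hT k)).hasSum

/-- Relabelling of the basis, or, if `e` is not surjective, compression to a subspace spanned by
basis vectors. -/
def reindex (e : β → α) : OpMap α β where
  toFun T := T.submatrix e e
  map_add' _ _ := rfl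
  map_smul' _ _ := rfl

theorem isCP_reindex {e : β → α} (he : Function.Injective e) : IsCP (reindex e) := fun κ _ hT =>
  hT.submatrix (e := Prod.map e (id : κ → κ)) (he.prodMap Function.injective_id)

theorem IsCP.posTC {Φ : OpMap α β} (h : IsCP Φ) {T : Op α} (hT : IsPosTraceClass T) :
    IsPosTraceClass (Φ T) := by
  have h1 := h PUnit (T.submatrix Prod.fst Prod.fst)
    (hT.submatrix (e := (Prod.fst : α × PUnit.{u + 1} → α)) (fun a b hab => Prod.ext hab rfl))
  exact h1.submatrix (e := fun b => (b, PUnit.unit)) (Prod.mk_left_injective _)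

theorem IsCP.comp {Φ : OpMap β γ} {Ψ : OpMap α β} (h : IsCP Φ) (h' : IsCP Ψ) :
    IsCP (Φ ∘ₗ Ψ) := fun κ T hT => h κ _ (h' κ T hT)

theorem IsCP.add {Φ Ψ : OpMap α β} (h : IsCP Φ) (h' : IsCP Ψ) : IsCP (Φ + Ψ) :=
  fun κ T hT => (h κ T hT).add (h' κ T hT)

theorem withId_withId (Φ : OpMap α β) (T : Op ((α × κ) × κ')) :
    withId κ' (withId κ Φ) T =
      reindex (Equiv.prodAssoc β κ κ')
        (withId (κ × κ') Φ (reindex (Equiv.prodAssoc α κ κ').symm T)) :=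
  rfl

theorem IsCP.withId {Φ : OpMap α β} (h : IsCP Φ) (κ : Type u) : IsCP (withId κ Φ) := by
  intro κ' T hT
  rw [withId_withId]
  exact (h _ _ (hT.submatrix (Equiv.injective _))).submatrix (Equiv.injective _)

/-- Trace preservation on positive trace class operators. -/
def IsTP (Φ : OpMap α β) : Prop := ∀ T : Op α, IsPosTraceClass T → opTrace (Φ T) = opTrace T

theorem IsCP.isChannel {Φ : OpMap α β} (h : IsCP Φ) (h' : IsTP Φ) : IsChannel Φ :=
  ⟨fun _ T hT => h _ T hT, h'⟩

theorem IsChannel.posTC {Φ : OpMap α β} (h : IsChannel Φ) {T : Op α} (hT : IsPosTraceClass T) :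
    IsPosTraceClass (Φ T) := by
  have h1 := h.1 1 (T.submatrix Prod.fst Prod.fst)
    (hT.submatrix (e := (Prod.fst : α × ULift.{u} (Fin 1) → α))
      (fun a b hab => Prod.ext hab (Subsingleton.elim _ _)))
  exact h1.submatrix (e := fun b => (b, ULift.up 0)) (Prod.mk_left_injective _)

theorem IsChannel.tr_eq {Φ : OpMap α β} (h : IsChannel Φ) {T : Op α} (hT : IsPosTraceClass T) :
    tr (Φ T) = tr T := by
  have := h.2 T hT
  rw [opTrace_eq hT, opTrace_eq (h.posTC hT)] at this
  exact_mod_cast this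

theorem IsChannel.isDensity {Φ : OpMap α β} (h : IsChannel Φ) {T : Op α} (hT : IsDensity T) :
    IsDensity (Φ T) := ⟨h.posTC hT.1, by rw [h.2 T hT.1, hT.2]⟩

/-- Positivity with finite dimensional ancillas and trace preservation give positivity with
arbitrary ancillas: positivity is tested on finite sections, and the trace is summed blockwise. -/
theorem IsChannel.isCP {Φ : OpMap α β} (h : IsChannel Φ) : IsCP Φ := by
  classical
  intro κ T hT
  have hpsd : (ChannelMetric.withId κ Φ T).PosSemidef := by
    refine posSemidef_of_cover fun F => ?_
    let K := F.image Prod.snd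
    let e : ULift.{u} (Fin K.card) ≃ K := Equiv.ulift.trans K.equivFin.symm
    refine ⟨β × ULift.{u} (Fin K.card), Prod.map id (fun i => (e i : κ)), ?_, ?_⟩
    · intro p hp
      refine ⟨(p.1, e.symm ⟨p.2, Finset.mem_image_of_mem _ hp⟩), ?_⟩
      simp [Prod.map]
    · exact (h.1 _ (T.submatrix (Prod.map id (fun i => (e i : κ)))
        (Prod.map id (fun i => (e i : κ)))) (hT.submatrix
          (Function.injective_id.prodMap (Subtype.val_injective.comp e.injective)))).1
  refine isPosTraceClass_of_summable hpsd ?_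
  have h0 : ∀ p : κ × β, 0 ≤ ((ChannelMetric.withId κ Φ T) (p.2, p.1) (p.2, p.1)).re :=
    fun p => diag_re_nonneg hpsd _
  rw [← (Equiv.prodComm κ β).summable_iff]
  refine (summable_prod_of_nonneg h0).2 ⟨fun k => ?_, ?_⟩
  · exact summable_re (h.posTC (block_diag_posTC hT k))
  · have h1 := (hasSum_tr_block hT).summable
    exact h1.congr fun k => (h.tr_eq (block_diag_posTC hT k)).symm

theorem IsChannel.comp {Φ : OpMap β γ} {Ψ : OpMap α β} (h : IsChannel Φ) (h' : IsChannel Ψ) :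
    IsChannel (Φ ∘ₗ Ψ) :=
  (h.isCP.comp h'.isCP).isChannel fun T hT => (h.2 _ (h'.posTC hT)).trans (h'.2 T hT)

theorem IsChannel.withId {Φ : OpMap α β} (h : IsChannel Φ) (κ : Type u) :
    IsChannel (withId κ Φ) := by
  refine (h.isCP.withId κ).isChannel fun T hT => ?_
  have hp := h.isCP κ T hT
  rw [opTrace_eq hT, opTrace_eq hp, ← (hasSum_tr_block hp).tsum_eq, ← (hasSum_tr_block hT).tsum_eq]
  congr 1
  exact tsum_congr fun k => h.tr_eq (block_diag_posTC hT k)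

theorem isChannel_reindex (e : β ≃ α) : IsChannel (reindex e) :=
  (isCP_reindex e.injective).isChannel fun T _ => e.tsum_eq (fun a => T a a)

theorem isChannel_id : IsChannel (LinearMap.id : OpMap α α) := isChannel_reindex (Equiv.refl α)

theorem tensor_eq (Φ : OpMap α α') (Ψ : OpMap β β') :
    tensor Φ Ψ = withId β' Φ ∘ₗ reindex (Equiv.prodComm α β') ∘ₗ withId α Ψ ∘ₗ
      reindex (Equiv.prodComm β α) := rfl

theorem IsChannel.tensor {Φ : OpMap α α'} {Ψ : OpMap β β'} (h : IsChannel Φ) (h' : IsChannel Ψ) :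
    IsChannel (tensor Φ Ψ) := by
  rw [tensor_eq]
  exact (h.withId _).comp ((isChannel_reindex _).comp ((h'.withId _).comp (isChannel_reindex _)))

theorem isChannel_tensorPow {Φ : OpMap α β} (h : IsChannel Φ) : ∀ n, IsChannel (tensorPow Φ n)
  | 0 => isChannel_id
  | n + 1 => h.tensor (isChannel_tensorPow h n)

theorem onMemory_eq (κ : Type u) (L : OpMap (α × γ) (β × γ)) :
    onMemory κ L = reindex (fun x : (β × κ) × γ => ((x.1.1, x.2), x.1.2)) ∘ₗ withId κ L ∘ₗ
      reindex (fun x : (α × γ) × κ => ((x.1.1, x.2), x.1.2)) := rfl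

/-- Exchange of the last two factors of a threefold product. -/
def swapRight (α β γ : Type u) : (α × β) × γ ≃ (α × γ) × β where
  toFun x := ((x.1.1, x.2), x.1.2)
  invFun x := ((x.1.1, x.2), x.1.2)
  left_inv _ := rfl
  right_inv _ := rfl

theorem IsChannel.onMemory {L : OpMap (α × γ) (β × γ)} (h : IsChannel L) (κ : Type u) :
    IsChannel (onMemory κ L) := by
  rw [onMemory_eq]
  exact (isChannel_reindex (swapRight β κ γ)).comp
    ((h.withId κ).comp (isChannel_reindex (swapRight α γ κ)))

theorem tensor_kron (Φ : OpMap α α') (Ψ : OpMap β β') (A : Op α) (B : Op β) :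
    tensor Φ Ψ (A ⊗ₖ B) = Φ A ⊗ₖ Ψ B := by
  ext x y
  have h1 : ∀ a a', Ψ (Matrix.of fun b b' => (A ⊗ₖ B) (a, b) (a', b')) x.2 y.2 =
      (Ψ B x.2 y.2) * A a a' := by
    intro a a'
    have : (Matrix.of fun b b' => (A ⊗ₖ B) (a, b) (a', b')) = A a a' • B := rfl
    rw [this, map_smul, Matrix.smul_apply, smul_eq_mul, mul_comm]
  have h2 : (Matrix.of fun a a' => Ψ (Matrix.of fun b b' => (A ⊗ₖ B) (a, b) (a', b')) x.2 y.2) =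
      (Ψ B x.2 y.2) • A := by
    ext a a'; exact h1 a a'
  change Φ (Matrix.of fun a a' => Ψ (Matrix.of fun b b' => (A ⊗ₖ B) (a, b) (a', b')) x.2 y.2)
    x.1 y.1 = _
  rw [h2, map_smul, Matrix.smul_apply, smul_eq_mul, mul_comm]; rfl

theorem withId_kron (Φ : OpMap α α') (A : Op α) (B : Op κ) :
    withId κ Φ (A ⊗ₖ B) = Φ A ⊗ₖ B := tensor_kron Φ LinearMap.id A B

theorem IsChannel.mem_TC {Φ : OpMap α β} (h : IsChannel Φ) {T : Op α} (hT : T ∈ TC α) :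
    Φ T ∈ TC β := map_mem_TC (fun _ h' => (h.posTC h').mem_TC) hT

theorem IsChannel.trFun_eq {Φ : OpMap α β} (h : IsChannel Φ) {T : Op α} (hT : T ∈ TC α) :
    trFun β (Φ T) = trFun α T :=
  map_eqOn_TC (f := trFun β ∘ₗ Φ) (g := trFun α) (fun S hS => by
    rw [LinearMap.comp_apply, trFun_eq_of_mem_TC (h.posTC hS).mem_TC,
      trFun_eq_of_mem_TC hS.mem_TC, h.2 S hS]) hT

/-- A limit of positive matrices is positive. -/
theorem posSemidef_of_tendsto {s : Type*} {l : Filter s} [l.NeBot] {S : s → Op α} {T : Op α}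
    (hS : ∀ i, (S i).PosSemidef) (h : ∀ a b, Tendsto (fun i => S i a b) l (𝓝 (T a b))) :
    T.PosSemidef := by
  refine ⟨?_, fun x => ?_⟩
  · ext a b
    have h1 := (h b a).star
    have h2 := h a b
    refine tendsto_nhds_unique h1 (h2.congr fun i => ?_)
    exact ((hS i).1.apply a b).symm
  · refine ge_of_tendsto' (f := fun i => x.sum fun a xa => x.sum fun b xb => star xa * S i a b * xb)
      (x := l) ?_ fun i => (hS i).2 x
    refine tendsto_finsetSum _ fun a _ => tendsto_finsetSum _ fun b _ => ?_
    exact ((h a b).const_mul _).mul_const _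

/-- The trace, as a channel to a trivial system. -/
def trCh (α : Type u) : OpMap α PUnit where
  toFun T := Matrix.of fun _ _ => trFun α T
  map_add' S T := by ext; simp
  map_smul' c T := by ext; simp

theorem trCh_apply (T : Op α) (x y : PUnit) : trCh α T x y = trFun α T := rfl

theorem summable_block_left {T : Op (α × κ)} (hT : IsPosTraceClass T) (k k' : κ) :
    Summable fun a => T (a, k) (a, k') :=
  summable_block (hT.submatrix (e := (Equiv.prodComm κ α)) (Equiv.injective _)) k k'

/-- Complete positivity: with an ancilla, the trace is the limit of the partial sums of the diagonal
blocks. -/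
theorem isChannel_trCh (α : Type u) : IsChannel (trCh α) := by
  have key : ∀ (κ : Type u) (T : Op (α × κ)), IsPosTraceClass T →
      ∀ x y : PUnit × κ, HasSum (fun a => T (a, x.2) (a, y.2)) (withId κ (trCh α) T x y) := by
    intro κ T hT x y
    rw [withId_apply, trCh_apply, trFun_eq]
    · exact (summable_block_left hT x.2 y.2).hasSum
    · exact summable_block_left hT x.2 y.2
  refine IsCP.isChannel (fun κ T hT => ?_) fun T hT => ?_
  · have hpsd : (withId κ (trCh α) T).PosSemidef := by
      refine posSemidef_of_tendsto (l := atTop) (S := fun F : Finset α => ∑ a ∈ F,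
        T.submatrix (fun x : PUnit × κ => (a, x.2)) (fun x => (a, x.2))) (fun F => ?_) ?_
      · exact Matrix.posSemidef_sum _ fun a _ => hT.1.submatrix _
      · intro x y
        refine (key κ T hT x y).congr fun F => ?_
        rw [Matrix.sum_apply]; rfl
    refine isPosTraceClass_of_summable hpsd ?_
    have h1 := (hasSum_tr_block hT).summable
    refine ((Equiv.punitProd κ).symm.summable_iff).1 (h1.congr fun k => ?_)
    have h2 := Complex.hasSum_re (key κ T hT (PUnit.unit, k) (PUnit.unit, k))
    exact h2.tsum_eq
  · unfold opTrace
    rw [tsum_fintype]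
    simp [trCh_apply, trFun_eq hT.2, opTrace]

/-- Adjoining a system in the state `ω`. -/
def append (α : Type u) (ω : Op β) : OpMap α (α × β) where
  toFun T := T ⊗ₖ ω
  map_add' S T := Matrix.add_kronecker S T ω
  map_smul' c T := Matrix.smul_kronecker c T ω

theorem append_apply (ω : Op β) (T : Op α) : append α ω T = T ⊗ₖ ω := rfl

theorem isChannel_append (α : Type u) {ω : Op β} (hω : IsDensity ω) :
    IsChannel (append α ω) := by
  refine IsCP.isChannel (fun κ T hT => ?_) fun T hT => ?_
  · exact (hT.kron hω.1).submatrix (swapRight α β κ).injective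
  · rw [append_apply, opTrace_kron hT hω.1, hω.2, mul_one]

/-- Discarding the system and preparing the state `ω` instead. -/
def prep (α : Type u) (ω : Op β) : OpMap α β :=
  reindex (Equiv.punitProd β).symm ∘ₗ append PUnit ω ∘ₗ trCh α

theorem isChannel_prep (α : Type u) {ω : Op β} (hω : IsDensity ω) : IsChannel (prep α ω) :=
  (isChannel_reindex _).comp ((isChannel_append _ hω).comp (isChannel_trCh α))

/-- The partial trace over the second factor, as a linear map on all matrices. -/
def ptr (α κ : Type u) : OpMap (α × κ) α :=
  reindex (fun a => (PUnit.unit, a)) ∘ₗ withId α (trCh κ) ∘ₗ reindex (Equiv.prodComm κ α)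

theorem ptr_apply (T : Op (α × κ)) (a b : α) :
    ptr α κ T a b = trFun κ (Matrix.of fun w w' => T (a, w) (b, w')) := rfl

theorem isChannel_ptr (α κ : Type u) : IsChannel (ptr α κ) :=
  (isChannel_reindex (Equiv.punitProd α).symm).comp
    (((isChannel_trCh κ).withId α).comp (isChannel_reindex _))

theorem ptr_eq_partialTrace {T : Op (α × κ)} (hT : IsPosTraceClass T) :
    ptr α κ T = partialTrace T := by
  ext a b
  rw [ptr_apply, trFun_eq (summable_block hT a b)]; rfl

theorem ptr_kron (A : Op α) (B : Op κ) : ptr α κ (A ⊗ₖ B) = trFun κ B • A := by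
  ext a b
  rw [ptr_apply]
  have : (Matrix.of fun w w' => (A ⊗ₖ B) (a, w) (b, w')) = A a b • B := rfl
  rw [this, map_smul, Matrix.smul_apply, smul_eq_mul, smul_eq_mul, mul_comm]

/-! ### Enlarging a system and restricting to a subsystem -/

open Classical in
/-- Extension by zero along an injection of index sets. -/
def extZ (e : α → β) : OpMap α β where
  toFun T := Matrix.of fun x y =>
    if h : (∃ a, e a = x) ∧ (∃ b, e b = y) then T h.1.choose h.2.choose else 0
  map_add' S T := by
    ext x y
    simp only [Matrix.of_apply, Matrix.add_apply]
    split_ifs <;> simp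
  map_smul' c T := by
    ext x y
    simp only [Matrix.of_apply, Matrix.smul_apply, RingHom.id_apply]
    split_ifs <;> simp

theorem extZ_apply {e : α → β} (he : Function.Injective e) (T : Op α) (a b : α) :
    extZ e T (e a) (e b) = T a b := by
  have h : (∃ a', e a' = e a) ∧ (∃ b', e b' = e b) := ⟨⟨a, rfl⟩, ⟨b, rfl⟩⟩
  refine (dif_pos h).trans ?_
  rw [he h.1.choose_spec, he h.2.choose_spec]

theorem extZ_apply_left {e : α → β} (T : Op α) {x : β} (hx : x ∉ Set.range e) (y : β) :
    extZ e T x y = 0 := dif_neg fun h => hx h.1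

theorem extZ_apply_right {e : α → β} (T : Op α) (x : β) {y : β} (hy : y ∉ Set.range e) :
    extZ e T x y = 0 := dif_neg fun h => hy h.2

theorem posTC_extZ {e : α → β} (he : Function.Injective e) {T : Op α} (hT : IsPosTraceClass T) :
    IsPosTraceClass (extZ e T) ∧ opTrace (extZ e T) = opTrace T := by
  classical
  have hs : HasSum (fun x => extZ e T x x) (opTrace T) := by
    refine (he.hasSum_iff (fun x hx => extZ_apply_left T hx x)).1 ?_
    refine hT.2.hasSum.congr_fun fun a => ?_
    exact extZ_apply he T a a
  refine ⟨⟨?_, hs.summable⟩, hs.tsum_eq⟩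
  have h := posSemidef_sandwich hT.1 fun x : β =>
    if h : ∃ a, e a = x then Finsupp.single h.choose (1 : ℂ) else 0
  convert h using 1
  ext x y
  rw [Matrix.of_apply]
  by_cases hx : ∃ a, e a = x
  · by_cases hy : ∃ b, e b = y
    · obtain ⟨a, rfl⟩ := hx
      obtain ⟨b, rfl⟩ := hy
      have h1 : (∃ a', e a' = e a) := ⟨a, rfl⟩
      have h2 : (∃ a', e a' = e b) := ⟨b, rfl⟩
      rw [extZ_apply he, dif_pos h1, dif_pos h2, sesq_single, he h1.choose_spec,
        he h2.choose_spec]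
      simp
    · rw [extZ_apply_right T x hy, dif_neg hy, sesq_zero_right]
  · rw [extZ_apply_left T hx, dif_neg hx, sesq_zero_left]

theorem withId_extZ {e : α → β} (he : Function.Injective e) (T : Op (α × κ)) :
    withId κ (extZ e) T = extZ (Prod.map e (id : κ → κ)) T := by
  have hi : Function.Injective (Prod.map e (id : κ → κ)) := he.prodMap Function.injective_id
  ext ⟨x, k⟩ ⟨y, k'⟩
  rw [withId_apply]
  by_cases hx : x ∈ Set.range e
  · by_cases hy : y ∈ Set.range e
    · obtain ⟨a, rfl⟩ := hx
      obtain ⟨b, rfl⟩ := hy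
      exact (extZ_apply he _ a b).trans (extZ_apply hi T (a, k) (b, k')).symm
    · rw [extZ_apply_right _ _ hy, extZ_apply_right]
      rintro ⟨p, hp⟩
      exact hy ⟨p.1, congrArg Prod.fst hp⟩
  · rw [extZ_apply_left _ hx, extZ_apply_left]
    rintro ⟨p, hp⟩
    exact hx ⟨p.1, congrArg Prod.fst hp⟩

theorem isChannel_extZ {e : α → β} (he : Function.Injective e) : IsChannel (extZ e) := by
  refine IsCP.isChannel (fun κ T hT => ?_) fun T hT => (posTC_extZ he hT).2
  rw [withId_extZ he]
  exact (posTC_extZ (he.prodMap Function.injective_id) hT).1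

/-- A left inverse of `extZ e`: restriction to the range of `e`, with the weight outside the range
moved to the state `ω`. -/
def retract (e : α → β) (ω : Op α) : OpMap β α :=
  reindex e + prep {x // x ∉ Set.range e} ω ∘ₗ reindex Subtype.val

theorem isChannel_retract {e : α → β} (he : Function.Injective e) {ω : Op α} (hω : IsDensity ω) :
    IsChannel (retract e ω) := by
  have hp := isChannel_prep {x // x ∉ Set.range e} hω
  have h1 := isCP_reindex he
  have h2 := isCP_reindex (Subtype.val_injective (p := fun x => x ∉ Set.range e))
  refine IsCP.isChannel (h1.add (hp.isCP.comp h2)) fun T hT => ?_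
  have e1 : opTrace (retract e ω T) = opTrace (reindex e T) + opTrace (prep _ ω (reindex
      (Subtype.val : {x // x ∉ Set.range e} → β) T)) :=
    Summable.tsum_add (h1.posTC hT).2 ((hp.isCP.comp h2).posTC hT).2
  rw [e1, hp.2 _ (h2.posTC hT)]
  have h3 : HasSum (fun x : Set.range e => T x x) (opTrace (reindex e T)) := by
    rw [← (Equiv.ofInjective e he).hasSum_iff]
    exact (h1.posTC hT).2.hasSum
  have h4 : HasSum (fun x : ((Set.range e)ᶜ : Set β) => T x x) (opTrace (reindex
      (Subtype.val : {x // x ∉ Set.range e} → β) T)) := (h2.posTC hT).2.hasSum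
  exact (h3.add_compl h4).unique hT.2.hasSum

theorem retract_extZ {e : α → β} (he : Function.Injective e) (ω T : Op α) :
    retract e ω (extZ e T) = T := by
  have : reindex (Subtype.val : {x // x ∉ Set.range e} → β) (extZ e T) = 0 := by
    ext x y
    exact extZ_apply_left T x.2 y
  rw [retract, LinearMap.add_apply, LinearMap.comp_apply, this, map_zero, add_zero]
  ext a b
  exact extZ_apply he T a b

/-! ### Measurements with finitely many outcomes -/

/-- Compression of a block matrix by a vector of the second factor. -/
theorem posTC_compress {T : Op (α × κ)} (hT : IsPosTraceClass T) (x : κ →₀ ℂ) :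
    IsPosTraceClass (x.sum fun k c => x.sum fun k' c' => (star c * c') • block T k k') := by
  constructor
  · have h := posSemidef_sandwich hT.1 fun a : α =>
      ∑ k ∈ x.support, x k • Finsupp.single (a, k) (1 : ℂ)
    convert h using 1
    ext a b
    rw [Matrix.of_apply]
    simp only [sesq_sum_left, sesq_sum_right, sesq_smul_left, sesq_smul_right, sesq_single,
      Finsupp.sum, Matrix.sum_apply, Matrix.smul_apply, block, Matrix.of_apply,
      Finset.sum_mul]
    rw [Finset.sum_comm]
    refine Finset.sum_congr rfl fun k _ => Finset.sum_congr rfl fun k' _ => ?_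
    simp [mul_comm, mul_left_comm]
  · simp only [Finsupp.sum, Matrix.sum_apply, Matrix.smul_apply]
    exact summable_sum fun k _ => summable_sum fun k' _ =>
      (summable_block_left hT k k').mul_left _

theorem posSemidef_of_sesq_nonneg {T : Op α} (h : ∀ x, 0 ≤ sesq T x x) : T.PosSemidef := by
  refine ⟨?_, h⟩
  have him : ∀ x, (sesq T x x).im = 0 := fun x => ((Complex.le_def.1 (h x)).2).symm
  ext i j
  have hi := him (Finsupp.single i 1)
  have hj := him (Finsupp.single j 1)
  have h1 := him (Finsupp.single i 1 + Finsupp.single j 1)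
  have h2 := him (Finsupp.single i 1 + Finsupp.single j Complex.I)
  simp only [sesq_add_left, sesq_add_right, sesq_single] at hi hj h1 h2
  simp at hi hj h1 h2
  rw [Matrix.conjTranspose_apply]
  apply Complex.ext <;> simp <;> linarith

/-- The channel that performs the measurement with effects `φ s` and records the outcome in the
diagonal of a matrix. -/
def record {N : Type u} [DecidableEq N] (φ : N → Op α →ₗ[ℂ] ℂ) : OpMap α N where
  toFun T := Matrix.diagonal fun s => φ s T
  map_add' S T := by
    rw [Matrix.diagonal_add]; congr 1; ext s; simp
  map_smul' c T := by
    rw [RingHom.id_apply, ← Matrix.diagonal_smul]; congr 1; ext s; simp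

/-- Positivity of the functionals `φ s` is complete positivity, since a block matrix is tested on
its compressions by vectors of the ancilla. -/
theorem isChannel_record {N : Type u} [DecidableEq N] [Fintype N] {φ : N → Op α →ₗ[ℂ] ℂ}
    (h0 : ∀ s T, IsPosTraceClass T → 0 ≤ φ s T)
    (h1 : ∀ T, IsPosTraceClass T → ∑ s, φ s T = opTrace T) : IsChannel (record φ) := by
  have htr : IsTP (record φ) := by
    intro T hT
    rw [← h1 T hT, opTrace, tsum_fintype]
    simp [record]
  refine ⟨fun n T hT => ?_, htr⟩
  have hm : ∀ s, (Matrix.of fun k k' => φ s (block T k k') :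
      Op (ULift.{u} (Fin n))).PosSemidef := by
    intro s
    have hx : ∀ x : ULift.{u} (Fin n) →₀ ℂ,
        0 ≤ sesq (Matrix.of fun k k' => φ s (block T k k')) x x := by
      intro x
      have h := h0 s _ (posTC_compress hT x)
      simp only [Finsupp.sum, map_sum, map_smul] at h
      refine h.trans_eq ?_
      refine Finset.sum_congr rfl fun k _ => Finset.sum_congr rfl fun k' _ => ?_
      simp [mul_comm, mul_left_comm]
    exact posSemidef_of_sesq_nonneg hx
  refine isPosTraceClass_of_summable ?_ ?_
  · -- the matrix is the sum over `t` of copies of the positive matrices `φ t (block T k k')`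
    have h2 : (∑ t : N, Matrix.of fun y y' : N × ULift.{u} (Fin n) =>
        sesq (Matrix.of fun k k' => φ t (block T k k'))
          (if y.1 = t then Finsupp.single y.2 1 else 0)
          (if y'.1 = t then Finsupp.single y'.2 1 else 0)).PosSemidef :=
      Matrix.posSemidef_sum _ fun t _ => posSemidef_sandwich (hm t) _
    convert h2 using 1
    ext ⟨s, k⟩ ⟨s', k'⟩
    rw [withId_apply, Matrix.sum_apply, Finset.sum_eq_single s]
    · by_cases h : s' = s
      · subst h; simp [record]
      · simp [record, h, Ne.symm h]
    · intro t _ ht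
      simp [Ne.symm ht]
    · simp
  · exact (hasSum_fintype _).summable

end

section

variable {α α' α'' β β' γ κ κ' : Type u}

/-! ### Tangent vectors -/

/-- Compression of a block matrix by the vector `e_k + c e_k'` of the second factor. -/
theorem posTC_pair {T : Op (α × κ)} (hT : IsPosTraceClass T) (k k' : κ) (c : ℂ) :
    IsPosTraceClass (block T k k + c • block T k k' + star c • block T k' k +
      (star c * c) • block T k' k') := by
  constructor
  · have h := posSemidef_sandwich hT.1 fun a : α =>
      Finsupp.single (a, k) (1 : ℂ) + c • Finsupp.single (a, k') (1 : ℂ)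
    convert h using 1
    ext a b
    simp only [sesq_add_left, sesq_add_right, sesq_smul_left, sesq_smul_right, sesq_single,
      Matrix.add_apply, Matrix.smul_apply, block, Matrix.of_apply]
    simp
    ring
  · have h := fun k k' => summable_block_left hT k k'
    exact (((h k k).add ((h k k').mul_left _)).add ((h k' k).mul_left _)).add
      ((h k' k').mul_left _)

/-- The blocks of a trace class operator are of trace class, by polarization. -/
theorem block_mem_TC {T : Op (α × κ)} (hT : T ∈ TC (α × κ)) (k k' : κ) : block T k k' ∈ TC α := by
  let f : OpMap (α × κ) α :=
    { toFun := fun T => block T k k', map_add' := fun _ _ => rfl, map_smul' := fun _ _ => rfl }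
  refine map_mem_TC (f := f) (fun T hT => ?_) hT
  have h := fun c => (posTC_pair hT k k' c).mem_TC
  have h2 := (TC α).smul_mem (1 / 4 : ℂ) ((TC α).add_mem ((TC α).sub_mem (h 1) (h (-1)))
    ((TC α).smul_mem Complex.I ((TC α).sub_mem (h (-Complex.I)) (h Complex.I))))
  convert h2 using 1
  change block T k k' = _
  ext a b
  simp [block]
  ring_nf
  simp [Complex.I_sq]
  ring

/-- The map `Δ`, with any ancilla, sends trace class operators to trace class operators of trace
zero. -/
def IsTZ (Δ : OpMap α β) : Prop :=
  ∀ (κ : Type u) (T : Op (α × κ)), T ∈ TC (α × κ) →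
    withId κ Δ T ∈ TC (β × κ) ∧ trFun _ (withId κ Δ T) = 0

/-- Maps that agree on states agree on the trace class, also in the presence of an ancilla. -/
theorem withId_eqOn_TC {Φ Ψ : OpMap α β} (h : ∀ ρ, IsDensity ρ → Φ ρ = Ψ ρ)
    {T : Op (α × κ)} (hT : T ∈ TC (α × κ)) : withId κ Φ T = withId κ Ψ T := by
  ext x y
  rw [withId_apply, withId_apply]
  refine congrFun (congrFun ?_ x.1) y.1
  refine map_eqOn_TC (f := Φ) (g := Ψ) (fun S hS => ?_) (block_mem_TC hT _ _)
  rcases isEmpty_or_nonempty α with hα | hα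
  · rw [Subsingleton.elim S 0, map_zero, map_zero]
  · obtain ⟨ρ, hρ, e⟩ := exists_density_of_isPosTraceClass hS
    rw [e, map_smul, map_smul, h ρ hρ]

theorem IsTangent.isTZ {Δ : OpMap α β} (h : IsTangent Δ) : IsTZ Δ := by
  obtain ⟨c, Φ₁, Φ₂, h1, h2, h3⟩ := h
  intro κ T hT
  have e : withId κ Δ T = (c : ℂ) • (withId κ Φ₁ T - withId κ Φ₂ T) :=
    withId_eqOn_TC (Ψ := (c : ℂ) • (Φ₁ - Φ₂)) h3 hT
  rw [e]
  refine ⟨(TC _).smul_mem _ ((TC _).sub_mem ((h1.withId κ).mem_TC hT) ((h2.withId κ).mem_TC hT)),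
    ?_⟩
  rw [map_smul, map_sub, (h1.withId κ).trFun_eq hT, (h2.withId κ).trFun_eq hT, sub_self, smul_zero]

theorem IsTZ.add {Δ Δ' : OpMap α β} (h : IsTZ Δ) (h' : IsTZ Δ') : IsTZ (Δ + Δ') := by
  intro κ T hT
  have e : ChannelMetric.withId κ (Δ + Δ') T = withId κ Δ T + withId κ Δ' T := rfl
  rw [e, map_add, (h κ T hT).2, (h' κ T hT).2, add_zero]
  exact ⟨(TC _).add_mem (h κ T hT).1 (h' κ T hT).1, rfl⟩

theorem isTZ_zero : IsTZ (0 : OpMap α β) := by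
  intro κ T hT
  have e : withId κ (0 : OpMap α β) T = 0 := rfl
  rw [e, map_zero]
  exact ⟨(TC _).zero_mem, rfl⟩

theorem IsTZ.comp_channel {Δ : OpMap β γ} (h : IsTZ Δ) {C : OpMap α β} (hC : IsChannel C) :
    IsTZ (Δ ∘ₗ C) := fun κ _ hT => h κ _ ((hC.withId κ).mem_TC hT)

theorem IsChannel.comp_isTZ {C : OpMap β γ} (hC : IsChannel C) {Δ : OpMap α β} (h : IsTZ Δ) :
    IsTZ (C ∘ₗ Δ) := by
  intro κ T hT
  have e : ChannelMetric.withId κ (C ∘ₗ Δ) T =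
      ChannelMetric.withId κ C (ChannelMetric.withId κ Δ T) := rfl
  rw [e]
  exact ⟨(hC.withId κ).mem_TC (h κ T hT).1,
    ((hC.withId κ).trFun_eq (h κ T hT).1).trans (h κ T hT).2⟩

theorem IsTZ.withId {Δ : OpMap α β} (h : IsTZ Δ) (κ : Type u) : IsTZ (withId κ Δ) := by
  intro κ' T hT
  have h1 := isChannel_reindex (Equiv.prodAssoc α κ κ').symm
  have h2 := isChannel_reindex (Equiv.prodAssoc β κ κ')
  have h3 := h (κ × κ') _ (h1.mem_TC hT)
  exact ⟨h2.mem_TC h3.1, (h2.trFun_eq h3.1).trans h3.2⟩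

theorem IsTZ.tensor_left {Δ : OpMap α α'} (h : IsTZ Δ) {Φ : OpMap β β'} (hΦ : IsChannel Φ) :
    IsTZ (tensor Δ Φ) := by
  rw [tensor_eq]
  exact (h.withId _).comp_channel ((isChannel_reindex (Equiv.prodComm _ _)).comp
    ((hΦ.withId _).comp (isChannel_reindex (Equiv.prodComm _ _))))

theorem IsTZ.tensor_right {Δ : OpMap β β'} (h : IsTZ Δ) {Φ : OpMap α α'} (hΦ : IsChannel Φ) :
    IsTZ (tensor Φ Δ) := by
  rw [tensor_eq]
  exact (hΦ.withId _).comp_isTZ ((isChannel_reindex (Equiv.prodComm _ _)).comp_isTZ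
    ((h.withId _).comp_channel (isChannel_reindex (Equiv.prodComm _ _))))

theorem isTZ_tensorDeriv {Φ Δ : OpMap α β} (hΦ : IsChannel Φ) (hΔ : IsTZ Δ) :
    ∀ n, IsTZ (tensorDeriv Φ Δ n)
  | 0 => isTZ_zero
  | n + 1 => (hΔ.tensor_left (isChannel_tensorPow hΦ n)).add
      ((isTZ_tensorDeriv hΦ hΔ n).tensor_right hΦ)

theorem IsTZ.mem_TC {Δ : OpMap α β} (h : IsTZ Δ) {T : Op α} (hT : T ∈ TC α) :
    Δ T ∈ TC β ∧ trFun _ (Δ T) = 0 := by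
  have h1 := isChannel_reindex (Equiv.prodPUnit.{u, u} α)
  have h2 := isChannel_reindex (Equiv.prodPUnit.{u, u} β).symm
  have h3 := h PUnit _ (h1.mem_TC hT)
  exact ⟨h2.mem_TC h3.1, (h2.trFun_eq h3.1).trans h3.2⟩

/-! ### Channels are determined by their values on finite sections -/

open Classical in
/-- The section of `T` on the finite index set `F`. -/
def mask (F : Finset α) (T : Op α) : Op α :=
  ∑ a ∈ F, ∑ b ∈ F, T a b • Matrix.single a b (1 : ℂ)

open Classical in
theorem mask_apply (F : Finset α) (T : Op α) (i j : α) :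
    mask F T i j = if i ∈ F ∧ j ∈ F then T i j else 0 := by
  simp only [mask, Matrix.sum_apply, Matrix.smul_apply, Matrix.single_apply, smul_eq_mul]
  by_cases hi : i ∈ F
  · by_cases hj : j ∈ F
    · rw [Finset.sum_eq_single i, Finset.sum_eq_single j] <;> simp +contextual [hi, hj]
    · rw [if_neg (by simp [hj])]
      refine Finset.sum_eq_zero fun a _ => Finset.sum_eq_zero fun b hb => ?_
      rw [if_neg, mul_zero]
      rintro ⟨-, rfl⟩; exact hj hb
  · rw [if_neg (by simp [hi])]
    refine Finset.sum_eq_zero fun a ha => Finset.sum_eq_zero fun b hb => ?_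
    rw [if_neg, mul_zero]
    rintro ⟨rfl, -⟩; exact hi ha

/-- The trace after rescaling by a weight of constant modulus on `F` and on its complement. -/
theorem hasSum_scale {T : Op α} (hT : IsPosTraceClass T) (F : Finset α) [DecidableEq α]
    {w : α → ℝ} {p r : ℝ} (hp : ∀ a ∈ F, w a ^ 2 = p) (hr : ∀ a ∉ F, w a ^ 2 = r) :
    HasSum (fun a => (scale w T a a).re)
      (p * ∑ a ∈ F, (T a a).re + r * (tr T - ∑ a ∈ F, (T a a).re)) := by
  have h1 : HasSum (fun a => if a ∈ F then (T a a).re else 0) (∑ a ∈ F, (T a a).re) := by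
    have : HasSum (fun a => if a ∈ F then (T a a).re else 0)
        (∑ a ∈ F, if a ∈ F then (T a a).re else 0) :=
      hasSum_sum_of_ne_finset_zero fun b hb => if_neg hb
    rwa [Finset.sum_congr rfl (fun a ha => if_pos ha)] at this
  have h2 := (h1.mul_left p).add (((summable_re hT).hasSum.sub h1).mul_left r)
  refine h2.congr_fun fun a => ?_
  have e : (scale w T a a).re = w a ^ 2 * (T a a).re := by
    simp [scale]; ring
  by_cases ha : a ∈ F
  · simp [e, ha, hp a ha]
  · simp [e, ha, hr a ha]

/-- The error of replacing `T` by its section is controlled by the missing weight `τ`; the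
off-diagonal blocks are dominated by `η P T P + η⁻¹ Q T Q`. -/
theorem IsChannel.norm_sub_mask_le {C : OpMap α β} (hC : IsChannel C) {T : Op α}
    (hT : IsPosTraceClass T) (F : Finset α) (i j : β) {η : ℝ} (hη : 0 < η) :
    ‖C T i j - C (mask F T) i j‖ ≤ (tr T - ∑ a ∈ F, (T a a).re) + η * tr T +
      η⁻¹ * (tr T - ∑ a ∈ F, (T a a).re) := by
  classical
  set τ := tr T - ∑ a ∈ F, (T a a).re with hτ
  have hs : 0 < √η := Real.sqrt_pos.2 hη
  have hss : √η ^ 2 = η := Real.sq_sqrt hη.le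
  let w0 : α → ℝ := fun a => if a ∈ F then 0 else 1
  let w1 : α → ℝ := fun a => if a ∈ F then √η else (√η)⁻¹
  let w2 : α → ℝ := fun a => if a ∈ F then √η else -(√η)⁻¹
  have h0 := hasSum_scale hT F (w := w0) (p := 0) (r := 1) (by intro a ha; simp [w0, ha])
    (by intro a ha; simp [w0, ha])
  have h1 := hasSum_scale hT F (w := w1) (p := η) (r := η⁻¹)
    (by intro a ha; simp [w1, ha, hss]) (by intro a ha; simp [w1, ha, hss])
  have h2 := hasSum_scale hT F (w := w2) (p := η) (r := η⁻¹)
    (by intro a ha; simp [w2, ha, hss]) (by intro a ha; simp [w2, ha, hss])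
  have p0 := isPosTraceClass_of_summable (posSemidef_scale hT.1 w0) h0.summable
  have p1 := isPosTraceClass_of_summable (posSemidef_scale hT.1 w1) h1.summable
  have p2 := isPosTraceClass_of_summable (posSemidef_scale hT.1 w2) h2.summable
  have hsc : ((√η : ℝ) : ℂ) ≠ 0 := by exact_mod_cast hs.ne'
  have e : T = mask F T + scale w0 T + (1 / 2 : ℂ) • (scale w1 T - scale w2 T) := by
    ext a b
    simp only [Matrix.add_apply, Matrix.smul_apply, Matrix.sub_apply, mask_apply, scale,
      Matrix.of_apply, w0, w1, w2]
    by_cases ha : a ∈ F <;> by_cases hb : b ∈ F <;> simp [ha, hb] <;> field_simp <;> norm_num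
  have e2 : C T i j - C (mask F T) i j =
      C (scale w0 T) i j + (1 / 2 : ℂ) * (C (scale w1 T) i j - C (scale w2 T) i j) := by
    conv_lhs => rw [e]
    simp only [map_add, map_smul, map_sub, Matrix.add_apply, Matrix.smul_apply, Matrix.sub_apply,
      smul_eq_mul]
    rw [← e]; ring
  have hb : ∀ S, IsPosTraceClass S → ‖C S i j‖ ≤ tr S := fun S hS =>
    (norm_entry_le_tr (hC.posTC hS) i j).trans_eq (hC.tr_eq hS)
  have t0 := hb _ p0
  have t1 := hb _ p1
  have t2 := hb _ p2
  rw [tr, h0.tsum_eq] at t0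
  rw [tr, h1.tsum_eq] at t1
  rw [tr, h2.tsum_eq] at t2
  have hF : ∑ a ∈ F, (T a a).re ≤ tr T := sum_diag_le_tr hT F
  have hFη := mul_le_mul_of_nonneg_left hF hη.le
  rw [e2]
  refine (norm_add_le _ _).trans ?_
  rw [norm_mul]
  have t3 := norm_sub_le (C (scale w1 T) i j) (C (scale w2 T) i j)
  have : ‖(1 / 2 : ℂ)‖ = 1 / 2 := by norm_num
  rw [this]
  linarith

/-- Channels are normal: a positive trace class operator is exhausted by its finite sections. -/
theorem IsChannel.tendsto_mask {C : OpMap α β} (hC : IsChannel C) {T : Op α}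
    (hT : IsPosTraceClass T) {F : ℕ → Finset α}
    (hF : Tendsto (fun n => ∑ a ∈ F n, (T a a).re) atTop (𝓝 (tr T))) (i j : β) :
    Tendsto (fun n => C (mask (F n) T) i j) atTop (𝓝 (C T i j)) := by
  rw [Metric.tendsto_atTop']
  intro ε hε
  have hT0 := tr_nonneg hT.1
  set η := ε / (2 * (tr T + 1)) with hη
  have hη0 : 0 < η := by positivity
  have h1 : Tendsto (fun n => (1 + η⁻¹) * (tr T - ∑ a ∈ F n, (T a a).re)) atTop (𝓝 0) := by
    have := (tendsto_const_nhds (x := tr T)).sub hF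
    rw [sub_self] at this
    simpa using this.const_mul (1 + η⁻¹)
  obtain ⟨N, hN⟩ := ((h1.eventually (gt_mem_nhds (half_pos hε)))).exists_forall_of_atTop
  refine ⟨N, fun n hn => ?_⟩
  rw [dist_comm, dist_eq_norm]
  have h2 := hC.norm_sub_mask_le hT (F n) i j hη0
  have h3 := hN n hn.le
  have h4 : η * tr T ≤ ε / 2 := by
    rw [hη, div_mul_eq_mul_div, div_le_div_iff₀ (by positivity) (by positivity)]
    nlinarith
  linarith

theorem IsChannel.apply_mask (C : OpMap α β) (F : Finset α) (T : Op α) (i j : β) :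
    C (mask F T) i j = ∑ a ∈ F, ∑ b ∈ F,
      T a b * (by classical exact C (Matrix.single a b 1) i j) := by
  classical
  simp only [mask, map_sum, map_smul, Matrix.sum_apply, Matrix.smul_apply, smul_eq_mul]

theorem IsChannel.norm_mask_le {C : OpMap α β} (hC : IsChannel C) {T : Op α}
    (hT : IsPosTraceClass T) (F : Finset α) (i j : β) : ‖C (mask F T) i j‖ ≤ tr T := by
  classical
  let w : α → ℝ := fun a => if a ∈ F then 1 else 0
  have h0 := hasSum_scale hT F (w := w) (p := 1) (r := 0) (by intro a ha; simp [w, ha])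
    (by intro a ha; simp [w, ha])
  have p0 := isPosTraceClass_of_summable (posSemidef_scale hT.1 w) h0.summable
  have e : mask F T = scale w T := by
    ext a b
    rw [mask_apply]
    by_cases ha : a ∈ F <;> by_cases hb : b ∈ F <;> simp [w, scale, ha, hb]
  rw [e]
  refine (norm_entry_le_tr (hC.posTC p0) i j).trans ((hC.tr_eq p0).trans_le ?_)
  rw [tr, h0.tsum_eq]
  linarith [sum_diag_le_tr hT F]

end

section

variable {α β γ κ : Type u} {X : Type u} [MeasurableSpace X]

/-! ### Mixtures of states -/

/-- `σ` is an (entrywise measurable) family of states with average state `S`. -/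
structure IsMixture (q : Measure X) (σ : X → Op α) (S : Op α) : Prop where
  density : ∀ x, IsDensity (σ x)
  meas : ∀ i j, AEMeasurable (fun x => σ x i j) q
  avg : IsDensity S
  eq : ∀ i j, S i j = ∫ x, σ x i j ∂q

/-- The matrix `∫ h(x) σ_x dq(x)`, entry by entry. -/
def wavg (q : Measure X) (h : X → ℝ) (σ : X → Op α) : Op α :=
  Matrix.of fun i j => ∫ x, (h x : ℂ) * σ x i j ∂q

theorem IsDensity.norm_entry_le_one {ρ : Op α} (h : IsDensity ρ) (i j : α) : ‖ρ i j‖ ≤ 1 :=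
  (norm_entry_le_tr h.1 i j).trans_eq h.tr_eq

theorem integrable_weight {q : Measure X} {h : X → ℝ} (hh : Integrable h q) {f : X → ℂ}
    (hf : AEMeasurable f q) (hb : ∀ x, ‖f x‖ ≤ 1) : Integrable (fun x => (h x : ℂ) * f x) q :=
  (hh.ofReal (𝕜 := ℂ)).mul_bdd (c := 1) hf.aestronglyMeasurable (ae_of_all _ hb)

variable {q : Measure X} {σ : X → Op α} {S : Op α}

theorem IsMixture.integrable (H : IsMixture q σ S) {h : X → ℝ} (hh : Integrable h q) (i j : α) :
    Integrable (fun x => (h x : ℂ) * σ x i j) q :=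
  integrable_weight hh (H.meas i j) fun x => (H.density x).norm_entry_le_one i j

theorem IsMixture.integrable_entry [IsProbabilityMeasure q] (H : IsMixture q σ S) (i j : α) :
    Integrable (fun x => σ x i j) q := by
  simpa using H.integrable (integrable_const (1 : ℝ)) i j

theorem IsMixture.wavg_diag_re (H : IsMixture q σ S) {h : X → ℝ} (hh : Integrable h q) (i : α) :
    (wavg q h σ i i).re = ∫ x, h x * (σ x i i).re ∂q := by
  have := integral_re (H.integrable hh i i)
  simp only [RCLike.re_eq_complex_re] at this
  rw [wavg, Matrix.of_apply, ← this]
  congr 1; ext x; simp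

theorem IsMixture.posTC_wavg (H : IsMixture q σ S) {h : X → ℝ} (hh : Integrable h q)
    (h0 : ∀ x, 0 ≤ h x) : IsPosTraceClass (wavg q h σ) := by
  have hpsd : (wavg q h σ).PosSemidef := by
    refine posSemidef_of_sesq_nonneg fun v => ?_
    have e : sesq (wavg q h σ) v v = ∫ x, (h x : ℂ) * sesq (σ x) v v ∂q := by
      simp only [sesq, Finsupp.sum, Finset.mul_sum]
      rw [integral_finsetSum]
      · refine Finset.sum_congr rfl fun i _ => ?_
        rw [integral_finsetSum]
        · refine Finset.sum_congr rfl fun j _ => ?_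
          rw [wavg, Matrix.of_apply, ← integral_const_mul, ← integral_mul_const]
          congr 1; ext x; ring
        · intro j _
          convert ((H.integrable hh i j).const_mul (star (v i))).mul_const (v j) using 1
          ext x; ring
      · intro i _
        refine integrable_finsetSum _ fun j _ => ?_
        refine (((H.integrable hh i j).const_mul (star (v i))).mul_const (v j)).congr ?_
        exact ae_of_all _ fun x => by ring
    have e2 : ∀ x, (h x : ℂ) * sesq (σ x) v v = ((h x * (sesq (σ x) v v).re : ℝ) : ℂ) := by
      intro x
      have := Complex.le_def.1 ((H.density x).1.1.2 v)
      change (0 : ℂ).re ≤ (sesq (σ x) v v).re ∧ (0 : ℂ).im = (sesq (σ x) v v).im at this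
      have e3 : sesq (σ x) v v = ((sesq (σ x) v v).re : ℂ) :=
        Complex.ext rfl (by simpa using this.2.symm)
      rw [Complex.ofReal_mul, ← e3]
    rw [e]
    simp only [e2]
    rw [integral_complex_ofReal]
    refine Complex.zero_le_real.2 (integral_nonneg fun x => mul_nonneg (h0 x) ?_)
    exact (Complex.le_def.1 ((H.density x).1.1.2 v)).1
  refine isPosTraceClass_of_summable hpsd ?_
  refine summable_of_sum_le (c := ∫ x, h x ∂q) (fun i => diag_re_nonneg hpsd i) fun F => ?_
  simp only [H.wavg_diag_re hh]
  have hi : ∀ i, Integrable (fun x => h x * (σ x i i).re) q := fun i => by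
    have := (H.integrable hh i i).re
    simpa using this
  rw [← integral_finsetSum _ fun i _ => hi i]
  refine integral_mono (integrable_finsetSum _ fun i _ => hi i) hh fun x => ?_
  have := sum_diag_le_tr (H.density x).1 F
  rw [(H.density x).tr_eq] at this
  simp only [← Finset.mul_sum]
  exact mul_le_of_le_one_right (h0 x) this

/-- The members of a mixture are, almost surely, exhausted by one sequence of finite sections:
this is where it matters that the average of the mixture again has trace one. -/
theorem IsMixture.exists_exhaustion [IsProbabilityMeasure q] (H : IsMixture q σ S) :
    ∃ F : ℕ → Finset α, ∀ᵐ x ∂q, Tendsto (fun n => ∑ a ∈ F n, (σ x a a).re) atTop (𝓝 1) := by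
  have hS : HasSum (fun a => (S a a).re) 1 := by
    have := (summable_re H.avg.1).hasSum
    rwa [show ∑' a, (S a a).re = 1 from H.avg.tr_eq] at this
  have hex : ∀ n : ℕ, ∃ F : Finset α, 1 - 1 / ((n : ℝ) + 1) < ∑ a ∈ F, (S a a).re := fun n =>
    (hS.eventually (lt_mem_nhds (by have : 0 < 1 / ((n : ℝ) + 1) := by positivity
                                    linarith))).exists
  choose F hF using hex
  let f : ℕ → X → ℝ := fun n x => ∑ a ∈ F n, (σ x a a).re
  have hre : ∀ a, Integrable (fun x => (σ x a a).re) q := fun a => (H.integrable_entry a a).re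
  have hf : ∀ n, Integrable (f n) q := fun n => integrable_finsetSum _ fun a _ => hre a
  have hf1 : ∀ n x, f n x ≤ 1 := fun n x => by
    have := sum_diag_le_tr (H.density x).1 (F n)
    rwa [(H.density x).tr_eq] at this
  have hint : ∀ n, ∫ x, f n x ∂q = ∑ a ∈ F n, (S a a).re := by
    intro n
    rw [integral_finsetSum _ fun a _ => hre a]
    refine Finset.sum_congr rfl fun a _ => ?_
    have := integral_re (H.integrable_entry a a)
    simp only [RCLike.re_eq_complex_re] at this
    rw [this, ← H.eq]
  have hm : TendstoInMeasure q f atTop fun _ => 1 := by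
    refine tendstoInMeasure_of_tendsto_eLpNorm (p := 1) one_ne_zero
      (fun n => (hf n).aestronglyMeasurable) aestronglyMeasurable_const ?_
    have e : ∀ n, eLpNorm (f n - fun _ => (1 : ℝ)) 1 q =
        ENNReal.ofReal (1 - ∑ a ∈ F n, (S a a).re) := by
      intro n
      rw [eLpNorm_one_eq_lintegral_enorm]
      have : ∀ x, ‖(f n - fun _ => (1 : ℝ) : X → ℝ) x‖ₑ = ENNReal.ofReal (1 - f n x) := by
        intro x
        rw [Pi.sub_apply, ← ofReal_norm, Real.norm_eq_abs, abs_sub_comm,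
          abs_of_nonneg (sub_nonneg.2 (hf1 n x))]
      simp only [this]
      have h1 := ofReal_integral_eq_lintegral_ofReal (f := fun x => 1 - f n x)
        ((integrable_const (1 : ℝ)).sub (hf n)) (ae_of_all q fun x => sub_nonneg.2 (hf1 n x))
      rw [← h1, integral_sub (integrable_const _) (hf n), hint]
      simp
    simp only [e]
    have h0 : Tendsto (fun n : ℕ => ENNReal.ofReal (1 / ((n : ℝ) + 1))) atTop (𝓝 0) := by
      have := ENNReal.tendsto_ofReal (tendsto_one_div_add_atTop_nhds_zero_nat (𝕜 := ℝ))
      simpa using this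
    refine tendsto_of_tendsto_of_tendsto_of_le_of_le tendsto_const_nhds h0 (fun _ => bot_le)
      fun n => ENNReal.ofReal_le_ofReal ?_
    linarith [hF n]
  obtain ⟨ns, -, h⟩ := hm.exists_seq_tendsto_ae
  exact ⟨fun n => F (ns n), h⟩

theorem IsMixture.aemeasurable_map [IsProbabilityMeasure q] (H : IsMixture q σ S)
    {C : OpMap α β} (hC : IsChannel C) (i j : β) : AEMeasurable (fun x => C (σ x) i j) q := by
  obtain ⟨F, hF⟩ := H.exists_exhaustion
  refine aemeasurable_of_tendsto_metrizable_ae atTop (f := fun n x => C (mask (F n) (σ x)) i j)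
    (fun n => ?_) ?_
  · simp only [IsChannel.apply_mask]
    exact Finset.aemeasurable_fun_sum _ fun a _ => Finset.aemeasurable_fun_sum _ fun b _ =>
      (H.meas a b).mul_const _
  · filter_upwards [hF] with x hx
    refine hC.tendsto_mask (H.density x).1 ?_ i j
    rwa [(H.density x).tr_eq]

theorem IsMixture.map_wavg_of_nonneg [IsProbabilityMeasure q] (H : IsMixture q σ S)
    {C : OpMap α β} (hC : IsChannel C) {h : X → ℝ} (hh : Integrable h q) (h0 : ∀ x, 0 ≤ h x) :
    C (wavg q h σ) = wavg q h fun x => C (σ x) := by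
  ext i j
  obtain ⟨F, hF⟩ := H.exists_exhaustion
  have hT := H.posTC_wavg hh h0
  have hi : ∀ i, Integrable (fun x => h x * (σ x i i).re) q := fun i => by
    have := (H.integrable hh i i).re
    simpa using this
  have hsum : ∀ n, ∑ a ∈ F n, (wavg q h σ a a).re = ∫ x, h x * ∑ a ∈ F n, (σ x a a).re ∂q := by
    intro n
    simp only [H.wavg_diag_re hh, Finset.mul_sum]
    rw [integral_finsetSum _ fun i _ => hi i]
  have hlim : Tendsto (fun n => ∑ a ∈ F n, (wavg q h σ a a).re) atTop (𝓝 (∫ x, h x ∂q)) := by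
    simp only [hsum]
    refine tendsto_integral_of_dominated_convergence (fun x => |h x|) (fun n => ?_) hh.abs ?_ ?_
    · simp only [Finset.mul_sum]
      exact (integrable_finsetSum _ fun i _ => hi i).aestronglyMeasurable
    · intro n
      refine ae_of_all _ fun x => ?_
      have h1 := sum_diag_le_tr (H.density x).1 (F n)
      rw [(H.density x).tr_eq] at h1
      have h2 : 0 ≤ ∑ a ∈ F n, (σ x a a).re :=
        Finset.sum_nonneg fun a _ => diag_re_nonneg (H.density x).1.1 a
      rw [norm_mul, Real.norm_eq_abs, Real.norm_eq_abs, abs_of_nonneg h2]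
      exact mul_le_of_le_one_right (abs_nonneg _) h1
    · filter_upwards [hF] with x hx
      simpa using hx.const_mul (h x)
  have htr : tr (wavg q h σ) = ∫ x, h x ∂q := by
    refine le_antisymm ?_ (le_of_tendsto' hlim fun n => sum_diag_le_tr hT (F n))
    refine (summable_re hT).tsum_le_of_sum_le fun G => ?_
    simp only [H.wavg_diag_re hh]
    rw [← integral_finsetSum _ fun i _ => hi i]
    refine integral_mono (integrable_finsetSum _ fun i _ => hi i) hh fun x => ?_
    have := sum_diag_le_tr (H.density x).1 G
    rw [(H.density x).tr_eq] at this
    simp only [← Finset.mul_sum]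
    exact mul_le_of_le_one_right (h0 x) this
  have lim1 := hC.tendsto_mask hT (by rwa [htr]) i j
  refine tendsto_nhds_unique lim1 ?_
  have e : ∀ n, C (mask (F n) (wavg q h σ)) i j =
      ∫ x, (h x : ℂ) * C (mask (F n) (σ x)) i j ∂q := by
    intro n
    simp only [IsChannel.apply_mask, Finset.mul_sum]
    have hab : ∀ a b (z : ℂ), Integrable (fun x => (h x : ℂ) * (σ x a b * z)) q := fun a b z => by
      convert (H.integrable hh a b).mul_const z using 1
      ext x; ring
    rw [integral_finsetSum _ fun a _ => integrable_finsetSum _ fun b _ => hab a b _]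
    refine Finset.sum_congr rfl fun a _ => ?_
    rw [integral_finsetSum _ fun b _ => hab a b _]
    refine Finset.sum_congr rfl fun b _ => ?_
    rw [wavg, Matrix.of_apply, ← integral_mul_const]
    congr 1; ext x; ring
  simp only [e]
  refine tendsto_integral_of_dominated_convergence (fun x => |h x|) (fun n => ?_) hh.abs ?_ ?_
  · refine (integrable_weight hh ?_ fun x => ?_).aestronglyMeasurable
    · simp only [IsChannel.apply_mask]
      exact Finset.aemeasurable_fun_sum _ fun a _ => Finset.aemeasurable_fun_sum _ fun b _ =>
        (H.meas a b).mul_const _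
    · exact (hC.norm_mask_le (H.density x).1 _ i j).trans_eq (H.density x).tr_eq
  · intro n
    refine ae_of_all _ fun x => ?_
    have h1 := (hC.norm_mask_le (H.density x).1 (F n) i j).trans_eq (H.density x).tr_eq
    rw [norm_mul, Complex.norm_real, Real.norm_eq_abs]
    exact mul_le_of_le_one_right (abs_nonneg _) h1
  · filter_upwards [hF] with x hx
    refine (hC.tendsto_mask (H.density x).1 ?_ i j).const_mul _
    rwa [(H.density x).tr_eq]

theorem IsMixture.wavg_eq_sub (H : IsMixture q σ S) {h : X → ℝ} (hh : Integrable h q) :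
    wavg q h σ = wavg q (fun x => max (h x) 0) σ - wavg q (fun x => max (-h x) 0) σ := by
  ext i j
  rw [Matrix.sub_apply]
  simp only [wavg, Matrix.of_apply]
  rw [← integral_sub (H.integrable hh.pos_part i j) (H.integrable hh.neg_part i j)]
  congr 1; ext x
  rw [← sub_mul, ← Complex.ofReal_sub, max_zero_sub_max_neg_zero_eq_self]

theorem IsMixture.wavg_one (H : IsMixture q σ S) : wavg q (fun _ => 1) σ = S := by
  ext i j
  rw [H.eq]; simp [wavg]

theorem IsMixture.map [IsProbabilityMeasure q] (H : IsMixture q σ S) {C : OpMap α β}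
    (hC : IsChannel C) : IsMixture q (fun x => C (σ x)) (C S) where
  density x := hC.isDensity (H.density x)
  meas := H.aemeasurable_map hC
  avg := hC.isDensity H.avg
  eq i j := by
    have := H.map_wavg_of_nonneg hC (integrable_const (1 : ℝ)) fun _ => zero_le_one
    rw [H.wavg_one] at this
    rw [this]; simp [wavg]

/-- Channels commute with (weighted, entrywise) averages. -/
theorem IsMixture.map_wavg [IsProbabilityMeasure q] (H : IsMixture q σ S) {C : OpMap α β}
    (hC : IsChannel C) {h : X → ℝ} (hh : Integrable h q) :
    C (wavg q h σ) = wavg q h fun x => C (σ x) := by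
  rw [H.wavg_eq_sub hh, map_sub, H.map_wavg_of_nonneg hC hh.pos_part fun x => le_max_right _ _,
    H.map_wavg_of_nonneg hC hh.neg_part fun x => le_max_right _ _, (H.map hC).wavg_eq_sub hh]

end

section

variable {X : Type u} [MeasurableSpace X]

/-! ### Classical Fisher information -/

/-- `g` is a square integrable score function for `q`, that is, the density of a tangent vector of
finite Fisher information. -/
structure IsScore (q : Measure X) (g : X → ℝ) : Prop where
  memLp : MemLp g 2 q
  mean : ∫ x, g x ∂q = 0

theorem IsScore.integrable {q : Measure X} [IsProbabilityMeasure q] {g : X → ℝ}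
    (h : IsScore q g) : Integrable g q := h.memLp.integrable one_le_two

/-- Against bounded functions, a signed measure with a density is integrated by means of that
density. -/
theorem signedIntegral_eq {q : Measure X} [IsProbabilityMeasure q] {δ : SignedMeasure X}
    (h : δ ≪ᵥ q.toENNRealVectorMeasure) {f : X → ℂ} (hf : AEMeasurable f q)
    (hb : ∀ x, ‖f x‖ ≤ 1) : signedIntegral δ f = ∫ x, (δ.rnDeriv q x : ℂ) * f x ∂q := by
  rw [SignedMeasure.absolutelyContinuous_ennreal_iff,
    VectorMeasure.ennrealToMeasure_toENNRealVectorMeasure,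
    SignedMeasure.totalVariation_absolutelyContinuous_iff] at h
  have h1 := integral_rnDeriv_smul (f := f) h.1
  have h2 := integral_rnDeriv_smul (f := f) h.2
  have i1 := integrable_weight (Measure.integrable_toReal_rnDeriv
    (μ := δ.toJordanDecomposition.posPart) (ν := q)) hf hb
  have i2 := integrable_weight (Measure.integrable_toReal_rnDeriv
    (μ := δ.toJordanDecomposition.negPart) (ν := q)) hf hb
  rw [signedIntegral, ← h1, ← h2]
  simp only [Complex.real_smul]
  rw [← integral_sub i1 i2]
  congr 1; ext x
  rw [SignedMeasure.rnDeriv_def, Complex.ofReal_sub, sub_mul]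

theorem fisherInfo_eq {q : Measure X} {δ : SignedMeasure X}
    (h : δ ≪ᵥ q.toENNRealVectorMeasure) :
    fisherInfo q δ = ∫⁻ x, ENNReal.ofReal (δ.rnDeriv q x ^ 2) ∂q := by
  rw [fisherInfo, if_pos h]

/-- A program of finite Fisher information is given by a score function. -/
theorem exists_score {q : Measure X} {δ : SignedMeasure X} (hp : IsProgram q δ)
    (hfin : fisherInfo q δ ≠ ⊤) : ∃ g : X → ℝ, IsScore q g ∧
      fisherInfo q δ = ENNReal.ofReal (∫ x, g x ^ 2 ∂q) ∧
      ∀ f : X → ℂ, AEMeasurable f q → (∀ x, ‖f x‖ ≤ 1) →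
        signedIntegral δ f = ∫ x, (g x : ℂ) * f x ∂q := by
  have := hp.1
  have h : δ ≪ᵥ q.toENNRealVectorMeasure := by
    by_contra hc
    exact hfin (by rw [fisherInfo, if_neg hc])
  have hJ := fisherInfo_eq h
  have hm : AEStronglyMeasurable (δ.rnDeriv q) q :=
    (SignedMeasure.measurable_rnDeriv δ q).aestronglyMeasurable
  have hi : Integrable (fun x => δ.rnDeriv q x ^ 2) q := by
    refine ⟨(SignedMeasure.measurable_rnDeriv δ q).pow_const 2 |>.aestronglyMeasurable, ?_⟩
    rw [hasFiniteIntegral_iff_ofReal (ae_of_all _ fun x => sq_nonneg _), ← hJ]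
    exact lt_top_iff_ne_top.2 hfin
  refine ⟨δ.rnDeriv q, ⟨(memLp_two_iff_integrable_sq hm).2 hi, ?_⟩, ?_,
    fun f hf hb => signedIntegral_eq h hf hb⟩
  · have e := SignedMeasure.withDensityᵥ_rnDeriv_eq δ q h
    have h0 := hp.2
    rw [← e, withDensityᵥ_apply (SignedMeasure.integrable_rnDeriv δ q) MeasurableSet.univ,
      setIntegral_univ] at h0
    exact h0
  · rw [hJ, ofReal_integral_eq_lintegral_ofReal hi (ae_of_all _ fun x => sq_nonneg _)]

/-- The program with score function `g`. -/
theorem IsScore.program {q : Measure X} [IsProbabilityMeasure q] {g : X → ℝ} (hg : IsScore q g) :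
    IsProgram q (q.withDensityᵥ g) ∧
      fisherInfo q (q.withDensityᵥ g) = ENNReal.ofReal (∫ x, g x ^ 2 ∂q) ∧
      ∀ f : X → ℂ, AEMeasurable f q → (∀ x, ‖f x‖ ≤ 1) →
        signedIntegral (q.withDensityᵥ g) f = ∫ x, (g x : ℂ) * f x ∂q := by
  have hi := hg.integrable
  have hac := Measure.withDensityᵥ_absolutelyContinuous q g
  have hae : SignedMeasure.rnDeriv (q.withDensityᵥ g) q =ᵐ[q] g :=
    (SignedMeasure.integrable_rnDeriv _ q).ae_eq_of_withDensityᵥ_eq hi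
      (SignedMeasure.withDensityᵥ_rnDeriv_eq _ q hac)
  refine ⟨⟨inferInstance, ?_⟩, ?_, fun f hf hb => ?_⟩
  · rw [withDensityᵥ_apply hi MeasurableSet.univ, setIntegral_univ, hg.mean]
  · rw [fisherInfo_eq hac, ofReal_integral_eq_lintegral_ofReal hg.memLp.integrable_sq
      (ae_of_all _ fun x => sq_nonneg _)]
    refine lintegral_congr_ae ?_
    filter_upwards [hae] with x hx
    rw [hx]
  · rw [signedIntegral_eq hac hf hb]
    refine integral_congr_ae ?_
    filter_upwards [hae] with x hx
    rw [hx]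

theorem isScore_zero (q : Measure X) : IsScore q fun _ => 0 :=
  ⟨MemLp.zero, by simp⟩

/-- Score functions of independent programs add up, and so do their Fisher informations. -/
theorem IsScore.prod {X' : Type u} [MeasurableSpace X'] {q : Measure X} {q' : Measure X'}
    [IsProbabilityMeasure q] [IsProbabilityMeasure q'] {g : X → ℝ} {g' : X' → ℝ}
    (hg : IsScore q g) (hg' : IsScore q' g') :
    IsScore (q.prod q') (fun p => g p.1 + g' p.2) ∧
      ∫ p, (g p.1 + g' p.2) ^ 2 ∂q.prod q' = ∫ x, g x ^ 2 ∂q + ∫ x, g' x ^ 2 ∂q' := by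
  have m1 : MemLp (fun p : X × X' => g p.1) 2 (q.prod q') := hg.memLp.comp_fst q'
  have m2 : MemLp (fun p : X × X' => g' p.2) 2 (q.prod q') := hg'.memLp.comp_snd q
  have e1 : ∀ f : X → ℝ, ∫ p, f p.1 ∂q.prod q' = ∫ x, f x ∂q := fun f => by
    rw [integral_fun_fst]; simp
  have e2 : ∀ f : X' → ℝ, ∫ p, f p.2 ∂q.prod q' = ∫ x, f x ∂q' := fun f => by
    rw [integral_fun_snd]; simp
  refine ⟨⟨m1.add m2, ?_⟩, ?_⟩
  · rw [integral_add (m1.integrable one_le_two) (m2.integrable one_le_two), e1, e2, hg.mean,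
      hg'.mean, add_zero]
  · have e : ∀ p : X × X', (g p.1 + g' p.2) ^ 2 =
        (g p.1 ^ 2 + g' p.2 ^ 2) + 2 * (g p.1 * g' p.2) := fun p => by ring
    simp only [e]
    have i1 : Integrable (fun p : X × X' => g p.1 ^ 2 + g' p.2 ^ 2) (q.prod q') :=
      m1.integrable_sq.add m2.integrable_sq
    rw [integral_add i1, integral_add m1.integrable_sq m2.integrable_sq, integral_const_mul,
      integral_prod_mul, hg.mean, e1 fun x => g x ^ 2, e2 fun x => g' x ^ 2]
    · ring
    · exact (hg.integrable.mul_prod hg'.integrable).const_mul 2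

theorem ofReal_integral_le {q : Measure X} {h : X → ℝ} (hh : Integrable h q) :
    ENNReal.ofReal (∫ x, h x ∂q) ≤ ∫⁻ x, ENNReal.ofReal (h x) ∂q := by
  rw [integral_eq_lintegral_pos_part_sub_lintegral_neg_part hh]
  refine (ENNReal.ofReal_le_ofReal (sub_le_self _ ENNReal.toReal_nonneg)).trans ?_
  exact ENNReal.ofReal_toReal_le

/-- The value `2 ∫ f dδ - ∫ f² dp` of the variational expression for the Fisher information. -/
def simpleValue (p : Measure X) (d : SignedMeasure X) (f : SimpleFunc X ℝ) : ℝ :=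
  ∑ r ∈ f.range, (2 * r * d (f ⁻¹' {r}) - r ^ 2 * p.real (f ⁻¹' {r}))

theorem simpleValue_eq {p : Measure X} [IsProbabilityMeasure p] {d : SignedMeasure X}
    (h : d ≪ᵥ p.toENNRealVectorMeasure) (f : SimpleFunc X ℝ) :
    Integrable (fun x => 2 * f x * d.rnDeriv p x - f x ^ 2) p ∧
    simpleValue p d f = ∫ x, (2 * f x * d.rnDeriv p x - f x ^ 2) ∂p := by
  have hi := SignedMeasure.integrable_rnDeriv d p
  obtain ⟨c, hc⟩ := f.exists_forall_norm_le
  have hint : Integrable (fun x => 2 * f x * d.rnDeriv p x - f x ^ 2) p := by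
    refine Integrable.sub ?_ ?_
    · simp only [mul_assoc]
      exact (hi.bdd_mul f.aestronglyMeasurable (ae_of_all _ hc)).const_mul 2
    · have := (f.map fun r => r ^ 2).integrable_of_isFiniteMeasure (μ := p)
      exact this
  refine ⟨hint, ?_⟩
  have hu : (⋃ r ∈ f.range, f ⁻¹' {r}) = Set.univ := by
    ext x; simp
  rw [← setIntegral_univ, ← hu, integral_biUnion_finset _ (fun r _ => f.measurableSet_fiber r)
    (fun r _ s _ hrs => (Set.disjoint_singleton.2 hrs).preimage f) fun r _ => hint.integrableOn]
  refine Finset.sum_congr rfl fun r _ => ?_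
  have e : ∫ x in f ⁻¹' {r}, (2 * f x * d.rnDeriv p x - f x ^ 2) ∂p =
      ∫ x in f ⁻¹' {r}, (2 * r * d.rnDeriv p x - r ^ 2) ∂p := by
    refine setIntegral_congr_fun (f.measurableSet_fiber r) fun x hx => ?_
    have hx' : f x = r := hx
    simp only [hx']
  rw [e, integral_sub (hi.integrableOn.const_mul _) (integrable_const _), integral_const_mul,
    setIntegral_const]
  have e2 : d (f ⁻¹' {r}) = ∫ x in f ⁻¹' {r}, d.rnDeriv p x ∂p := by
    conv_lhs => rw [← SignedMeasure.withDensityᵥ_rnDeriv_eq d p h]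
    exact withDensityᵥ_apply hi (f.measurableSet_fiber r)
  rw [e2, smul_eq_mul]; ring

/-- The Fisher information is the supremum of the variational expression over simple functions, so
that it is exhausted by measurements with finitely many outcomes. -/
theorem fisherInfo_le {p : Measure X} [IsProbabilityMeasure p] {d : SignedMeasure X} {c : ℝ≥0∞}
    (hc : ∀ f : SimpleFunc X ℝ, ENNReal.ofReal (simpleValue p d f) ≤ c) : fisherInfo p d ≤ c := by
  by_cases h : d ≪ᵥ p.toENNRealVectorMeasure
  · rw [fisherInfo_eq h]
    set g := d.rnDeriv p with hg
    have hgm : Measurable g := SignedMeasure.measurable_rnDeriv d p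
    let f : ℕ → SimpleFunc X ℝ := SimpleFunc.approxOn g hgm Set.univ 0 (Set.mem_univ _)
    have hf : ∀ x, Tendsto (fun n => f n x) atTop (𝓝 (g x)) := fun x =>
      SimpleFunc.tendsto_approxOn hgm _ (by simp)
    have h1 : ∀ x, ENNReal.ofReal (g x ^ 2) =
        liminf (fun n => ENNReal.ofReal (2 * f n x * g x - f n x ^ 2)) atTop := by
      intro x
      refine (Tendsto.liminf_eq ?_).symm
      refine ENNReal.tendsto_ofReal ?_
      have := (((hf x).const_mul 2).mul_const (g x)).sub ((hf x).pow 2)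
      convert this using 2
      ring
    simp only [h1]
    refine (lintegral_liminf_le fun n => ?_).trans ?_
    · exact ((((f n).measurable.const_mul 2).mul hgm).sub
        ((f n).measurable.pow_const 2)).ennreal_ofReal
    · have h2 : ∀ n, ∫⁻ x, ENNReal.ofReal (2 * f n x * g x - f n x ^ 2) ∂p ≤ c := by
        intro n
        have h3 := simpleValue_eq h (f n)
        have h4 := hc (f n)
        rw [h3.2, ofReal_integral_eq_lintegral_ofReal h3.1] at h4
        · exact h4
        · -- `|f - g| ≤ |g|` gives `2 f g - f² = g² - (f - g)² ≥ 0`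
          refine ae_of_all _ fun x => ?_
          have h5 := SimpleFunc.edist_approxOn_le hgm (Set.mem_univ (0 : ℝ)) x n
          rw [edist_dist, edist_dist, ENNReal.ofReal_le_ofReal_iff dist_nonneg, Real.dist_eq,
            Real.dist_eq, zero_sub, abs_neg] at h5
          have h6 := sq_le_sq.2 h5
          change 0 ≤ 2 * f n x * g x - f n x ^ 2
          change (f n x - g x) ^ 2 ≤ g x ^ 2 at h6
          nlinarith
      exact liminf_le_of_frequently_le' (Frequently.of_forall h2)
  · -- on a set of `p`-measure zero that `d` charges, the expression is linear and unbounded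
    obtain ⟨B, hB, hB'⟩ : ∃ B, p.toENNRealVectorMeasure B = 0 ∧ d B ≠ 0 := by
      by_contra hcon
      push Not at hcon
      exact h fun B hB => hcon B hB
    have hBm : MeasurableSet B := by
      by_contra hn
      exact hB' (d.not_measurable hn)
    rw [Measure.toENNRealVectorMeasure_apply_measurable hBm] at hB
    have key : ∀ t : ℝ, t ≠ 0 → ENNReal.ofReal (2 * t * d B) ≤ c := by
      intro t ht
      have h1 := hc (SimpleFunc.piecewise B hBm (SimpleFunc.const X t) (SimpleFunc.const X 0))
      set f := SimpleFunc.piecewise B hBm (SimpleFunc.const X t) (SimpleFunc.const X 0) with hf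
      have hfx : ∀ x, f x = t ↔ x ∈ B := by
        intro x
        by_cases hx : x ∈ B <;> simp [hf, hx, ht.symm]
      have hpre : f ⁻¹' {t} = B := by
        ext x; exact hfx x
      have hv : simpleValue p d f = 2 * t * d B := by
        rw [simpleValue, Finset.sum_eq_single t]
        · rw [hpre, measureReal_def, hB]; simp
        · intro r hr hrt
          have : r = 0 := by
            obtain ⟨x, rfl⟩ := SimpleFunc.mem_range.1 hr
            have hx : x ∉ B := fun hx => hrt ((hfx x).2 hx)
            simp [hf, hx]
          subst this; simp
        · intro hr
          have : f ⁻¹' {t} = ∅ := by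
            ext x
            simp only [Set.mem_preimage, Set.mem_singleton_iff, Set.mem_empty_iff_false, iff_false]
            intro hx
            exact hr (hx ▸ SimpleFunc.mem_range_self f x)
          rw [this]; simp
      rwa [hv] at h1
    have htop : ∀ n : ℕ, (n : ℝ≥0∞) ≤ c := by
      intro n
      rcases Nat.eq_zero_or_pos n with rfl | hn
      · simp
      have h2 := key (n / (2 * d B)) (div_ne_zero (by positivity) (by positivity))
      rw [show 2 * (n / (2 * d B)) * d B = (n : ℝ) by field_simp] at h2
      simpa using h2
    have : c = ⊤ := ENNReal.eq_top_of_forall_nnreal_le fun r => by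
      obtain ⟨n, hn⟩ := exists_nat_ge r
      exact le_trans (by exact_mod_cast hn) (htop n)
    rw [this]; exact le_top

/-- On a finite set, every test function gives a lower bound of the Fisher information. -/
theorem le_fisherInfo {N : Type u} [Fintype N] {mN : MeasurableSpace N}
    [MeasurableSingletonClass N] {p : Measure N} [IsProbabilityMeasure p] (d : SignedMeasure N)
    (f : N → ℝ) :
    ENNReal.ofReal (∑ s, (2 * f s * d {s} - f s ^ 2 * p.real {s})) ≤ fisherInfo p d := by
  by_cases h : d ≪ᵥ p.toENNRealVectorMeasure
  · rw [fisherInfo_eq h]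
    have hi := SignedMeasure.integrable_rnDeriv d p
    have e : ∑ s, (2 * f s * d {s} - f s ^ 2 * p.real {s}) =
        ∫ s, (2 * f s * d.rnDeriv p s - f s ^ 2) ∂p := by
      rw [integral_fintype .of_finite]
      refine Finset.sum_congr rfl fun s _ => ?_
      have e2 : d {s} = ∫ x in {s}, d.rnDeriv p x ∂p := by
        conv_lhs => rw [← SignedMeasure.withDensityᵥ_rnDeriv_eq d p h]
        exact withDensityᵥ_apply hi (measurableSet_singleton s)
      rw [e2, integral_singleton]
      simp only [smul_eq_mul]; ring
    rw [e]
    refine (ofReal_integral_le .of_finite).trans (lintegral_mono fun s => ?_)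
    refine ENNReal.ofReal_le_ofReal ?_
    nlinarith [sq_nonneg (f s - d.rnDeriv p s)]
  · rw [fisherInfo, if_neg h]; exact le_top

end

section

variable {ι o ι' o' γ γ' γ₀ γ₁ γ₂ κ κ' : Type u}

/-! ### Combs: sequential use of a channel -/

/-- `P` is a map obtained from `n` successive uses of `Φ`, with arbitrary channels and ancillas in
between, and `D` is its derivative in the direction `Δ`, that is, the sum of the `n` maps obtained
by replacing one use of `Φ` by `Δ`. Unlike in an adaptive protocol, the ancilla may change from step
to step. -/
def Comb (Φ Δ : OpMap ι o) : ℕ → (γ₀ γ : Type u) → OpMap γ₀ γ → OpMap γ₀ γ → Prop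
  | 0, _, _, P, D => IsChannel P ∧ D = 0
  | n + 1, γ₀, γ, P, D => ∃ (κ : Type u) (P₀ D₀ : OpMap γ₀ (ι × κ)) (C : OpMap (o × κ) γ),
      Comb Φ Δ n γ₀ (ι × κ) P₀ D₀ ∧ IsChannel C ∧ P = C ∘ₗ withId κ Φ ∘ₗ P₀ ∧
      D = C ∘ₗ (withId κ Δ ∘ₗ P₀ + withId κ Φ ∘ₗ D₀)

variable {Φ Δ : OpMap ι o} {Φ' Δ' : OpMap ι' o'} {m n : ℕ}

theorem Comb.post {P D : OpMap γ₀ γ} (h : Comb Φ Δ n γ₀ γ P D) {C : OpMap γ γ'}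
    (hC : IsChannel C) : Comb Φ Δ n γ₀ γ' (C ∘ₗ P) (C ∘ₗ D) := by
  cases n with
  | zero => exact ⟨hC.comp h.1, by rw [h.2, LinearMap.comp_zero]⟩
  | succ n =>
    obtain ⟨κ, P₀, D₀, C₀, h0, hC0, rfl, rfl⟩ := h
    exact ⟨κ, P₀, D₀, C ∘ₗ C₀, h0, hC.comp hC0, rfl, rfl⟩

theorem Comb.use {P D : OpMap γ₀ (ι × κ)} (h : Comb Φ Δ n γ₀ (ι × κ) P D) :
    Comb Φ Δ (n + 1) γ₀ (o × κ) (withId κ Φ ∘ₗ P) (withId κ Δ ∘ₗ P + withId κ Φ ∘ₗ D) :=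
  ⟨κ, P, D, LinearMap.id, h, isChannel_id, rfl, rfl⟩

theorem Comb.pre {P D : OpMap γ₁ γ} (h : Comb Φ Δ n γ₁ γ P D) {E : OpMap γ₀ γ₁}
    (hE : IsChannel E) : Comb Φ Δ n γ₀ γ (P ∘ₗ E) (D ∘ₗ E) := by
  induction n generalizing γ with
  | zero => exact ⟨h.1.comp hE, by rw [h.2, LinearMap.zero_comp]⟩
  | succ n ih =>
    obtain ⟨κ, P₀, D₀, C₀, h0, hC0, rfl, rfl⟩ := h
    exact ⟨κ, _, _, C₀, ih h0, hC0, rfl, rfl⟩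

theorem Comb.comp {P D : OpMap γ₀ γ₁} (h : Comb Φ Δ m γ₀ γ₁ P D) {P' D' : OpMap γ₁ γ₂}
    (h' : Comb Φ Δ n γ₁ γ₂ P' D') :
    Comb Φ Δ (m + n) γ₀ γ₂ (P' ∘ₗ P) (D' ∘ₗ P + P' ∘ₗ D) := by
  induction n generalizing γ₂ with
  | zero =>
    rw [h'.2, LinearMap.zero_comp, zero_add]
    exact h.post h'.1
  | succ n ih =>
    obtain ⟨κ, P₀, D₀, C₀, h0, hC0, rfl, rfl⟩ := h'
    refine ⟨κ, _, _, C₀, ih h0, hC0, rfl, ?_⟩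
    ext1 T
    simp only [LinearMap.comp_apply, LinearMap.add_apply, map_add, add_assoc]

theorem Comb.isChannel (hΦ : IsChannel Φ) {P D : OpMap γ₀ γ} (h : Comb Φ Δ n γ₀ γ P D) :
    IsChannel P := by
  induction n generalizing γ with
  | zero => exact h.1
  | succ n ih =>
    obtain ⟨κ, P₀, D₀, C₀, h0, hC0, rfl, rfl⟩ := h
    exact hC0.comp ((hΦ.withId κ).comp (ih h0))

theorem Comb.isTZ (hΦ : IsChannel Φ) (hΔ : IsTZ Δ) {P D : OpMap γ₀ γ}
    (h : Comb Φ Δ n γ₀ γ P D) : IsTZ D := by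
  induction n generalizing γ with
  | zero => rw [h.2]; exact isTZ_zero
  | succ n ih =>
    obtain ⟨κ, P₀, D₀, C₀, h0, hC0, rfl, rfl⟩ := h
    exact hC0.comp_isTZ (((hΔ.withId κ).comp_channel (h0.isChannel hΦ)).add
      ((hΦ.withId κ).comp_isTZ (ih h0)))

theorem Comb.withId {P D : OpMap γ₀ γ} (h : Comb Φ Δ n γ₀ γ P D) (κ' : Type u) :
    Comb Φ Δ n (γ₀ × κ') (γ × κ') (withId κ' P) (withId κ' D) := by
  induction n generalizing γ with
  | zero => exact ⟨h.1.withId κ', by rw [h.2]; rfl⟩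
  | succ n ih =>
    obtain ⟨κ, P₀, D₀, C₀, h0, hC0, rfl, rfl⟩ := h
    exact ⟨κ × κ', _, _, ChannelMetric.withId κ' C₀ ∘ₗ reindex (Equiv.prodAssoc o κ κ'),
      (ih h0).post (isChannel_reindex (Equiv.prodAssoc ι κ κ').symm),
      (hC0.withId κ').comp (isChannel_reindex (Equiv.prodAssoc o κ κ')), rfl, rfl⟩

/-- A comb for a channel that can be simulated by `Φ'` is a comb for `Φ'`. -/
theorem Comb.simulate {E : OpMap ι ι'} {F : OpMap o' o} (hE : IsChannel E) (hF : IsChannel F)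
    (e1 : Φ = F ∘ₗ Φ' ∘ₗ E) (e2 : Δ = F ∘ₗ Δ' ∘ₗ E) {P D : OpMap γ₀ γ}
    (h : Comb Φ Δ n γ₀ γ P D) : Comb Φ' Δ' n γ₀ γ P D := by
  induction n generalizing γ with
  | zero => exact h
  | succ n ih =>
    obtain ⟨κ, P₀, D₀, C₀, h0, hC0, rfl, rfl⟩ := h
    subst e1 e2
    refine ⟨κ, _, _, C₀ ∘ₗ ChannelMetric.withId κ F, (ih h0).post (hE.withId κ),
      hC0.comp (hF.withId κ), rfl, ?_⟩
    ext1 T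
    simp only [LinearMap.comp_apply, LinearMap.add_apply, map_add]
    rfl

/-- The systems of `(α × β) × κ` in the order `β`, `α`, `κ`. -/
def frontSecond (α β κ : Type u) : (α × β) × κ ≃ β × (α × κ) where
  toFun x := (x.1.2, (x.1.1, x.2))
  invFun x := ((x.2.1, x.1), x.2.2)
  left_inv _ := rfl
  right_inv _ := rfl

/-- The systems of `β × (α × κ)` in the order `α`, `β`, `κ`. -/
def frontMiddle (β α κ : Type u) : β × (α × κ) ≃ α × (β × κ) where
  toFun x := (x.2.1, (x.1, x.2.2))
  invFun x := (x.2.1, (x.1, x.2.2))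
  left_inv _ := rfl
  right_inv _ := rfl

/-- Parallel uses of `Φ` are a special case of sequential ones. -/
theorem comb_tensorPow (Φ Δ : OpMap ι o) (m : ℕ) (κ : Type u) :
    Comb Φ Δ m (Pow ι m × κ) (Pow o m × κ) (withId κ (tensorPow Φ m))
      (withId κ (tensorDeriv Φ Δ m)) := by
  induction m generalizing κ with
  | zero => exact ⟨isChannel_id, rfl⟩
  | succ m ih =>
    have h := (((((ih (ι × κ)).pre (isChannel_reindex (frontSecond ι (Pow ι m) κ).symm)).post
      (isChannel_reindex (frontMiddle ι (Pow o m) κ))).use).post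
        (isChannel_reindex (Equiv.prodAssoc o (Pow o m) κ)))
    exact h

/-- Each use of `m` copies in parallel amounts to `m` uses of a single copy. -/
theorem Comb.serialize (Φ Δ : OpMap ι o) (m n : ℕ) {P D : OpMap γ₀ γ}
    (h : Comb (tensorPow Φ m) (tensorDeriv Φ Δ m) n γ₀ γ P D) : Comb Φ Δ (n * m) γ₀ γ P D := by
  induction n generalizing γ with
  | zero => rw [Nat.zero_mul]; exact h
  | succ n ih =>
    obtain ⟨κ, P₀, D₀, C₀, h0, hC0, rfl, rfl⟩ := h
    rw [Nat.succ_mul]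
    exact ((ih h0).comp (comb_tensorPow Φ Δ m κ)).post hC0

/-! ### Combs and adaptive protocols -/

/-- Acting on the system commutes with enlarging the ancilla. -/
theorem withId_comp_extZ (A : OpMap ι o) {e : κ → κ'} (he : Function.Injective e)
    (T : Op (ι × κ)) : withId κ' A (extZ (Prod.map id e) T) =
      extZ (Prod.map (id : o → o) e) (withId κ A T) := by
  have hι : Function.Injective (Prod.map (id : ι → ι) e) := Function.injective_id.prodMap he
  have ho : Function.Injective (Prod.map (id : o → o) e) := Function.injective_id.prodMap he
  have hr : ∀ {α : Type u} (x : α × κ'), x.2 ∉ Set.range e →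
      x ∉ Set.range (Prod.map (id : α → α) e) := by
    rintro α x hx ⟨p, hp⟩
    exact hx ⟨p.2, congrArg Prod.snd hp⟩
  ext ⟨x, k⟩ ⟨y, l⟩
  rw [withId_apply]
  by_cases hk : k ∈ Set.range e
  · by_cases hl : l ∈ Set.range e
    · obtain ⟨k, rfl⟩ := hk
      obtain ⟨l, rfl⟩ := hl
      have : block (extZ (Prod.map id e) T) (e k) (e l) = block T k l := by
        ext a b
        exact extZ_apply hι T (a, k) (b, l)
      rw [this]
      exact (extZ_apply ho (withId κ A T) (x, k) (y, l)).symm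
    · have : block (extZ (Prod.map id e) T) k l = 0 := by
        ext a b
        exact extZ_apply_right T _ (hr (b, l) hl)
      rw [this, map_zero, extZ_apply_right _ _ (hr (y, l) hl)]; rfl
  · have : block (extZ (Prod.map id e) T) k l = 0 := by
      ext a b
      exact extZ_apply_left T (hr (a, k) hk) _
    rw [this, map_zero, extZ_apply_left _ (hr (x, k) hk)]; rfl

/-- Enlarging the ancilla of an adaptive protocol. -/
theorem adaptive_extZ (Φ Δ : OpMap ι o) {e : κ → κ'} (he : Function.Injective e)
    {init : OpMap (ι × κ) (ι × κ)} {Ψ : ℕ → OpMap (o × κ) (ι × κ)}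
    {init' : OpMap (ι × κ') (ι × κ')} {Ψ' : ℕ → OpMap (o × κ') (ι × κ')} (n : ℕ)
    (hi : ∀ T, init' (extZ (Prod.map id e) T) = extZ (Prod.map id e) (init T))
    (hΨ : ∀ k < n, ∀ T, Ψ' k (extZ (Prod.map id e) T) = extZ (Prod.map id e) (Ψ k T))
    (T : Op (ι × κ)) :
    adaptive Φ init' Ψ' n (extZ (Prod.map id e) T) =
        extZ (Prod.map id e) (adaptive Φ init Ψ n T) ∧
      adaptiveDeriv Φ Δ init' Ψ' n (extZ (Prod.map id e) T) =
        extZ (Prod.map id e) (adaptiveDeriv Φ Δ init Ψ n T) := by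
  induction n with
  | zero =>
    simp only [adaptive, adaptiveDeriv, LinearMap.comp_apply, hi, withId_comp_extZ _ he, and_self]
  | succ n ih =>
    obtain ⟨h1, h2⟩ := ih fun k hk => hΨ k (hk.trans n.lt_succ_self)
    have h3 := hΨ n n.lt_succ_self
    simp only [adaptive, adaptiveDeriv, LinearMap.comp_apply, LinearMap.add_apply, h1, h2, h3,
      withId_comp_extZ _ he, map_add, and_self]

/-- Every comb is, up to encoding its input and decoding its output, an adaptive protocol: the
ancillas of the different steps are made into one by taking their disjoint union. -/
theorem Comb.compile (hΦ : IsChannel Φ) {ρ₀ : Op γ₀} (hρ₀ : IsDensity ρ₀) {P D : OpMap γ₀ γ}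
    (h : Comb Φ Δ (n + 1) γ₀ γ P D) :
    ∃ (κ : Type u) (E : OpMap γ₀ (ι × κ)) (init : OpMap (ι × κ) (ι × κ))
      (Ψ : ℕ → OpMap (o × κ) (ι × κ)) (C : OpMap (o × κ) γ), IsChannel E ∧ IsChannel init ∧
      (∀ k < n, IsChannel (Ψ k)) ∧ IsChannel C ∧ (∀ T, C (adaptive Φ init Ψ n (E T)) = P T) ∧
      ∀ T, C (adaptiveDeriv Φ Δ init Ψ n (E T)) = D T := by
  induction n generalizing γ with
  | zero =>
    obtain ⟨κ, P₀, D₀, C₀, h0, hC0, rfl, rfl⟩ := h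
    refine ⟨κ, P₀, LinearMap.id, fun _ => 0, C₀, h0.1, isChannel_id, by simp, hC0,
      fun T => rfl, fun T => ?_⟩
    rw [h0.2, LinearMap.comp_zero, add_zero]; rfl
  | succ n ih =>
    obtain ⟨κ', P₀, D₀, C₀, h0, hC0, rfl, rfl⟩ := h
    obtain ⟨κ, E, init, Ψ, C, hE, hi, hΨ, hC, e1, e2⟩ := ih h0
    -- states needed to extend channels to the enlarged system
    have hω := hE.isDensity hρ₀
    have hω' := (hΦ.withId κ).isDensity hω
    have hω'' := (hΦ.withId κ').isDensity ((h0.isChannel hΦ).isDensity hρ₀)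
    have inl := fun α : Type u => (Function.injective_id (α := α)).prodMap
      (Sum.inl_injective (α := κ) (β := κ'))
    have inr := fun α : Type u => (Function.injective_id (α := α)).prodMap
      (Sum.inr_injective (α := κ) (β := κ'))
    let init' : OpMap (ι × (κ ⊕ κ')) (ι × (κ ⊕ κ')) :=
      extZ (Prod.map id Sum.inl) ∘ₗ init ∘ₗ retract (Prod.map id Sum.inl) (E ρ₀)
    let Ψ' : ℕ → OpMap (o × (κ ⊕ κ')) (ι × (κ ⊕ κ')) := fun k =>
      if k = n then extZ (Prod.map id Sum.inr) ∘ₗ C ∘ₗ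
        retract (Prod.map id Sum.inl) (ChannelMetric.withId κ Φ (E ρ₀))
      else extZ (Prod.map id Sum.inl) ∘ₗ Ψ k ∘ₗ
        retract (Prod.map id Sum.inl) (ChannelMetric.withId κ Φ (E ρ₀))
    have key := fun T => adaptive_extZ Φ Δ (e := (Sum.inl : κ → κ ⊕ κ')) Sum.inl_injective
      (init := init) (Ψ := Ψ) (init' := init') (Ψ' := Ψ') n
      (fun T => by
        simp only [init', LinearMap.comp_apply]
        rw [retract_extZ (inl ι)])
      (fun k hk T => by
        simp only [Ψ', if_neg hk.ne, LinearMap.comp_apply]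
        rw [retract_extZ (inl o)]) T
    have hn : ∀ T, Ψ' n (extZ (Prod.map id Sum.inl) T) = extZ (Prod.map id Sum.inr) (C T) := by
      intro T
      simp only [Ψ', if_true, LinearMap.comp_apply]
      rw [retract_extZ (inl o)]
    refine ⟨κ ⊕ κ', extZ (Prod.map id Sum.inl) ∘ₗ E, init', Ψ', C₀ ∘ₗ
      retract (Prod.map id Sum.inr) (ChannelMetric.withId κ' Φ (P₀ ρ₀)),
      (isChannel_extZ (inl ι)).comp hE,
      (isChannel_extZ (inl ι)).comp (hi.comp (isChannel_retract (inl ι) hω)), fun k hk => ?_,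
      hC0.comp (isChannel_retract (inr o) hω''), fun T => ?_, fun T => ?_⟩
    · simp only [Ψ']
      split_ifs with hkn
      · exact (isChannel_extZ (inr ι)).comp (hC.comp (isChannel_retract (inl o) hω'))
      · exact (isChannel_extZ (inl ι)).comp ((hΨ k (by omega)).comp
          (isChannel_retract (inl o) hω'))
    · simp only [adaptive, LinearMap.comp_apply, (key _).1, hn, e1]
      rw [withId_comp_extZ _ Sum.inr_injective, retract_extZ (inr o)]
    · simp only [adaptiveDeriv, LinearMap.comp_apply, LinearMap.add_apply, (key _).1, (key _).2, hn,
        e1, e2]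
      rw [withId_comp_extZ _ Sum.inr_injective, withId_comp_extZ _ Sum.inr_injective, map_add,
        retract_extZ (inr o), retract_extZ (inr o)]

theorem comb_adaptive (Φ Δ : OpMap ι o) {init : OpMap (ι × κ) (ι × κ)}
    {Ψ : ℕ → OpMap (o × κ) (ι × κ)} (hi : IsChannel init) (n : ℕ)
    (hΨ : ∀ k < n, IsChannel (Ψ k)) :
    Comb Φ Δ (n + 1) (ι × κ) (o × κ) (adaptive Φ init Ψ n) (adaptiveDeriv Φ Δ init Ψ n) := by
  induction n with
  | zero => exact ⟨κ, init, 0, LinearMap.id, ⟨hi, rfl⟩, isChannel_id, rfl, by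
      simp [adaptiveDeriv]⟩
  | succ n ih =>
    exact ((ih fun k hk => hΨ k (hk.trans n.lt_succ_self)).post (hΨ n n.lt_succ_self)).use

/-! ### Reachable states and their derivatives -/

/-- `σ` is the output of `n` successive uses of `Φ`, and `δ` its derivative in the direction `Δ`. -/
def Reach (Φ Δ : OpMap ι o) (n : ℕ) (γ : Type u) (σ δ : Op γ) : Prop :=
  ∃ (γ₀ : Type u) (ρ : Op γ₀) (P D : OpMap γ₀ γ), IsDensity ρ ∧ Comb Φ Δ n γ₀ γ P D ∧
    σ = P ρ ∧ δ = D ρ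

theorem Reach.post {σ δ : Op γ} (h : Reach Φ Δ n γ σ δ) {C : OpMap γ γ'} (hC : IsChannel C) :
    Reach Φ Δ n γ' (C σ) (C δ) := by
  obtain ⟨γ₀, ρ, P, D, hρ, hc, rfl, rfl⟩ := h
  exact ⟨γ₀, ρ, _, _, hρ, hc.post hC, rfl, rfl⟩

theorem Reach.use {σ δ : Op (ι × κ)} (h : Reach Φ Δ n (ι × κ) σ δ) :
    Reach Φ Δ (n + 1) (o × κ) (withId κ Φ σ) (withId κ Δ σ + withId κ Φ δ) := by
  obtain ⟨γ₀, ρ, P, D, hρ, hc, rfl, rfl⟩ := h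
  exact ⟨γ₀, ρ, _, _, hρ, hc.use, rfl, rfl⟩

theorem Reach.exists_of_succ {σ δ : Op γ} (h : Reach Φ Δ (n + 1) γ σ δ) :
    ∃ (κ : Type u) (σ₀ δ₀ : Op (ι × κ)) (C : OpMap (o × κ) γ), Reach Φ Δ n (ι × κ) σ₀ δ₀ ∧
      IsChannel C ∧ σ = C (withId κ Φ σ₀) ∧ δ = C (withId κ Δ σ₀ + withId κ Φ δ₀) := by
  obtain ⟨γ₀, ρ, _, _, hρ, ⟨κ, P₀, D₀, C, h0, hC, rfl, rfl⟩, rfl, rfl⟩ := h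
  exact ⟨κ, P₀ ρ, D₀ ρ, C, ⟨γ₀, ρ, P₀, D₀, hρ, h0, rfl, rfl⟩, hC, rfl, rfl⟩

theorem reach_zero {ρ : Op γ} (hρ : IsDensity ρ) : Reach Φ Δ 0 γ ρ 0 :=
  ⟨γ, ρ, LinearMap.id, 0, hρ, ⟨isChannel_id, rfl⟩, rfl, rfl⟩

theorem Reach.of_zero {σ δ : Op γ} (h : Reach Φ Δ 0 γ σ δ) : IsDensity σ ∧ δ = 0 := by
  obtain ⟨γ₀, ρ, P, D, hρ, ⟨hP, rfl⟩, rfl, rfl⟩ := h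
  exact ⟨hP.isDensity hρ, rfl⟩

theorem Reach.isDensity (hΦ : IsChannel Φ) {σ δ : Op γ} (h : Reach Φ Δ n γ σ δ) :
    IsDensity σ := by
  obtain ⟨γ₀, ρ, P, D, hρ, hc, rfl, rfl⟩ := h
  exact (hc.isChannel hΦ).isDensity hρ

theorem Reach.trFun_eq_zero (hΦ : IsChannel Φ) (hΔ : IsTZ Δ) {σ δ : Op γ}
    (h : Reach Φ Δ n γ σ δ) : δ ∈ TC γ ∧ trFun γ δ = 0 := by
  obtain ⟨γ₀, ρ, P, D, hρ, hc, rfl, rfl⟩ := h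
  exact (hc.isTZ hΦ hΔ).mem_TC hρ.1.mem_TC

theorem Reach.serialize {m : ℕ} {σ δ : Op γ}
    (h : Reach (tensorPow Φ m) (tensorDeriv Φ Δ m) n γ σ δ) : Reach Φ Δ (n * m) γ σ δ := by
  obtain ⟨γ₀, ρ, P, D, hρ, hc, rfl, rfl⟩ := h
  exact ⟨γ₀, ρ, P, D, hρ, hc.serialize, rfl, rfl⟩

theorem Reach.simulate {E : OpMap ι ι'} {F : OpMap o' o} (hE : IsChannel E) (hF : IsChannel F)
    (e1 : Φ = F ∘ₗ Φ' ∘ₗ E) (e2 : Δ = F ∘ₗ Δ' ∘ₗ E) {σ δ : Op γ}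
    (h : Reach Φ Δ n γ σ δ) : Reach Φ' Δ' n γ σ δ := by
  obtain ⟨γ₀, ρ, P, D, hρ, hc, rfl, rfl⟩ := h
  exact ⟨γ₀, ρ, P, D, hρ, hc.simulate hE hF e1 e2, rfl, rfl⟩

/-- Two runs, one after the other, on independent inputs. -/
theorem Reach.seq {σ δ : Op γ} {σ' δ' : Op γ'} (h : Reach Φ Δ m γ σ δ)
    (h' : Reach Φ Δ n γ' σ' δ') :
    Reach Φ Δ (m + n) (γ × γ') (σ ⊗ₖ σ') (δ ⊗ₖ σ' + σ ⊗ₖ δ') := by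
  obtain ⟨γ₀, ρ, P, D, hρ, hc, rfl, rfl⟩ := h
  obtain ⟨γ₀', ρ', P', D', hρ', hc', rfl, rfl⟩ := h'
  have h1 := (hc.withId γ₀').post (isChannel_reindex (Equiv.prodComm γ₀' γ))
  have h2 := (h1.comp (hc'.withId γ)).post (isChannel_reindex (Equiv.prodComm γ γ'))
  have hk : ∀ {α β α' β' : Type u} (A : OpMap α α') (B : OpMap β β') (S : Op α) (T : Op β),
      reindex (Equiv.prodComm α' β') (withId α' B (reindex (Equiv.prodComm β α')
        (withId β A (S ⊗ₖ T)))) = A S ⊗ₖ B T := fun A B S T => by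
    rw [← tensor_kron, withId_kron, tensor_kron]
    have : reindex (Equiv.prodComm _ _) (A S ⊗ₖ T) = T ⊗ₖ A S := by
      ext x y; exact mul_comm _ _
    rw [this, withId_kron]
    ext x y; exact mul_comm _ _
  refine ⟨γ₀ × γ₀', ρ ⊗ₖ ρ', _, _, hρ.kron hρ', h2, (hk P P' ρ ρ').symm, ?_⟩
  rw [add_comm, ← hk P D', ← hk D P', ← map_add]
  rfl

/-- The systems of `(α × κ) × (β × κ')` in the order `α`, `β`, `κ`, `κ'`. -/
def shuffle (α β κ κ' : Type u) : (α × β) × (κ × κ') ≃ (α × κ) × (β × κ') where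
  toFun x := ((x.1.1, x.2.1), (x.1.2, x.2.2))
  invFun x := ((x.1.1, x.2.1), (x.1.2, x.2.2))
  left_inv _ := rfl
  right_inv _ := rfl

theorem withId_tensor_shuffle (A : OpMap ι o) (B : OpMap ι' o') (S : Op (ι × κ))
    (T : Op (ι' × κ')) :
    withId (κ × κ') (tensor A B) (reindex (shuffle ι ι' κ κ') (S ⊗ₖ T)) =
      reindex (shuffle o o' κ κ') (withId κ A S ⊗ₖ withId κ' B T) := by
  ext x y
  have e : block (reindex (shuffle ι ι' κ κ') (S ⊗ₖ T)) x.2 y.2 =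
      block S x.2.1 y.2.1 ⊗ₖ block T x.2.2 y.2.2 := rfl
  rw [withId_apply, e, tensor_kron]
  rfl

/-- Two runs in parallel, on independent inputs. -/
theorem Reach.par {σ δ : Op γ} {σ' δ' : Op γ'} (h : Reach Φ Δ n γ σ δ)
    (h' : Reach Φ' Δ' n γ' σ' δ') :
    Reach (tensor Φ Φ') (tensor Δ Φ' + tensor Φ Δ') n (γ × γ') (σ ⊗ₖ σ')
      (δ ⊗ₖ σ' + σ ⊗ₖ δ') := by
  induction n generalizing γ γ' with
  | zero =>
    obtain ⟨h1, rfl⟩ := h.of_zero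
    obtain ⟨h2, rfl⟩ := h'.of_zero
    simpa using reach_zero (h1.kron h2)
  | succ n ih =>
    obtain ⟨κ, σ₀, δ₀, C, h0, hC, rfl, rfl⟩ := h.exists_of_succ
    obtain ⟨κ', σ₀', δ₀', C', h0', hC', rfl, rfl⟩ := h'.exists_of_succ
    have h1 := ((((ih h0 h0').post (isChannel_reindex (shuffle ι ι' κ κ'))).use).post
      (isChannel_reindex (shuffle o o' κ κ').symm)).post (hC.tensor hC')
    have hs : ∀ S : Op ((o × κ) × (o' × κ')), reindex (shuffle o o' κ κ').symm
        (reindex (shuffle o o' κ κ') S) = S := fun S => rfl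
    have ha : ∀ (A B : OpMap (ι × ι') (o × o')) (S : Op ((ι × ι') × (κ × κ'))),
        withId (κ × κ') (A + B) S = withId (κ × κ') A S + withId (κ × κ') B S :=
      fun _ _ _ => rfl
    rw [ha, map_add (reindex (shuffle ι ι' κ κ')), map_add (withId (κ × κ') (tensor Φ Φ'))] at h1
    simp only [withId_tensor_shuffle, map_add, hs, tensor_kron] at h1
    convert h1 using 1
    simp only [map_add, Matrix.add_kronecker, Matrix.kronecker_add]
    abel

/-! ### Splitting tensor powers -/

/-- A tensor power of order `m + n` as a product of tensor powers. -/
def powSplit (α : Type u) (m : ℕ) : ∀ n, Pow α (m + n) ≃ Pow α n × Pow α m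
  | 0 => (Equiv.punitProd (Pow α m)).symm
  | n + 1 => ((Equiv.refl α).prodCongr (powSplit α m n)).trans
      (Equiv.prodAssoc α (Pow α n) (Pow α m)).symm

theorem tensorPow_add (Φ Δ : OpMap ι o) (m n : ℕ) :
    tensor (tensorPow Φ n) (tensorPow Φ m) =
        reindex (powSplit o m n).symm ∘ₗ tensorPow Φ (m + n) ∘ₗ reindex (powSplit ι m n) ∧
      tensor (tensorDeriv Φ Δ n) (tensorPow Φ m) + tensor (tensorPow Φ n) (tensorDeriv Φ Δ m) =
        reindex (powSplit o m n).symm ∘ₗ tensorDeriv Φ Δ (m + n) ∘ₗ reindex (powSplit ι m n) := by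
  induction n with
  | zero =>
    constructor
    · rfl
    · have : tensor (tensorDeriv Φ Δ 0) (tensorPow Φ m) = 0 := rfl
      rw [this, zero_add]; rfl
  | succ n ih =>
    have hassoc : ∀ (A : OpMap ι o) (B : OpMap (Pow ι n) (Pow o n))
        (C : OpMap (Pow ι m) (Pow o m)) (Z : OpMap (Pow ι (m + n)) (Pow o (m + n))),
        tensor B C = reindex (powSplit o m n).symm ∘ₗ Z ∘ₗ reindex (powSplit ι m n) →
        tensor (tensor A B) C = reindex (powSplit o m (n + 1)).symm ∘ₗ tensor A Z ∘ₗ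
          reindex (powSplit ι m (n + 1)) := by
      intro A B C Z hZ
      have e : tensor (tensor A B) C = reindex (Equiv.prodAssoc o (Pow o n) (Pow o m)) ∘ₗ
          tensor A (tensor B C) ∘ₗ reindex (Equiv.prodAssoc ι (Pow ι n) (Pow ι m)).symm := rfl
      rw [e, hZ]; rfl
    have h2 : ∀ (B B' : OpMap (Pow ι n) (Pow o n)) (C C' : OpMap (Pow ι m) (Pow o m)),
        tensor (tensor Φ B) C + tensor (tensor Φ B') C' =
        reindex (Equiv.prodAssoc o (Pow o n) (Pow o m)) ∘ₗ
          tensor Φ (tensor B C + tensor B' C') ∘ₗ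
          reindex (Equiv.prodAssoc ι (Pow ι n) (Pow ι m)).symm := by
      intro B B' C C'
      ext1 T; ext x y
      refine (congrFun (congrFun (map_add Φ _ _) x.1.1) y.1.1).symm
    refine ⟨hassoc Φ _ _ _ ih.1, ?_⟩
    have h3 := hassoc Δ _ _ _ ih.1
    have h4 := h2 (tensorDeriv Φ Δ n) (tensorPow Φ n) (tensorPow Φ m) (tensorDeriv Φ Δ m)
    rw [ih.2] at h4
    exact (add_assoc _ _ _).trans (congrArg₂ (· + ·) h3 h4)

end

section

variable {ι o ι' o' γ γ' κ : Type u} {Φ Δ : OpMap ι o} {Φ' Δ' : OpMap ι' o'} {m n : ℕ}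

/-! ### Vector measures on finite sets -/

section FiniteMeasure

variable {N : Type u} [Fintype N] [MeasurableSpace N] [DiscreteMeasurableSpace N]
  {E : Type*} [AddCommGroup E] [TopologicalSpace E] [IsTopologicalAddGroup E]

/-- The vector measure on a finite set with the given weights. -/
def finVec (w : N → E) : VectorMeasure N E := ∑ s, VectorMeasure.dirac s (w s)

open Classical in
theorem finVec_apply (w : N → E) (B : Set N) : finVec w B = ∑ s, if s ∈ B then w s else 0 := by
  have h : ∀ F : Finset N, (∑ s ∈ F, VectorMeasure.dirac s (w s)) B =
      ∑ s ∈ F, if s ∈ B then w s else 0 := by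
    intro F
    induction F using Finset.induction_on with
    | empty => simp
    | insert a F ha ih =>
      rw [Finset.sum_insert ha, Finset.sum_insert ha, _root_.add_apply, ih]
      congr 1
      split_ifs with h
      · exact VectorMeasure.dirac_apply_of_mem (MeasurableSet.of_discrete) h
      · exact VectorMeasure.dirac_apply_of_notMem h
  exact h _

/-- The measure on a finite set with the given weights. -/
def finMeas (w : N → ℝ) : Measure N := ∑ s, ENNReal.ofReal (w s) • Measure.dirac s

open Classical in
theorem finMeas_apply (w : N → ℝ) (B : Set N) :
    finMeas w B = ∑ s, if s ∈ B then ENNReal.ofReal (w s) else 0 := by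
  rw [finMeas, Measure.finsetSum_apply]
  refine Finset.sum_congr rfl fun s _ => ?_
  rw [Measure.smul_apply, Measure.dirac_apply, smul_eq_mul]
  by_cases h : s ∈ B <;> simp [h]

open Classical in
theorem finMeas_real (w : N → ℝ) (hw : ∀ s, 0 ≤ w s) (B : Set N) :
    (finMeas w).real B = ∑ s, if s ∈ B then w s else 0 := by
  rw [measureReal_def, finMeas_apply, ENNReal.toReal_sum]
  · refine Finset.sum_congr rfl fun s _ => ?_
    split_ifs
    · exact ENNReal.toReal_ofReal (hw s)
    · rfl
  · intro s _
    split_ifs <;> simp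

end FiniteMeasure

/-! ### The Fisher information of reachable states -/

/-- The value `2 ∑ f δ - ∑ f² σ` of the variational expression for the Fisher information, for the
measurement in the given basis. -/
def testValue {N : Type u} [Fintype N] (σ δ : Op N) (f : N → ℝ) : ℝ :=
  ∑ s, (2 * f s * (δ s s).re - f s ^ 2 * (σ s s).re)

/-- The supremum of the Fisher information over the states reachable with `n` uses of `Φ`. As
channels can be applied at the end, it is enough to measure in the basis of a finite system. -/
def reachInfo (Φ Δ : OpMap ι o) (n : ℕ) : ℝ≥0∞ :=
  sSup {j | ∃ (N : Type u) (_ : Fintype N) (σ δ : Op N) (f : N → ℝ), Reach Φ Δ n N σ δ ∧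
    (∀ s, (δ s s).im = 0) ∧ j = ENNReal.ofReal (testValue σ δ f)}

theorem le_reachInfo {N : Type u} [Fintype N] {σ δ : Op N} (f : N → ℝ)
    (h : Reach Φ Δ n N σ δ) (h0 : ∀ s, (δ s s).im = 0) :
    ENNReal.ofReal (testValue σ δ f) ≤ reachInfo Φ Δ n :=
  le_sSup ⟨N, _, σ, δ, f, h, h0, rfl⟩

/-- The probability of the event `B`, as a linear functional of the state. -/
def evalAt {α Ω : Type u} [MeasurableSpace Ω] (M : Op α →ₗ[ℂ] ComplexMeasure Ω) (B : Set Ω) :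
    Op α →ₗ[ℂ] ℂ where
  toFun T := M T B
  map_add' S T := by rw [map_add, _root_.add_apply]
  map_smul' c T := by rw [map_smul, _root_.smul_apply]; rfl

/-- The Fisher information of every measurement on a reachable state is approximated by measurements
with finitely many outcomes, obtained by coarse graining. -/
theorem fisherInfo_le_reachInfo {Ω : Type u} [MeasurableSpace Ω] {σ δ : Op γ}
    (hr : Reach Φ Δ n γ σ δ) {M : Op γ →ₗ[ℂ] ComplexMeasure Ω} (hM : IsMeasurement M)
    {p : Measure Ω} {d : SignedMeasure Ω} (h : IsOutcome M σ δ p d) :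
    fisherInfo p d ≤ reachInfo Φ Δ n := by
  classical
  have := h.1
  refine fisherInfo_le fun f => ?_
  let N := ULift.{u} f.range
  let φ : N → Op γ →ₗ[ℂ] ℂ := fun r => evalAt M (f ⁻¹' {(r.down : ℝ)})
  have hC : IsChannel (record φ) := by
    refine isChannel_record (fun s T hT => (hM T hT).1 _) fun T hT => ?_
    rw [← (hM T hT).2]
    have hu : (⋃ r ∈ f.range, f ⁻¹' {r}) = Set.univ := by
      ext x; simp
    rw [← hu, VectorMeasure.of_biUnion_finset (fun r _ s _ hrs =>
      (Set.disjoint_singleton.2 hrs).preimage f) fun r _ => f.measurableSet_fiber r,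
      ← Finset.sum_coe_sort f.range]
    exact Equiv.ulift.{u}.sum_comp fun r : f.range => M T (f ⁻¹' {(r : ℝ)})
  have hd : ∀ (T : Op γ) (s : N), record φ T s s = M T (f ⁻¹' {(s.down : ℝ)}) := fun T s => by
    change Matrix.diagonal _ s s = _
    rw [Matrix.diagonal_apply_eq]; rfl
  have h1 := le_reachInfo (fun s : N => (s.down : ℝ)) (hr.post hC) (fun s => by
    rw [hd, h.2.2 _ (f.measurableSet_fiber _), Complex.ofReal_im])
  refine le_of_eq_of_le (congrArg ENNReal.ofReal ?_) h1
  rw [simpleValue, testValue, ← Finset.sum_coe_sort f.range, ← Equiv.ulift.{u}.sum_comp]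
  refine Finset.sum_congr rfl fun s _ => ?_
  rw [hd, hd, h.2.2 _ (f.measurableSet_fiber _), h.2.1 _ (f.measurableSet_fiber _)]
  rfl

/-- The restriction to a fixed ancilla and the generality of the measurement in an adaptive protocol
do not change the supremum. -/
theorem GMinAdaptive_eq_reachInfo (hΦ : IsChannel Φ) (n : ℕ) :
    GMinAdaptive Φ Δ n = reachInfo Φ Δ (n + 1) := by
  classical
  apply le_antisymm
  · refine sSup_le ?_
    rintro j ⟨κ, Ω, _, ρ, init, Ψ, M, p, d, ⟨hρ, hi, hΨ⟩, hM, ho, rfl⟩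
    exact fisherInfo_le_reachInfo ⟨_, ρ, _, _, hρ, comb_adaptive Φ Δ hi n hΨ, rfl, rfl⟩ hM ho
  · refine sSup_le ?_
    rintro j ⟨N, _, σ, δ, f, ⟨γ₀, ρ, P, D, hρ, hc, rfl, rfl⟩, h0, rfl⟩
    have hσ := (hc.isChannel hΦ).isDensity hρ
    obtain ⟨κ, E, init, Ψ, C, hE, hi, hΨ, hC, e1, e2⟩ := hc.compile hΦ hρ
    let _ : MeasurableSpace N := ⊤
    let M : Op (o × κ) →ₗ[ℂ] ComplexMeasure N :=
      { toFun := fun T => finVec fun s => C T s s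
        map_add' := fun S T => by
          ext B hB
          rw [_root_.add_apply, finVec_apply, finVec_apply, finVec_apply,
            ← Finset.sum_add_distrib]
          refine Finset.sum_congr rfl fun s _ => ?_
          split_ifs <;> simp
        map_smul' := fun c T => by
          ext B hB
          rw [_root_.smul_apply, finVec_apply, finVec_apply, Finset.smul_sum]
          refine Finset.sum_congr rfl fun s _ => ?_
          split_ifs <;> simp }
    have hMa : ∀ T B, M T B = ∑ s, if s ∈ B then C T s s else 0 := fun T B => finVec_apply _ B
    have hM : IsMeasurement M := by
      intro T hT
      constructor
      · intro B
        rw [hMa]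
        refine Finset.sum_nonneg fun s _ => ?_
        split_ifs
        · exact (hC.posTC hT).1.diag_nonneg
        · exact le_rfl
      · rw [hMa, ← hC.2 T hT, opTrace, tsum_fintype]
        simp
    let p : Measure N := finMeas fun s => (P ρ s s).re
    let d : SignedMeasure N := finVec fun s => (D ρ s s).re
    have hp0 : ∀ s, 0 ≤ (P ρ s s).re := fun s => diag_re_nonneg hσ.1.1 s
    have hp : IsProbabilityMeasure p := by
      constructor
      rw [finMeas_apply]
      simp only [Set.mem_univ, if_true]
      rw [← ENNReal.ofReal_sum_of_nonneg fun s _ => hp0 s]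
      have := hσ.tr_eq
      rw [tr, tsum_fintype] at this
      rw [this, ENNReal.ofReal_one]
    have ho : IsOutcome M (adaptive Φ init Ψ n (E ρ)) (adaptiveDeriv Φ Δ init Ψ n (E ρ)) p d := by
      refine ⟨hp, fun B _ => ?_, fun B _ => ?_⟩
      · rw [hMa, e1, finMeas_real _ hp0, Complex.ofReal_sum]
        refine Finset.sum_congr rfl fun s _ => ?_
        split_ifs
        · exact diag_eq_re hσ.1.1 s
        · rfl
      · rw [hMa, e2, finVec_apply, Complex.ofReal_sum]
        refine Finset.sum_congr rfl fun s _ => ?_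
        split_ifs
        · exact Complex.ext rfl (h0 s)
        · rfl
    refine le_trans ?_ (le_sSup ⟨κ, N, _, E ρ, init, Ψ, M, p, d, ⟨hE.isDensity hρ, hi, hΨ⟩, hM,
      ho, rfl⟩)
    refine le_of_eq_of_le (congrArg ENNReal.ofReal ?_) (le_fisherInfo d f)
    refine Finset.sum_congr rfl fun s _ => ?_
    rw [finMeas_real _ hp0, finVec_apply]
    simp

theorem GMin_eq_reachInfo (hΦ : IsChannel Φ) : GMin Φ Δ = reachInfo Φ Δ 1 := by
  rw [← GMinAdaptive_eq_reachInfo hΦ 0]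
  apply le_antisymm
  · refine sSup_le ?_
    rintro j ⟨κ, Ω, _, ρ, M, p, d, hρ, hM, ho, rfl⟩
    exact le_sSup ⟨κ, Ω, _, ρ, LinearMap.id, fun _ => 0, M, p, d,
      ⟨hρ, isChannel_id, by simp⟩, hM, ho, rfl⟩
  · refine sSup_le ?_
    rintro j ⟨κ, Ω, _, ρ, init, Ψ, M, p, d, ⟨hρ, hi, -⟩, hM, ho, rfl⟩
    exact le_sSup ⟨κ, Ω, _, init ρ, M, p, d, hi.isDensity hρ, hM, ho, rfl⟩

theorem reachInfo_serialize (m n : ℕ) :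
    reachInfo (tensorPow Φ m) (tensorDeriv Φ Δ m) n ≤ reachInfo Φ Δ (n * m) := by
  refine sSup_le ?_
  rintro j ⟨N, _, σ, δ, f, h, h0, rfl⟩
  exact le_reachInfo f h.serialize h0

theorem reachInfo_simulate {E : OpMap ι ι'} {F : OpMap o' o} (hE : IsChannel E) (hF : IsChannel F)
    (e1 : Φ = F ∘ₗ Φ' ∘ₗ E) (e2 : Δ = F ∘ₗ Δ' ∘ₗ E) (n : ℕ) :
    reachInfo Φ Δ n ≤ reachInfo Φ' Δ' n := by
  refine sSup_le ?_
  rintro j ⟨N, _, σ, δ, f, h, h0, rfl⟩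
  exact le_reachInfo f (h.simulate hE hF e1 e2) h0

/-! ### Superadditivity -/

/-- The variational expression is additive on products for a sum of test functions, one of which is
centred. -/
theorem sum_prod_test {N N' : Type u} [Fintype N] [Fintype N'] {s d f : N → ℝ} {s' d' f' : N' → ℝ}
    (hs : ∑ x, s x = 1) (hs' : ∑ x, s' x = 1) (hd : ∑ x, d x = 0)
    (hf : ∑ x, f x * s x = 0) :
    ∑ p : N × N', (2 * (f p.1 + f' p.2) * (d p.1 * s' p.2 + s p.1 * d' p.2) -
        (f p.1 + f' p.2) ^ 2 * (s p.1 * s' p.2)) =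
      ∑ x, (2 * f x * d x - f x ^ 2 * s x) + ∑ x, (2 * f' x * d' x - f' x ^ 2 * s' x) := by
  have key : ∀ (u : N → ℝ) (v : N' → ℝ), ∑ p : N × N', u p.1 * v p.2 = (∑ x, u x) * ∑ y, v y := by
    intro u v
    rw [Fintype.sum_prod_type, Finset.sum_mul_sum]
  have e : ∀ p : N × N', 2 * (f p.1 + f' p.2) * (d p.1 * s' p.2 + s p.1 * d' p.2) -
        (f p.1 + f' p.2) ^ 2 * (s p.1 * s' p.2) =
      (2 * f p.1 * d p.1 - f p.1 ^ 2 * s p.1) * s' p.2 +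
      s p.1 * (2 * f' p.2 * d' p.2 - f' p.2 ^ 2 * s' p.2) +
      (f p.1 * s p.1) * (2 * d' p.2) + d p.1 * (2 * (f' p.2 * s' p.2)) -
      (f p.1 * s p.1) * (2 * (f' p.2 * s' p.2)) := fun p => by ring
  simp only [e]
  rw [Finset.sum_sub_distrib, Finset.sum_add_distrib, Finset.sum_add_distrib,
    Finset.sum_add_distrib, key (fun x => 2 * f x * d x - f x ^ 2 * s x) s',
    key s fun x => 2 * f' x * d' x - f' x ^ 2 * s' x, key (fun x => f x * s x) fun x => 2 * d' x,
    key d fun x => 2 * (f' x * s' x), key (fun x => f x * s x) fun x => 2 * (f' x * s' x), hs, hs',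
    hd, hf]
  ring

/-- Test functions may be assumed to be centred: subtracting the mean `a` of `f` adds `a²`. -/
theorem testValue_center {N : Type u} [Fintype N] {σ δ : Op N} (hσ : ∑ s, (σ s s).re = 1)
    (hδ : ∑ s, (δ s s).re = 0) (f : N → ℝ) :
    ∃ g : N → ℝ, ∑ s, g s * (σ s s).re = 0 ∧ testValue σ δ f ≤ testValue σ δ g := by
  set a := ∑ s, f s * (σ s s).re with ha
  refine ⟨fun s => f s - a, ?_, ?_⟩
  · simp only [sub_mul, Finset.sum_sub_distrib, ← Finset.mul_sum, hσ, ← ha]; ring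
  · have e : testValue σ δ (fun s => f s - a) = testValue σ δ f + a ^ 2 := by
      have : ∀ s, 2 * (f s - a) * (δ s s).re - (f s - a) ^ 2 * (σ s s).re =
          (2 * f s * (δ s s).re - f s ^ 2 * (σ s s).re) - 2 * a * (δ s s).re +
          2 * a * (f s * (σ s s).re) - a ^ 2 * (σ s s).re := fun s => by ring
      simp only [testValue, this]
      rw [Finset.sum_sub_distrib, Finset.sum_add_distrib, Finset.sum_sub_distrib, ← Finset.mul_sum,
        ← Finset.mul_sum, ← Finset.mul_sum, hσ, hδ, ← ha]
      ring
    rw [e]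
    nlinarith [sq_nonneg a]

theorem Reach.sum_eq (hΦ : IsChannel Φ) (hΔ : IsTZ Δ) {N : Type u} [Fintype N] {σ δ : Op N}
    (h : Reach Φ Δ n N σ δ) : ∑ s, (σ s s).re = 1 ∧ ∑ s, (δ s s).re = 0 := by
  constructor
  · have := (h.isDensity hΦ).tr_eq
    rwa [tr, tsum_fintype] at this
  · obtain ⟨h1, h2⟩ := h.trFun_eq_zero hΦ hΔ
    rw [trFun_eq_of_mem_TC h1, opTrace, tsum_fintype] at h2
    have := congrArg Complex.re h2
    simpa using this

/-- Information adds up on independent systems: centred test functions may simply be added. -/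
theorem reachInfo_add_le {l : ℕ} {α β : Type u} {Φ'' Δ'' : OpMap α β} (hΦ : IsChannel Φ)
    (hΔ : IsTZ Δ) (hΦ' : IsChannel Φ') (hΔ' : IsTZ Δ')
    (hne : ∃ σ δ : Op PUnit, Reach Φ Δ m PUnit σ δ)
    (hne' : ∃ σ δ : Op PUnit, Reach Φ' Δ' n PUnit σ δ)
    (H : ∀ (N N' : Type u) (σ δ : Op N) (σ' δ' : Op N'), Reach Φ Δ m N σ δ →
      Reach Φ' Δ' n N' σ' δ' →
      Reach Φ'' Δ'' l (N × N') (σ ⊗ₖ σ') (δ ⊗ₖ σ' + σ ⊗ₖ δ')) :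
    reachInfo Φ Δ m + reachInfo Φ' Δ' n ≤ reachInfo Φ'' Δ'' l := by
  have hreal : ∀ {ν η : Type u} {Θ Ξ : OpMap ν η} {k : ℕ} (hΘ : IsChannel Θ) (hΞ : IsTZ Ξ)
      (hn : ∃ σ δ : Op PUnit, Reach Θ Ξ k PUnit σ δ),
      {j | ∃ (N : Type u) (_ : Fintype N) (σ δ : Op N) (f : N → ℝ), Reach Θ Ξ k N σ δ ∧
        (∀ s, (δ s s).im = 0) ∧ j = ENNReal.ofReal (testValue σ δ f)}.Nonempty := by
    rintro ν η Θ Ξ k hΘ hΞ ⟨σ, δ, hr⟩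
    refine ⟨_, PUnit, inferInstance, σ, δ, fun _ => 0, hr, fun s => ?_, rfl⟩
    obtain ⟨h1, h2⟩ := hr.trFun_eq_zero hΘ hΞ
    rw [trFun_eq_of_mem_TC h1, opTrace, tsum_fintype] at h2
    have := congrArg Complex.im h2
    simpa using this
  rw [reachInfo, reachInfo, sSup_eq_iSup, sSup_eq_iSup]
  refine ENNReal.biSup_add_biSup_le (hreal hΦ hΔ hne) (hreal hΦ' hΔ' hne') ?_
  rintro _ ⟨N, _, σ, δ, f, hr, h0, rfl⟩ _ ⟨N', _, σ', δ', f', hr', h0', rfl⟩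
  -- the test function may be taken to have a nonnegative value
  have hnn : ∀ {M : Type u} [Fintype M] (τ ε : Op M) (f : M → ℝ), ∃ g : M → ℝ,
      0 ≤ testValue τ ε g ∧
        ENNReal.ofReal (testValue τ ε f) ≤ ENNReal.ofReal (testValue τ ε g) := by
    intro M _ τ ε f
    by_cases h : 0 ≤ testValue τ ε f
    · exact ⟨f, h, le_rfl⟩
    · refine ⟨fun _ => 0, by simp [testValue], ?_⟩
      rw [ENNReal.ofReal_of_nonpos (not_le.1 h).le]; exact bot_le
  obtain ⟨g, hg, hfg⟩ := hnn σ δ f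
  obtain ⟨g', hg', hfg'⟩ := hnn σ' δ' f'
  refine (add_le_add hfg hfg').trans ?_
  rw [← ENNReal.ofReal_add hg hg']
  have hs := hr.sum_eq hΦ hΔ
  have hs' := hr'.sum_eq hΦ' hΔ'
  obtain ⟨c, hc, hgc⟩ := testValue_center hs.1 hs.2 g
  obtain ⟨c', -, hgc'⟩ := testValue_center hs'.1 hs'.2 g'
  have hσ := (hr.isDensity hΦ).1.1
  have hσ' := (hr'.isDensity hΦ').1.1
  have hre : ∀ p : N × N', (δ ⊗ₖ σ' + σ ⊗ₖ δ') p p =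
      (((δ p.1 p.1).re * (σ' p.2 p.2).re + (σ p.1 p.1).re * (δ' p.2 p.2).re : ℝ) : ℂ) := by
    intro p
    have e1 : δ p.1 p.1 = ((δ p.1 p.1).re : ℂ) := Complex.ext rfl (h0 _)
    have e2 : δ' p.2 p.2 = ((δ' p.2 p.2).re : ℂ) := Complex.ext rfl (h0' _)
    rw [Matrix.add_apply, Matrix.kroneckerMap_apply, Matrix.kroneckerMap_apply, e1, e2,
      diag_eq_re hσ, diag_eq_re hσ']
    push_cast
    simp
  have hre2 : ∀ p : N × N', ((σ ⊗ₖ σ') p p).re = (σ p.1 p.1).re * (σ' p.2 p.2).re := by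
    intro p
    rw [Matrix.kroneckerMap_apply, diag_eq_re hσ, diag_eq_re hσ', ← Complex.ofReal_mul]
    simp
  have hv : testValue (σ ⊗ₖ σ') (δ ⊗ₖ σ' + σ ⊗ₖ δ') (fun p => c p.1 + c' p.2) =
      testValue σ δ c + testValue σ' δ' c' := by
    rw [testValue, testValue, testValue, ← sum_prod_test hs.1 hs'.1 hs.2 hc]
    refine Finset.sum_congr rfl fun p _ => ?_
    rw [hre, hre2, Complex.ofReal_re]
  have := le_reachInfo (fun p : N × N' => c p.1 + c' p.2) (H _ _ _ _ _ _ hr hr') (fun p => by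
    rw [hre, Complex.ofReal_im])
  refine le_trans (ENNReal.ofReal_le_ofReal ?_) this
  rw [hv]; linarith

theorem exists_reach [Nonempty ι] (Φ Δ : OpMap ι o) (n : ℕ) :
    ∃ σ δ : Op PUnit, Reach Φ Δ n PUnit σ δ := by
  have h : ∃ σ δ : Op ι, Reach Φ Δ n ι σ δ := by
    induction n with
    | zero =>
      obtain ⟨ρ, hρ⟩ := exists_isDensity (α := ι)
      exact ⟨ρ, 0, reach_zero hρ⟩
    | succ n ih =>
      obtain ⟨σ, δ, h⟩ := ih
      obtain ⟨ρ, hρ⟩ := exists_isDensity (α := ι)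
      exact ⟨_, _, ((h.post (isChannel_reindex (Equiv.prodPUnit ι))).use).post
        (isChannel_prep (o × PUnit) hρ)⟩
  obtain ⟨σ, δ, h⟩ := h
  exact ⟨_, _, h.post (isChannel_trCh ι)⟩

theorem reachInfo_seq [Nonempty ι] (hΦ : IsChannel Φ) (hΔ : IsTZ Δ) (m n : ℕ) :
    reachInfo Φ Δ m + reachInfo Φ Δ n ≤ reachInfo Φ Δ (m + n) :=
  reachInfo_add_le hΦ hΔ hΦ hΔ (exists_reach Φ Δ m) (exists_reach Φ Δ n)
    fun _ _ _ _ _ _ h h' => h.seq h'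

theorem reachInfo_par [Nonempty ι] [Nonempty ι'] (hΦ : IsChannel Φ) (hΔ : IsTZ Δ)
    (hΦ' : IsChannel Φ') (hΔ' : IsTZ Δ') (n : ℕ) :
    reachInfo Φ Δ n + reachInfo Φ' Δ' n ≤ reachInfo (tensor Φ Φ') (tensor Δ Φ' + tensor Φ Δ') n :=
  reachInfo_add_le hΦ hΔ hΦ' hΔ' (exists_reach Φ Δ n) (exists_reach Φ' Δ' n)
    fun _ _ _ _ _ _ h h' => h.par h'

theorem nonempty_pow (ι : Type u) [Nonempty ι] : ∀ n, Nonempty (Pow ι n)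
  | 0 => inferInstanceAs (Nonempty PUnit)
  | n + 1 => by
    have := nonempty_pow ι n
    exact inferInstanceAs (Nonempty (ι × Pow ι n))

theorem mul_reachInfo_le [Nonempty ι] (hΦ : IsChannel Φ) (hΔ : IsTZ Δ) (m n : ℕ) :
    m * reachInfo Φ Δ n ≤ reachInfo (tensorPow Φ m) (tensorDeriv Φ Δ m) n := by
  induction m with
  | zero => simp
  | succ m ih =>
    have := nonempty_pow ι m
    have h := reachInfo_par hΦ hΔ (isChannel_tensorPow hΦ m) (isTZ_tensorDeriv hΦ hΔ m) n
    rw [Nat.cast_succ, add_mul, one_mul, add_comm]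
    exact (add_le_add_right ih _).trans h

theorem reachInfo_pow_add [Nonempty ι] (hΦ : IsChannel Φ) (hΔ : IsTZ Δ) (m n : ℕ) :
    reachInfo (tensorPow Φ m) (tensorDeriv Φ Δ m) 1 +
      reachInfo (tensorPow Φ n) (tensorDeriv Φ Δ n) 1 ≤
      reachInfo (tensorPow Φ (m + n)) (tensorDeriv Φ Δ (m + n)) 1 := by
  have := nonempty_pow ι m
  have := nonempty_pow ι n
  rw [add_comm]
  refine (reachInfo_par (isChannel_tensorPow hΦ n) (isTZ_tensorDeriv hΦ hΔ n)
    (isChannel_tensorPow hΦ m) (isTZ_tensorDeriv hΦ hΔ m) 1).trans ?_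
  exact reachInfo_simulate (isChannel_reindex (powSplit ι m n))
    (isChannel_reindex (powSplit o m n).symm) (tensorPow_add Φ Δ m n).1 (tensorPow_add Φ Δ m n).2 1

end

section

variable {α β γ ι o ι' o' κ : Type u} {X X' : Type u} [MeasurableSpace X] [MeasurableSpace X']

/-! ### Simulations of a channel -/

/-- `Φ` is the average of the channels `Λ x` with respect to `q`, and `Δ` is the average weighted
with the score function `g`. -/
def SimBy (q : Measure X) (g : X → ℝ) (Λ : X → OpMap α β) (Φ Δ : OpMap α β) : Prop :=
  (∀ x, IsChannel (Λ x)) ∧ ∀ ρ, IsDensity ρ →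
    IsMixture q (fun x => Λ x ρ) (Φ ρ) ∧ Δ ρ = wavg q g fun x => Λ x ρ

variable {q : Measure X} {q' : Measure X'} {g : X → ℝ} {g' : X' → ℝ}

theorem SimBy.congr {Λ Λ' : X → OpMap α β} {Φ Δ Φ' Δ' : OpMap α β} (h : SimBy q g Λ Φ Δ)
    (hΛ : ∀ x, IsChannel (Λ' x)) (h1 : ∀ x ρ, IsDensity ρ → Λ x ρ = Λ' x ρ)
    (h2 : ∀ ρ, IsDensity ρ → Φ ρ = Φ' ρ) (h3 : ∀ ρ, IsDensity ρ → Δ ρ = Δ' ρ) :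
    SimBy q g Λ' Φ' Δ' := by
  refine ⟨hΛ, fun ρ hρ => ?_⟩
  have := h.2 ρ hρ
  simp only [h1 _ ρ hρ, h2 ρ hρ, h3 ρ hρ] at this
  exact this

theorem SimBy.pre {Λ : X → OpMap β γ} {Φ Δ : OpMap β γ} (h : SimBy q g Λ Φ Δ)
    {E : OpMap α β} (hE : IsChannel E) :
    SimBy q g (fun x => Λ x ∘ₗ E) (Φ ∘ₗ E) (Δ ∘ₗ E) :=
  ⟨fun x => (h.1 x).comp hE, fun ρ hρ => h.2 (E ρ) (hE.isDensity hρ)⟩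

theorem SimBy.post [IsProbabilityMeasure q] (hg : IsScore q g) {Λ : X → OpMap α β}
    {Φ Δ : OpMap α β} (h : SimBy q g Λ Φ Δ) {C : OpMap β γ} (hC : IsChannel C) :
    SimBy q g (fun x => C ∘ₗ Λ x) (C ∘ₗ Φ) (C ∘ₗ Δ) := by
  refine ⟨fun x => hC.comp (h.1 x), fun ρ hρ => ⟨(h.2 ρ hρ).1.map hC, ?_⟩⟩
  rw [LinearMap.comp_apply, (h.2 ρ hρ).2]
  exact (h.2 ρ hρ).1.map_wavg hC hg.integrable

/-- The defining identities of a simulation extend from states to the trace class. -/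
theorem SimBy.of_mem_TC [IsProbabilityMeasure q] (hg : IsScore q g) {Λ : X → OpMap α β}
    {Φ Δ : OpMap α β} (h : SimBy q g Λ Φ Δ) {T : Op α} (hT : T ∈ TC α) (i j : β) :
    Integrable (fun x => Λ x T i j) q ∧ Integrable (fun x => (g x : ℂ) * Λ x T i j) q ∧
      Φ T i j = ∫ x, Λ x T i j ∂q ∧ Δ T i j = ∫ x, (g x : ℂ) * Λ x T i j ∂q := by
  have hsmul : ∀ (c : ℂ) (S : Op α), (Integrable (fun x => Λ x S i j) q ∧
      Integrable (fun x => (g x : ℂ) * Λ x S i j) q ∧ Φ S i j = ∫ x, Λ x S i j ∂q ∧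
      Δ S i j = ∫ x, (g x : ℂ) * Λ x S i j ∂q) →
      (Integrable (fun x => Λ x (c • S) i j) q ∧
      Integrable (fun x => (g x : ℂ) * Λ x (c • S) i j) q ∧
      Φ (c • S) i j = ∫ x, Λ x (c • S) i j ∂q ∧
      Δ (c • S) i j = ∫ x, (g x : ℂ) * Λ x (c • S) i j ∂q) := by
    rintro c S ⟨h1, h2, h3, h4⟩
    have e : ∀ x, (g x : ℂ) * (c * Λ x S i j) = c * ((g x : ℂ) * Λ x S i j) := fun x => by ring
    simp only [map_smul, Matrix.smul_apply, smul_eq_mul, e]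
    rw [integral_const_mul, integral_const_mul, h3, h4]
    exact ⟨h1.const_mul c, h2.const_mul c, rfl, rfl⟩
  induction hT using Submodule.span_induction with
  | mem S hS =>
    rcases isEmpty_or_nonempty α with hα | hα
    · rw [Subsingleton.elim S 0]
      simp
    · obtain ⟨ρ, hρ, e⟩ := exists_density_of_isPosTraceClass hS
      rw [e]
      obtain ⟨h1, h2⟩ := h.2 ρ hρ
      refine hsmul _ _ ⟨h1.integrable_entry i j, h1.integrable hg.integrable i j, h1.eq i j, ?_⟩
      rw [h2]; rfl
  | zero => simp
  | add S S' _ _ h1 h2 =>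
    simp only [map_add, Matrix.add_apply, mul_add]
    rw [integral_add h1.1 h2.1, integral_add h1.2.1 h2.2.1, ← h1.2.2.1, ← h2.2.2.1, ← h1.2.2.2,
      ← h2.2.2.2]
    exact ⟨h1.1.add h2.1, h1.2.1.add h2.2.1, rfl, rfl⟩
  | smul c S _ h1 => exact hsmul c S h1

theorem SimBy.withId [IsProbabilityMeasure q] (hg : IsScore q g) {Λ : X → OpMap α β}
    {Φ Δ : OpMap α β} (hΦ : IsChannel Φ) (h : SimBy q g Λ Φ Δ) (κ : Type u) :
    SimBy q g (fun x => withId κ (Λ x)) (withId κ Φ) (withId κ Δ) := by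
  refine ⟨fun x => (h.1 x).withId κ, fun ρ hρ => ?_⟩
  have hb := fun k l => h.of_mem_TC hg (block_mem_TC hρ.1.mem_TC k l)
  refine ⟨⟨fun x => ((h.1 x).withId κ).isDensity hρ, fun i j => ?_, (hΦ.withId κ).isDensity hρ,
    fun i j => ?_⟩, ?_⟩
  · exact (hb i.2 j.2 i.1 j.1).1.aemeasurable
  · exact (hb i.2 j.2 i.1 j.1).2.2.1
  · ext i j
    exact (hb i.2 j.2 i.1 j.1).2.2.2

theorem single_mem_TC [DecidableEq α] (a b : α) : Matrix.single a b (1 : ℂ) ∈ TC α := by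
  -- the matrix unit is an off-diagonal block of a positive matrix of rank one
  let J : Op (ULift.{u} (Fin 2)) := Matrix.vecMulVec (fun _ => 1) (star fun _ => 1)
  let e : ULift.{u} (Fin 2) → α × ULift.{u} (Fin 2) := fun s =>
    (if s.down = 0 then a else b, s)
  have he : Function.Injective e := fun s t h => congrArg Prod.snd h
  have hJ : IsPosTraceClass J :=
    ⟨Matrix.posSemidef_vecMulVec_self_star _, (hasSum_fintype _).summable⟩
  convert block_mem_TC (Submodule.subset_span (posTC_extZ he hJ).1)
    (ULift.up 0) (ULift.up 1) using 1
  ext i j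
  by_cases hi : a = i
  · by_cases hj : b = j
    · subst hi hj
      simpa [J, e, block, Matrix.vecMulVec_apply] using
        (extZ_apply he J (ULift.up 0) (ULift.up 1)).symm
    · rw [Matrix.single_apply_of_ne _ _ _ _ _ (by simp [hj])]
      refine (extZ_apply_right _ _ ?_).symm
      rintro ⟨s, h⟩
      obtain rfl : s = ULift.up 1 := congrArg Prod.snd h
      exact hj (by simpa [e] using congrArg Prod.fst h)
  · rw [Matrix.single_apply_of_ne _ _ _ _ _ (by simp [hi])]
    refine (extZ_apply_left _ ?_ _).symm
    rintro ⟨s, h⟩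
    obtain rfl : s = ULift.up 0 := congrArg Prod.snd h
    exact hi (by simpa [e] using congrArg Prod.fst h)

/-- Measurability of the outputs of a family of channels applied to a family of states, jointly in
both parameters. -/
theorem SimBy.aemeasurable_prod [IsProbabilityMeasure q] [IsProbabilityMeasure q']
    {σ : X → Op α} {S : Op α} (H : IsMixture q σ S) (hg' : IsScore q' g') {Λ : X' → OpMap α β}
    {Φ Δ : OpMap α β} (h : SimBy q' g' Λ Φ Δ) (i j : β) :
    AEMeasurable (fun p : X × X' => Λ p.2 (σ p.1) i j) (q.prod q') := by
  classical
  obtain ⟨F, hF⟩ := H.exists_exhaustion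
  refine aemeasurable_of_tendsto_metrizable_ae atTop
    (f := fun n p => Λ p.2 (mask (F n) (σ p.1)) i j) (fun n => ?_) ?_
  · simp only [IsChannel.apply_mask]
    refine Finset.aemeasurable_fun_sum _ fun a _ => Finset.aemeasurable_fun_sum _ fun b _ => ?_
    refine AEMeasurable.mul ?_ ?_
    · exact (H.meas a b).comp_quasiMeasurePreserving Measure.quasiMeasurePreserving_fst
    · exact ((h.of_mem_TC hg' (single_mem_TC a b) i j).1.aemeasurable).comp_quasiMeasurePreserving
        Measure.quasiMeasurePreserving_snd
  · have := Measure.quasiMeasurePreserving_fst (μ := q) (ν := q') |>.ae hF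
    filter_upwards [this] with p hp
    refine (h.1 p.2).tendsto_mask (H.density p.1).1 ?_ i j
    rwa [(H.density p.1).tr_eq]

/-- Successive simulation with independent programs. -/
theorem SimBy.comp [IsProbabilityMeasure q] [IsProbabilityMeasure q'] (hg : IsScore q g)
    (hg' : IsScore q' g') {Λ : X → OpMap α β} {Φ Δ : OpMap α β} (h : SimBy q g Λ Φ Δ)
    {Λ' : X' → OpMap β γ} {Φ' Δ' : OpMap β γ} (hΦ' : IsChannel Φ') (h' : SimBy q' g' Λ' Φ' Δ') :
    SimBy (q.prod q') (fun p => g p.1 + g' p.2) (fun p => Λ' p.2 ∘ₗ Λ p.1) (Φ' ∘ₗ Φ)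
      (Δ' ∘ₗ Φ + Φ' ∘ₗ Δ) := by
  refine ⟨fun p => (h'.1 p.2).comp (h.1 p.1), fun ρ hρ => ?_⟩
  obtain ⟨H, hD⟩ := h.2 ρ hρ
  have hmeas : ∀ i j, AEMeasurable (fun p : X × X' => Λ' p.2 (Λ p.1 ρ) i j) (q.prod q') :=
    fun i j => h'.aemeasurable_prod H hg' i j
  have hb : ∀ (i j) (p : X × X'), ‖Λ' p.2 (Λ p.1 ρ) i j‖ ≤ 1 := fun i j p =>
    ((h'.1 p.2).isDensity (H.density p.1)).norm_entry_le_one i j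
  have hint : ∀ i j, Integrable (fun p : X × X' => Λ' p.2 (Λ p.1 ρ) i j) (q.prod q') :=
    fun i j => by simpa using integrable_weight (integrable_const (1 : ℝ)) (hmeas i j) (hb i j)
  have hgi := hg.integrable.comp_fst q'
  have hgi' := hg'.integrable.comp_snd q
  have i1 := fun i j => integrable_weight hgi (hmeas i j) (hb i j)
  have i2 := fun i j => integrable_weight hgi' (hmeas i j) (hb i j)
  have inner : ∀ (x i j), ∫ x', Λ' x' (Λ x ρ) i j ∂q' = Φ' (Λ x ρ) i j := fun x i j =>
    ((h'.2 _ (H.density x)).1.eq i j).symm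
  refine ⟨⟨fun p => (h'.1 p.2).isDensity (H.density p.1), hmeas, hΦ'.isDensity H.avg,
    fun i j => ?_⟩, ?_⟩
  · change Φ' (Φ ρ) i j = ∫ p : X × X', Λ' p.2 (Λ p.1 ρ) i j ∂q.prod q'
    rw [integral_prod _ (hint i j)]
    simp only [inner]
    exact (H.map hΦ').eq i j
  · ext i j
    change Δ' (Φ ρ) i j + Φ' (Δ ρ) i j =
      ∫ p : X × X', ((g p.1 + g' p.2 : ℝ) : ℂ) * Λ' p.2 (Λ p.1 ρ) i j ∂q.prod q'
    simp only [Complex.ofReal_add, add_mul]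
    rw [integral_add (i1 i j) (i2 i j), add_comm]
    congr 1
    · rw [integral_prod _ (i1 i j)]
      simp only [integral_const_mul, inner]
      rw [hD, H.map_wavg hΦ' hg.integrable]; rfl
    · rw [integral_prod_symm _ (i2 i j)]
      simp only [integral_const_mul]
      rw [(h'.2 _ H.avg).2]
      refine integral_congr_ae (ae_of_all _ fun x' => ?_)
      change (g' x' : ℂ) * Λ' x' (Φ ρ) i j = (g' x' : ℂ) * ∫ x, Λ' x' (Λ x ρ) i j ∂q
      rw [(H.map (h'.1 x')).eq]

/-! ### The maximal metric -/

theorem GMax_le [IsProbabilityMeasure q] (hg : IsScore q g) {Λ : X → OpMap ι o}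
    {Φ Δ : OpMap ι o} (h : SimBy q g Λ Φ Δ) :
    GMax Φ Δ ≤ ENNReal.ofReal (∫ x, g x ^ 2 ∂q) := by
  obtain ⟨h1, h2, h3⟩ := hg.program
  refine sInf_le ⟨X, _, q, q.withDensityᵥ g, Λ, ⟨h1, h.1, fun ρ hρ i j => ?_⟩, h2.symm⟩
  obtain ⟨H, hD⟩ := h.2 ρ hρ
  refine ⟨H.meas i j, H.eq i j, ?_⟩
  rw [h3 _ (H.meas i j) fun x => (H.density x).norm_entry_le_one i j, hD]; rfl

/-- A lower bound for the maximal metric has to be checked for simulations with score functions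
only. -/
theorem le_GMax {c : ℝ≥0∞} {Φ Δ : OpMap ι o} (hΦ : IsChannel Φ)
    (H : ∀ (X : Type u) (_ : MeasurableSpace X) (q : Measure X) (g : X → ℝ) (Λ : X → OpMap ι o),
      IsProbabilityMeasure q → IsScore q g → SimBy q g Λ Φ Δ →
      c ≤ ENNReal.ofReal (∫ x, g x ^ 2 ∂q)) : c ≤ GMax Φ Δ := by
  refine le_sInf ?_
  rintro j ⟨X, _, q, δ, Λ, ⟨hp, hΛ, h⟩, rfl⟩
  by_cases hfin : fisherInfo q δ = ⊤
  · rw [hfin]; exact le_top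
  obtain ⟨g, hg, hJ, hint⟩ := exists_score hp hfin
  rw [hJ]
  refine H X _ q g Λ hp.1 hg ⟨hΛ, fun ρ hρ => ⟨⟨fun x => (hΛ x).isDensity hρ,
    fun i j => (h ρ hρ i j).1, hΦ.isDensity hρ, fun i j => (h ρ hρ i j).2.1⟩, ?_⟩⟩
  ext i j
  rw [(h ρ hρ i j).2.2, hint _ (h ρ hρ i j).1
    fun x => ((hΛ x).isDensity hρ).norm_entry_le_one i j]
  rfl

/-- The maximal metric is monotone under pre- and postprocessing. -/
theorem GMax_mono {Φ Δ : OpMap ι o} {Φ' Δ' : OpMap ι' o'} (hΦ : IsChannel Φ)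
    {E : OpMap ι' ι} {C : OpMap o o'} (hE : IsChannel E) (hC : IsChannel C)
    (e1 : ∀ ρ, IsDensity ρ → C (Φ (E ρ)) = Φ' ρ) (e2 : ∀ ρ, IsDensity ρ → C (Δ (E ρ)) = Δ' ρ) :
    GMax Φ' Δ' ≤ GMax Φ Δ := by
  refine le_GMax hΦ fun X _ q g Λ _ hg h => ?_
  exact GMax_le hg (((h.pre hE).post hg hC).congr (fun x => hC.comp ((h.1 x).comp hE))
    (fun _ _ _ => rfl) e1 e2)

/-- Independent simulations of two channels simulate their tensor product. -/
theorem GMax_tensor_le {Φ Δ : OpMap ι o} {Φ' Δ' : OpMap ι' o'} (hΦ : IsChannel Φ)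
    (hΦ' : IsChannel Φ') :
    GMax (tensor Φ Φ') (tensor Δ Φ' + tensor Φ Δ') ≤ GMax Φ Δ + GMax Φ' Δ' := by
  have key : ∀ (X : Type u) (_ : MeasurableSpace X) (q : Measure X) (g : X → ℝ)
      (Λ : X → OpMap ι o), IsProbabilityMeasure q → IsScore q g → SimBy q g Λ Φ Δ →
      GMax (tensor Φ Φ') (tensor Δ Φ' + tensor Φ Δ') ≤
        ENNReal.ofReal (∫ x, g x ^ 2 ∂q) + GMax Φ' Δ' := by
    intro X _ q g Λ _ hg h
    refine tsub_le_iff_left.1 (le_GMax hΦ' fun X' _ q' g' Λ' _ hg' h' => tsub_le_iff_left.2 ?_)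
    have h1 := ((h'.withId hg' hΦ' ι).pre (isChannel_reindex (Equiv.prodComm ι' ι))).post hg'
      (isChannel_reindex (Equiv.prodComm ι o'))
    have h2 := h1.comp hg' hg (hΦ.withId o') (h.withId hg hΦ o')
    obtain ⟨h3, h4⟩ := hg'.prod hg
    rw [← ENNReal.ofReal_add (integral_nonneg fun x => sq_nonneg _)
      (integral_nonneg fun x => sq_nonneg _), add_comm (∫ x, g x ^ 2 ∂q), ← h4]
    exact GMax_le h3 h2
  exact tsub_le_iff_right.1 (le_GMax hΦ fun X _ q g Λ hq hg h =>
    tsub_le_iff_right.2 (key X _ q g Λ hq hg h))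

end

section

variable {α β γ ι o κ ω ω' : Type u} {X X' : Type u} [MeasurableSpace X] [MeasurableSpace X']

/-! ### Channels commute with the partial trace -/

open Classical in
/-- The partial trace over `ω` is the sum of the diagonal blocks, also after a channel has been
applied: the blocks left out of a finite partial sum have small total trace. -/
theorem IsChannel.hasSum_block {C : OpMap α β} (hC : IsChannel C) {A : Op (α × ω)}
    (hA : IsPosTraceClass A) (i j : β) :
    HasSum (fun w => C (block A w w) i j) (C (ptr α ω A) i j) := by
  have hb := hasSum_tr_block hA
  have key : ∀ F : Finset ω, ‖C (ptr α ω A) i j - ∑ w ∈ F, C (block A w w) i j‖ ≤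
      tr A - ∑ w ∈ F, tr (block A w w) := by
    intro F
    let χ : α × ω → ℝ := fun x => if x.2 ∈ F then 0 else 1
    have hR : IsPosTraceClass (scale χ A) := by
      refine isPosTraceClass_of_summable (posSemidef_scale hA.1 χ) ?_
      refine (summable_re hA).of_nonneg_of_le (fun x => diag_re_nonneg (posSemidef_scale hA.1 χ) x)
        fun x => ?_
      have := diag_re_nonneg hA.1 x
      by_cases hx : x.2 ∈ F <;> simp [scale, χ, hx, this]
    have hbl : ∀ w, block (scale χ A) w w = if w ∈ F then 0 else block A w w := by
      intro w
      by_cases hw : w ∈ F <;> ext a b <;> simp [block, scale, χ, hw]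
    have hp : ptr α ω A - ∑ w ∈ F, block A w w = ptr α ω (scale χ A) := by
      rw [ptr_eq_partialTrace hA, ptr_eq_partialTrace hR]
      ext a b
      simp only [Matrix.sub_apply, Matrix.sum_apply]
      have h1 := (summable_block hA a b).hasSum
      have h2 : HasSum (fun w => if w ∈ F then A (a, w) (b, w) else 0)
          (∑ w ∈ F, A (a, w) (b, w)) := by
        have : HasSum (fun w => if w ∈ F then A (a, w) (b, w) else 0)
            (∑ w ∈ F, if w ∈ F then A (a, w) (b, w) else 0) :=
          hasSum_sum_of_ne_finset_zero fun b hb => if_neg hb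
        rwa [Finset.sum_congr rfl fun w hw => if_pos hw] at this
      refine ((h1.sub h2).congr_fun fun w => ?_).tsum_eq.symm
      have := congrFun (congrFun (hbl w) a) b
      by_cases hw : w ∈ F <;> simp [block, hw] at this ⊢ <;> exact this
    have ht : tr (ptr α ω (scale χ A)) = tr A - ∑ w ∈ F, tr (block A w w) := by
      rw [(isChannel_ptr α ω).tr_eq hR]
      have h2 : HasSum (fun w => if w ∈ F then tr (block A w w) else 0)
          (∑ w ∈ F, tr (block A w w)) := by
        have : HasSum (fun w => if w ∈ F then tr (block A w w) else 0)
            (∑ w ∈ F, if w ∈ F then tr (block A w w) else 0) :=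
          hasSum_sum_of_ne_finset_zero fun b hb => if_neg hb
        rwa [Finset.sum_congr rfl fun w hw => if_pos hw] at this
      refine (hasSum_tr_block hR).unique ((hb.sub h2).congr_fun fun w => ?_)
      rw [hbl]
      by_cases hw : w ∈ F <;> simp [hw, tr]
    have hPR := (isChannel_ptr α ω).posTC hR
    have e : C (ptr α ω A) i j - ∑ w ∈ F, C (block A w w) i j = C (ptr α ω (scale χ A)) i j := by
      rw [← hp, map_sub, map_sum, Matrix.sub_apply, Matrix.sum_apply]
    rw [e, ← ht, ← hC.tr_eq hPR]
    exact norm_entry_le_tr (hC.posTC hPR) i j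
  rw [HasSum, SummationFilter.unconditional_filter, tendsto_iff_norm_sub_tendsto_zero]
  have hz : Tendsto (fun F : Finset ω => tr A - ∑ w ∈ F, tr (block A w w)) atTop (𝓝 0) := by
    have := (tendsto_const_nhds (x := tr A)).sub hb
    rwa [sub_self] at this
  refine squeeze_zero (fun _ => norm_nonneg _) (fun F => ?_) hz
  rw [norm_sub_rev]
  exact key F

theorem IsChannel.apply_ptr {C : OpMap α β} (hC : IsChannel C) {A : Op (α × ω)}
    (hA : IsPosTraceClass A) : C (ptr α ω A) = ptr β ω (ChannelMetric.withId ω C A) := by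
  ext i j
  rw [ptr_eq_partialTrace ((hC.withId ω).posTC hA), ← (hC.hasSum_block hA i j).tsum_eq]
  rfl

/-- Regrouping of a threefold product. -/
def regroup (α ω ω' : Type u) : α × (ω × ω') ≃ (α × ω') × ω where
  toFun x := ((x.1, x.2.2), x.2.1)
  invFun x := (x.1.1, (x.2, x.1.2))
  left_inv _ := rfl
  right_inv _ := rfl

/-- The partial trace over two factors can be taken successively. -/
theorem ptr_prod {T : Op ((α × ω') × ω)} (hT : IsPosTraceClass T) :
    ptr α (ω × ω') (reindex (regroup α ω ω') T) = ptr α ω (withId ω (ptr α ω') T) := by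
  have hT' := (isChannel_reindex (regroup α ω ω')).posTC hT
  rw [ptr_eq_partialTrace hT', ptr_eq_partialTrace (((isChannel_ptr α ω').withId ω).posTC hT)]
  ext a b
  refine (summable_block hT' a b).tsum_prod.trans (tsum_congr fun w => ?_)
  rw [withId_apply, ptr_eq_partialTrace (block_diag_posTC hT w)]
  rfl

/-! ### Simulations of adaptive protocols -/

/-- The channel obtained from an adaptive protocol whose uses of the channel are simulated by means
of a memory, which is initially in the state `τ` and is finally discarded. -/
def simMap (L : ℕ → OpMap (ι × ω) (o × ω)) (init : OpMap (ι × κ) (ι × κ))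
    (Ψ : ℕ → OpMap (o × κ) (ι × κ)) (n : ℕ) (τ : Op ω) : OpMap (ι × κ) (o × κ) :=
  ptr (o × κ) ω ∘ₗ adaptiveSim L init Ψ n ∘ₗ append (ι × κ) τ

theorem isChannel_adaptiveSim {L : ℕ → OpMap (ι × ω) (o × ω)} {init : OpMap (ι × κ) (ι × κ)}
    {Ψ : ℕ → OpMap (o × κ) (ι × κ)} (n : ℕ) (hL : ∀ k ≤ n, IsChannel (L k)) (hi : IsChannel init)
    (hΨ : ∀ k < n, IsChannel (Ψ k)) : IsChannel (adaptiveSim L init Ψ n) := by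
  induction n with
  | zero => exact ((hL 0 le_rfl).onMemory κ).comp (hi.withId ω)
  | succ n ih =>
    exact ((hL _ le_rfl).onMemory κ).comp (((hΨ n n.lt_succ_self).withId ω).comp
      (ih (fun k hk => hL k (hk.trans n.le_succ)) fun k hk => hΨ k (hk.trans n.lt_succ_self)))

theorem isChannel_simMap {L : ℕ → OpMap (ι × ω) (o × ω)} {init : OpMap (ι × κ) (ι × κ)}
    {Ψ : ℕ → OpMap (o × κ) (ι × κ)} (n : ℕ) (hL : ∀ k ≤ n, IsChannel (L k)) (hi : IsChannel init)
    (hΨ : ∀ k < n, IsChannel (Ψ k)) {τ : Op ω} (hτ : IsDensity τ) :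
    IsChannel (simMap L init Ψ n τ) :=
  (isChannel_ptr _ _).comp ((isChannel_adaptiveSim n hL hi hΨ).comp (isChannel_append _ hτ))

theorem simMap_apply {L : ℕ → OpMap (ι × ω) (o × ω)} {init : OpMap (ι × κ) (ι × κ)}
    {Ψ : ℕ → OpMap (o × κ) (ι × κ)} {n : ℕ} (hL : ∀ k ≤ n, IsChannel (L k)) (hi : IsChannel init)
    (hΨ : ∀ k < n, IsChannel (Ψ k)) {τ : Op ω} (hτ : IsDensity τ) {ρ : Op (ι × κ)}
    (hρ : IsDensity ρ) :
    simMap L init Ψ n τ ρ = partialTrace (adaptiveSim L init Ψ n (ρ ⊗ₖ τ)) :=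
  ptr_eq_partialTrace ((isChannel_adaptiveSim n hL hi hΨ).posTC (hρ.1.kron hτ.1))

/-- Simulation of all adaptive protocols with `n + 1` uses of the channel, with the tangent vector
given by a score function. -/
def AdaptiveSimBy (q : Measure X) (g : X → ℝ) (τ : Op ω) (Λ : X → ℕ → OpMap (ι × ω) (o × ω))
    (Φ Δ : OpMap ι o) (n : ℕ) : Prop :=
  IsDensity τ ∧ (∀ x, ∀ k ≤ n, IsChannel (Λ x k)) ∧
  ∀ (κ : Type u) (init : OpMap (ι × κ) (ι × κ)) (Ψ : ℕ → OpMap (o × κ) (ι × κ)),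
    IsChannel init → (∀ k < n, IsChannel (Ψ k)) →
    SimBy q g (fun x => simMap (Λ x) init Ψ n τ) (adaptive Φ init Ψ n) (adaptiveDeriv Φ Δ init Ψ n)

variable {q : Measure X} {q' : Measure X'} {g : X → ℝ} {g' : X' → ℝ} {Φ Δ : OpMap ι o} {n : ℕ}

theorem GMaxAdaptive_le [IsProbabilityMeasure q] (hg : IsScore q g) {τ : Op ω}
    {Λ : X → ℕ → OpMap (ι × ω) (o × ω)} (h : AdaptiveSimBy q g τ Λ Φ Δ n) :
    GMaxAdaptive Φ Δ n ≤ ENNReal.ofReal (∫ x, g x ^ 2 ∂q) := by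
  obtain ⟨h1, h2, h3⟩ := hg.program
  refine sInf_le ⟨X, ω, _, q, q.withDensityᵥ g, τ, Λ,
    ⟨h1, h.1, h.2.1, fun κ ρ init Ψ hP i j => ?_⟩, h2.symm⟩
  obtain ⟨hρ, hi, hΨ⟩ := hP
  obtain ⟨H, hD⟩ := (h.2.2 κ init Ψ hi hΨ).2 ρ hρ
  simp only [← simMap_apply (h.2.1 _) hi hΨ h.1 hρ]
  refine ⟨H.meas i j, H.eq i j, ?_⟩
  rw [h3 _ (H.meas i j) fun x => (H.density x).norm_entry_le_one i j, hD]; rfl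

/-- A lower bound for the maximal metric has to be checked for simulations with score functions
only. -/
theorem le_GMaxAdaptive {c : ℝ≥0∞} (hΦ : IsChannel Φ)
    (H : ∀ (X ω : Type u) (_ : MeasurableSpace X) (q : Measure X) (g : X → ℝ) (τ : Op ω)
      (Λ : X → ℕ → OpMap (ι × ω) (o × ω)), IsProbabilityMeasure q → IsScore q g →
      AdaptiveSimBy q g τ Λ Φ Δ n → c ≤ ENNReal.ofReal (∫ x, g x ^ 2 ∂q)) :
    c ≤ GMaxAdaptive Φ Δ n := by
  refine le_sInf ?_
  rintro j ⟨X, ω, _, q, δ, τ, Λ, ⟨hp, hτ, hΛ, h⟩, rfl⟩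
  by_cases hfin : fisherInfo q δ = ⊤
  · rw [hfin]; exact le_top
  obtain ⟨g, hg, hJ, hint⟩ := exists_score hp hfin
  rw [hJ]
  refine H X ω _ q g τ Λ hp.1 hg ⟨hτ, hΛ, fun κ init Ψ hi hΨ => ?_⟩
  have hc := fun x => isChannel_simMap n (hΛ x) hi hΨ hτ
  refine ⟨hc, fun ρ hρ => ?_⟩
  have h' := h κ ρ init Ψ ⟨hρ, hi, hΨ⟩
  simp only [← simMap_apply (hΛ _) hi hΨ hτ hρ] at h'
  refine ⟨⟨fun x => (hc x).isDensity hρ, fun i j => (h' i j).1,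
    ((comb_adaptive Φ Δ hi n hΨ).isChannel hΦ).isDensity hρ, fun i j => (h' i j).2.1⟩, ?_⟩
  ext i j
  rw [(h' i j).2.2, hint _ (h' i j).1 fun x => ((hc x).isDensity hρ).norm_entry_le_one i j]
  rfl

/-- A simulation of all adaptive protocols gives one of every composition with `n + 1` uses. -/
theorem AdaptiveSimBy.of_comb [IsProbabilityMeasure q] (hg : IsScore q g) (hΦ : IsChannel Φ)
    {τ : Op ω} {Λ : X → ℕ → OpMap (ι × ω) (o × ω)} (h : AdaptiveSimBy q g τ Λ Φ Δ n)
    {ρ₀ : Op α} (hρ₀ : IsDensity ρ₀) {P D : OpMap α β} (hc : Comb Φ Δ (n + 1) α β P D) :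
    ∃ Λ' : X → OpMap α β, SimBy q g Λ' P D := by
  obtain ⟨κ, E, init, Ψ, C, hE, hi, hΨ, hC, e1, e2⟩ := hc.compile hΦ hρ₀
  have h1 := ((h.2.2 κ init Ψ hi hΨ).pre hE).post hg hC
  exact ⟨_, h1.congr h1.1 (fun _ _ _ => rfl) (fun ρ _ => e1 ρ) fun ρ _ => e2 ρ⟩

/-- Measuring a mixture does not reveal more than the label of its component. -/
theorem testValue_wavg_le [IsProbabilityMeasure q] (hg : IsScore q g) {N : Type u} [Fintype N]
    {σ : X → Op N} {S : Op N} (H : IsMixture q σ S) (f : N → ℝ) :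
    testValue S (wavg q g σ) f ≤ ∫ x, g x ^ 2 ∂q := by
  have hi1 : ∀ s, Integrable (fun x => g x * (σ x s s).re) q := fun s => by
    simpa using (H.integrable hg.integrable s s).re
  have hi2 : ∀ s, Integrable (fun x => (σ x s s).re) q := fun s => by
    simpa using (H.integrable_entry s s).re
  have hi : ∀ s ∈ Finset.univ, Integrable
      (fun x => 2 * f s * (g x * (σ x s s).re) - f s ^ 2 * (σ x s s).re) q :=
    fun s _ => ((hi1 s).const_mul _).sub ((hi2 s).const_mul _)
  have e : testValue S (wavg q g σ) f =
      ∫ x, ∑ s, (2 * f s * (g x * (σ x s s).re) - f s ^ 2 * (σ x s s).re) ∂q := by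
    rw [integral_finsetSum _ hi, testValue]
    refine Finset.sum_congr rfl fun s _ => ?_
    rw [integral_sub ((hi1 s).const_mul _) ((hi2 s).const_mul _), integral_const_mul,
      integral_const_mul, H.wavg_diag_re hg.integrable]
    congr 2
    have := integral_re (H.integrable_entry s s)
    simp only [RCLike.re_eq_complex_re] at this
    rw [this, H.eq]
  rw [e]
  refine integral_mono (integrable_finsetSum _ hi) hg.memLp.integrable_sq fun x => ?_
  have h1 : ∑ s, (σ x s s).re = 1 := by
    have := (H.density x).tr_eq
    rwa [tr, tsum_fintype] at this
  calc ∑ s, (2 * f s * (g x * (σ x s s).re) - f s ^ 2 * (σ x s s).re)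
      ≤ ∑ s, g x ^ 2 * (σ x s s).re := by
        refine Finset.sum_le_sum fun s _ => ?_
        have h2 := mul_nonneg (sq_nonneg (g x - f s)) (diag_re_nonneg (H.density x).1.1 s)
        linarith
    _ = g x ^ 2 := by rw [← Finset.mul_sum, h1, mul_one]

/-- Nothing can be learnt from a simulated protocol that is not contained in the program. -/
theorem reachInfo_le_GMaxAdaptive (hΦ : IsChannel Φ) (n : ℕ) :
    reachInfo Φ Δ (n + 1) ≤ GMaxAdaptive Φ Δ n := by
  refine le_GMaxAdaptive hΦ fun X ω _ q g τ Λ _ hg h => sSup_le ?_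
  rintro j ⟨N, _, σ, δ, f, ⟨γ₀, ρ, P, D, hρ, hc, rfl, rfl⟩, -, rfl⟩
  obtain ⟨Λ', h'⟩ := h.of_comb hg hΦ hρ hc
  obtain ⟨H, hD⟩ := h'.2 ρ hρ
  rw [hD]
  exact ENNReal.ofReal_le_ofReal (testValue_wavg_le hg H f)

/-- Parallel use is a special adaptive protocol, so that it is covered by adaptive simulations. -/
theorem GMax_tensorPow_le_GMaxAdaptive [Nonempty ι] (hΦ : IsChannel Φ) (n : ℕ) :
    GMax (tensorPow Φ (n + 1)) (tensorDeriv Φ Δ (n + 1)) ≤ GMaxAdaptive Φ Δ n := by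
  have := nonempty_pow ι (n + 1)
  obtain ⟨ρ₀, hρ₀⟩ := exists_isDensity (α := Pow ι (n + 1) × PUnit.{u + 1})
  refine le_GMaxAdaptive hΦ fun X ω _ q g τ Λ _ hg h => ?_
  obtain ⟨Λ', h'⟩ := h.of_comb hg hΦ hρ₀ (comb_tensorPow Φ Δ (n + 1) PUnit.{u + 1})
  exact GMax_le hg ((h'.pre (isChannel_reindex (Equiv.prodPUnit (Pow ι (n + 1))))).post hg
    (isChannel_reindex (Equiv.prodPUnit (Pow o (n + 1))).symm))

/-- For a single use, a simulation without quantum memory suffices. -/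
theorem GMaxAdaptive_zero_le (hΦ : IsChannel Φ) : GMaxAdaptive Φ Δ 0 ≤ GMax Φ Δ := by
  refine le_GMax hΦ fun X _ q g Λ _ hg h => ?_
  obtain ⟨τ, hτ⟩ := exists_isDensity (α := PUnit.{u + 1})
  refine GMaxAdaptive_le hg (τ := τ) (Λ := fun x _ => withId PUnit (Λ x))
    ⟨hτ, fun x _ _ => (h.1 x).withId _, fun κ init Ψ hi hΨ => ?_⟩
  refine ((h.withId hg hΦ κ).pre hi).congr
    (fun x => isChannel_simMap 0 (fun _ _ => (h.1 x).withId _) hi hΨ hτ) (fun x ρ _ => ?_)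
    (fun _ _ => rfl) fun _ _ => rfl
  change _ = ptr (o × κ) PUnit (withId PUnit (withId κ (Λ x)) (withId PUnit init (ρ ⊗ₖ τ)))
  rw [withId_kron, withId_kron, ptr_kron, trFun_eq hτ.1.2, hτ.2, one_smul]
  rfl

/-! ### Concatenation of adaptive simulations -/

theorem adaptive_add (Φ Δ : OpMap ι o) (init : OpMap (ι × κ) (ι × κ))
    (Ψ : ℕ → OpMap (o × κ) (ι × κ)) (m n : ℕ) :
    adaptive Φ init Ψ (m + 1 + n) = adaptive Φ LinearMap.id (fun j => Ψ (m + 1 + j)) n ∘ₗ Ψ m ∘ₗ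
        adaptive Φ init Ψ m ∧
      adaptiveDeriv Φ Δ init Ψ (m + 1 + n) =
        adaptiveDeriv Φ Δ LinearMap.id (fun j => Ψ (m + 1 + j)) n ∘ₗ Ψ m ∘ₗ adaptive Φ init Ψ m +
        adaptive Φ LinearMap.id (fun j => Ψ (m + 1 + j)) n ∘ₗ Ψ m ∘ₗ
          adaptiveDeriv Φ Δ init Ψ m := by
  induction n with
  | zero => exact ⟨rfl, rfl⟩
  | succ n ih =>
    rw [← add_assoc]
    simp only [adaptive, adaptiveDeriv, ih.1, ih.2, LinearMap.comp_add, LinearMap.add_comp,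
      LinearMap.comp_assoc]
    exact ⟨trivial, (add_assoc (withId κ Δ ∘ₗ _) _ _).symm⟩

theorem adaptiveSim_add (L : ℕ → OpMap (ι × ω) (o × ω)) (init : OpMap (ι × κ) (ι × κ))
    (Ψ : ℕ → OpMap (o × κ) (ι × κ)) (m n : ℕ) :
    adaptiveSim L init Ψ (m + 1 + n) =
      adaptiveSim (fun j => L (m + 1 + j)) LinearMap.id (fun j => Ψ (m + 1 + j)) n ∘ₗ
        withId ω (Ψ m) ∘ₗ adaptiveSim L init Ψ m := by
  induction n with
  | zero => rfl
  | succ n ih =>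
    rw [← add_assoc]
    simp only [adaptiveSim, ih, LinearMap.comp_assoc]
    rfl

theorem adaptiveSim_congr {L L' : ℕ → OpMap (ι × ω) (o × ω)} (init : OpMap (ι × κ) (ι × κ))
    (Ψ : ℕ → OpMap (o × κ) (ι × κ)) (n : ℕ) (h : ∀ k ≤ n, L k = L' k) :
    adaptiveSim L init Ψ n = adaptiveSim L' init Ψ n := by
  induction n with
  | zero => rw [adaptiveSim, adaptiveSim, h 0 le_rfl]
  | succ n ih =>
    rw [adaptiveSim, adaptiveSim, h _ le_rfl, ih fun k hk => h k (hk.trans n.le_succ)]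

/-- The action on the first of two memories. -/
def liftFst (ω' : Type u) (L : OpMap (ι × ω) (o × ω)) : OpMap (ι × (ω × ω')) (o × (ω × ω')) :=
  reindex (Equiv.prodAssoc o ω ω').symm ∘ₗ withId ω' L ∘ₗ reindex (Equiv.prodAssoc ι ω ω')

/-- The action on the second of two memories. -/
def liftSnd (ω : Type u) (L : OpMap (ι × ω') (o × ω')) : OpMap (ι × (ω × ω')) (o × (ω × ω')) :=
  reindex (regroup o ω ω') ∘ₗ withId ω L ∘ₗ reindex (regroup ι ω ω').symm

theorem adaptiveSim_liftFst (L : ℕ → OpMap (ι × ω) (o × ω)) (init : OpMap (ι × κ) (ι × κ))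
    (Ψ : ℕ → OpMap (o × κ) (ι × κ)) (n : ℕ) :
    adaptiveSim (fun k => liftFst ω' (L k)) init Ψ n =
      reindex (Equiv.prodAssoc (o × κ) ω ω').symm ∘ₗ withId ω' (adaptiveSim L init Ψ n) ∘ₗ
        reindex (Equiv.prodAssoc (ι × κ) ω ω') := by
  induction n with
  | zero => rfl
  | succ n ih => rw [adaptiveSim, ih]; rfl

theorem adaptiveSim_liftSnd (L : ℕ → OpMap (ι × ω') (o × ω')) (init : OpMap (ι × κ) (ι × κ))
    (Ψ : ℕ → OpMap (o × κ) (ι × κ)) (n : ℕ) :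
    adaptiveSim (fun k => liftSnd ω (L k)) init Ψ n =
      reindex (regroup (o × κ) ω ω') ∘ₗ withId ω (adaptiveSim L init Ψ n) ∘ₗ
        reindex (regroup (ι × κ) ω ω').symm := by
  induction n with
  | zero => rfl
  | succ n ih => rw [adaptiveSim, ih]; rfl

/-- The two simulations one after the other, with independent memories. -/
def concatSim (m : ℕ) (L : ℕ → OpMap (ι × ω) (o × ω)) (L' : ℕ → OpMap (ι × ω') (o × ω')) (k : ℕ) :
    OpMap (ι × (ω × ω')) (o × (ω × ω')) :=
  if k ≤ m then liftFst ω' (L k) else liftSnd ω (L' (k - (m + 1)))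

/-- The first memory may be discarded before the second simulation begins, since the channels that
follow commute with the partial trace. -/
theorem simMap_concatSim {m n : ℕ} {L : ℕ → OpMap (ι × ω) (o × ω)}
    {L' : ℕ → OpMap (ι × ω') (o × ω')} (hL : ∀ k ≤ m, IsChannel (L k))
    (hL' : ∀ k ≤ n, IsChannel (L' k)) {init : OpMap (ι × κ) (ι × κ)} (hi : IsChannel init)
    {Ψ : ℕ → OpMap (o × κ) (ι × κ)} (hΨ : ∀ k < m + 1 + n, IsChannel (Ψ k)) {τ : Op ω}
    (hτ : IsDensity τ) {τ' : Op ω'} (hτ' : IsDensity τ') {ρ : Op (ι × κ)} (hρ : IsDensity ρ) :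
    simMap (concatSim m L L') init Ψ (m + 1 + n) (τ ⊗ₖ τ') ρ =
      simMap L' LinearMap.id (fun j => Ψ (m + 1 + j)) n τ' (Ψ m (simMap L init Ψ m τ ρ)) := by
  have hΨm : IsChannel (Ψ m) := hΨ m (by omega)
  have c1 := isChannel_adaptiveSim m hL hi fun k hk => hΨ k (by omega)
  have hΨ' : ∀ k < n, IsChannel (Ψ (m + 1 + k)) := fun k hk => hΨ _ (by omega)
  have c2 := isChannel_adaptiveSim n hL' isChannel_id hΨ'
  have hS := c1.posTC (hρ.1.kron hτ.1)
  have hS' := (hΨm.withId ω).posTC hS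
  have e1 : adaptiveSim (concatSim m L L') init Ψ m =
      adaptiveSim (fun k => liftFst ω' (L k)) init Ψ m :=
    adaptiveSim_congr _ _ _ fun k hk => if_pos hk
  have e2 : (fun j => concatSim m L L' (m + 1 + j)) = fun j => liftSnd ω (L' j) := by
    funext j
    rw [concatSim, if_neg (by omega), Nat.add_sub_cancel_left]
  have e3 : reindex (Equiv.prodAssoc (ι × κ) ω ω') (ρ ⊗ₖ (τ ⊗ₖ τ')) = (ρ ⊗ₖ τ) ⊗ₖ τ' := by
    ext x y
    exact (mul_assoc _ _ _).symm
  have e4 : withId (ω × ω') (Ψ m) (reindex (Equiv.prodAssoc (o × κ) ω ω').symm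
      (adaptiveSim L init Ψ m (ρ ⊗ₖ τ) ⊗ₖ τ')) = reindex (Equiv.prodAssoc (ι × κ) ω ω').symm
        (withId ω (Ψ m) (adaptiveSim L init Ψ m (ρ ⊗ₖ τ)) ⊗ₖ τ') := by
    ext x y
    have e : block (reindex (Equiv.prodAssoc (o × κ) ω ω').symm
        (adaptiveSim L init Ψ m (ρ ⊗ₖ τ) ⊗ₖ τ')) x.2 y.2 =
          τ' x.2.2 y.2.2 • block (adaptiveSim L init Ψ m (ρ ⊗ₖ τ)) x.2.1 y.2.1 := by
      ext a b; exact mul_comm _ _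
    rw [withId_apply, e, map_smul]
    exact mul_comm _ _
  have e5 : adaptiveSim (concatSim m L L') init Ψ (m + 1 + n) (ρ ⊗ₖ (τ ⊗ₖ τ')) =
      reindex (regroup (o × κ) ω ω')
        (withId ω (adaptiveSim L' LinearMap.id (fun j => Ψ (m + 1 + j)) n ∘ₗ append _ τ')
          (withId ω (Ψ m) (adaptiveSim L init Ψ m (ρ ⊗ₖ τ)))) := by
    rw [adaptiveSim_add, e1, e2, adaptiveSim_liftFst, adaptiveSim_liftSnd]
    simp only [LinearMap.comp_apply]
    rw [e3, withId_kron, e4]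
    rfl
  have hA := ((c2.comp (isChannel_append (ι × κ) hτ')).withId ω).posTC hS'
  change ptr _ _ (adaptiveSim (concatSim m L L') init Ψ (m + 1 + n) (ρ ⊗ₖ (τ ⊗ₖ τ'))) =
    simMap L' LinearMap.id (fun j => Ψ (m + 1 + j)) n τ'
      (Ψ m (ptr _ _ (adaptiveSim L init Ψ m (ρ ⊗ₖ τ))))
  rw [e5, ptr_prod hA, hΨm.apply_ptr hS,
    (isChannel_simMap n hL' isChannel_id hΨ' hτ').apply_ptr hS']
  rfl

theorem GMaxAdaptive_add_le (hΦ : IsChannel Φ) (m n : ℕ) :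
    GMaxAdaptive Φ Δ (m + 1 + n) ≤ GMaxAdaptive Φ Δ m + GMaxAdaptive Φ Δ n := by
  have key : ∀ (X ω : Type u) (_ : MeasurableSpace X) (q : Measure X) (g : X → ℝ) (τ : Op ω)
      (Λ : X → ℕ → OpMap (ι × ω) (o × ω)), IsProbabilityMeasure q → IsScore q g →
      AdaptiveSimBy q g τ Λ Φ Δ m →
      GMaxAdaptive Φ Δ (m + 1 + n) ≤ ENNReal.ofReal (∫ x, g x ^ 2 ∂q) + GMaxAdaptive Φ Δ n := by
    intro X ω _ q g τ Λ _ hg h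
    refine tsub_le_iff_left.1 (le_GMaxAdaptive hΦ fun X' ω' _ q' g' τ' Λ' _ hg' h' =>
      tsub_le_iff_left.2 ?_)
    obtain ⟨h3, h4⟩ := hg.prod hg'
    rw [← ENNReal.ofReal_add (integral_nonneg fun x => sq_nonneg _)
      (integral_nonneg fun x => sq_nonneg _), ← h4]
    have hch : ∀ (p : X × X') (k : ℕ), k ≤ m + 1 + n →
        IsChannel (concatSim m (Λ p.1) (Λ' p.2) k) := by
      intro p k hk
      rw [concatSim]
      split_ifs with hkm
      · exact (isChannel_reindex _).comp (((h.2.1 p.1 k hkm).withId ω').comp (isChannel_reindex _))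
      · exact (isChannel_reindex _).comp
          (((h'.2.1 p.2 (k - (m + 1)) (by omega)).withId ω).comp (isChannel_reindex _))
    refine GMaxAdaptive_le h3 (τ := τ ⊗ₖ τ') (Λ := fun p => concatSim m (Λ p.1) (Λ' p.2))
      ⟨h.1.kron h'.1, hch, fun κ init Ψ hi hΨ => ?_⟩
    have hΨ' : ∀ k < n, IsChannel (Ψ (m + 1 + k)) := fun k hk => hΨ _ (by omega)
    have s1 := (h.2.2 κ init Ψ hi fun k hk => hΨ k (by omega)).post hg (hΨ m (by omega))
    have s2 := h'.2.2 κ LinearMap.id (fun j => Ψ (m + 1 + j)) isChannel_id hΨ'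
    have s3 := s1.comp hg hg'
      ((comb_adaptive Φ Δ isChannel_id n hΨ').isChannel hΦ) s2
    obtain ⟨a1, a2⟩ := adaptive_add Φ Δ init Ψ m n
    rw [a1, a2]
    refine s3.congr (fun p => isChannel_simMap _ (hch p) hi hΨ (h.1.kron h'.1))
      (fun p ρ hρ => ?_) (fun _ _ => rfl) fun _ _ => rfl
    exact (simMap_concatSim (h.2.1 p.1) (h'.2.1 p.2) hi hΨ h.1 h'.1 hρ).symm
  exact tsub_le_iff_right.1 (le_GMaxAdaptive hΦ fun X ω _ q g τ Λ hq hg h =>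
    tsub_le_iff_right.2 (key X ω _ q g τ Λ hq hg h))

end

section

/-! ### Limits of superadditive and subadditive sequences -/

theorem mul_le_of_superadditive {a : ℕ → ℝ≥0∞} (h : ∀ m n, a m + a n ≤ a (m + 1 + n)) (k n j : ℕ)
    (hj : j * (k + 1) ≤ n + 1) : j * a k ≤ a n := by
  induction j generalizing n with
  | zero => simp
  | succ j ih =>
    rcases Nat.eq_zero_or_pos j with rfl | hj0
    · rcases (show k ≤ n by omega).eq_or_lt with rfl | hkn
      · simp
      · have := h k (n - (k + 1))
        rw [show k + 1 + (n - (k + 1)) = n by omega] at this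
        simpa using le_self_add.trans this
    · have h1 : k + 1 ≤ j * (k + 1) := Nat.le_mul_of_pos_left _ hj0
      rw [add_mul, one_mul] at hj
      have h2 := h k (n - (k + 1))
      rw [show k + 1 + (n - (k + 1)) = n by omega] at h2
      have h3 := ih (n - (k + 1)) (by omega)
      calc ((j + 1 : ℕ) : ℝ≥0∞) * a k = a k + j * a k := by push_cast; ring
        _ ≤ a k + a (n - (k + 1)) := by gcongr
        _ ≤ a n := h2

/-- Fekete's lemma for superadditive sequences in `[0, ∞]`. The index is shifted by one. -/
theorem tendsto_of_superadditive {a : ℕ → ℝ≥0∞} (h : ∀ m n, a m + a n ≤ a (m + 1 + n)) :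
    Tendsto (fun n => a n / (n + 1 : ℕ)) atTop (𝓝 (⨆ n, a n / (n + 1 : ℕ))) := by
  refine tendsto_order.2 ⟨fun b hb => ?_, fun b hb => Eventually.of_forall fun n =>
    (le_iSup (fun n => a n / ((n + 1 : ℕ) : ℝ≥0∞)) n).trans_lt hb⟩
  obtain ⟨k, hk⟩ := lt_iSup_iff.1 hb
  lift b to NNReal using hk.ne_top
  rw [ENNReal.lt_div_iff_mul_lt (by simp) (by simp)] at hk
  obtain ⟨c, hc1, hc2⟩ := exists_between hk
  lift c to NNReal using hc2.ne_top
  have hbc : b * (k + 1) < c := by exact_mod_cast hc1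
  obtain ⟨Q, hQ⟩ := exists_nat_gt (b * (k + 1) / (c - b * (k + 1)))
  have hpos : 0 < c - b * (k + 1) := tsub_pos_of_lt hbc
  rw [div_lt_iff₀ hpos] at hQ
  refine eventually_atTop.2 ⟨Q * (k + 1), fun n hn => ?_⟩
  rw [ENNReal.lt_div_iff_mul_lt (by simp) (by simp)]
  set j := (n + 1) / (k + 1) with hj
  have hj1 : j * (k + 1) ≤ n + 1 := Nat.div_mul_le_self _ _
  have hj2 : n + 1 < (j + 1) * (k + 1) := by
    rw [add_mul, one_mul]; exact Nat.lt_div_mul_add k.succ_pos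
  have hj3 : Q ≤ j := (Nat.le_div_iff_mul_le k.succ_pos).2 (hn.trans n.le_succ)
  have h1 : b * (j + 1) * (k + 1) < j * c := by
    have e : c = (c - b * (k + 1)) + b * (k + 1) := (tsub_add_cancel_of_le hbc.le).symm
    have hQ' : (Q : NNReal) ≤ j := by exact_mod_cast hj3
    calc b * (j + 1) * (k + 1) = j * (b * (k + 1)) + b * (k + 1) := by ring
      _ < j * (b * (k + 1)) + Q * (c - b * (k + 1)) := by gcongr
      _ ≤ j * (b * (k + 1)) + j * (c - b * (k + 1)) := by gcongr
      _ = j * ((c - b * (k + 1)) + b * (k + 1)) := by ring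
      _ = j * c := by rw [← e]
  have h2 : b * (n + 1) ≤ b * (j + 1) * (k + 1) := by
    rw [mul_assoc]
    gcongr
    exact_mod_cast hj2.le
  calc (b : ℝ≥0∞) * ((n + 1 : ℕ) : ℝ≥0∞) < j * c := by exact_mod_cast h2.trans_lt h1
    _ ≤ j * a k := by gcongr
    _ ≤ a n := mul_le_of_superadditive h k n j hj1

theorem le_mul_of_subadditive {a : ℕ → ℝ≥0∞} (h : ∀ m n, a (m + 1 + n) ≤ a m + a n) (n : ℕ) :
    a n ≤ (n + 1 : ℕ) * a 0 := by
  induction n with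
  | zero => simp
  | succ n ih =>
    calc a (n + 1) ≤ a n + a 0 := h n 0
      _ ≤ (n + 1 : ℕ) * a 0 + a 0 := by gcongr
      _ = ((n + 1 + 1 : ℕ) : ℝ≥0∞) * a 0 := by push_cast; ring

/-- Fekete's lemma for subadditive sequences in `[0, ∞]`. The index is shifted by one, and `h0`
ensures that an infinite first term does not coexist with finite terms. -/
theorem exists_tendsto_of_subadditive {a : ℕ → ℝ≥0∞} (h : ∀ m n, a (m + 1 + n) ≤ a m + a n)
    (h0 : ∀ n, a 0 ≤ a n) : ∃ l ≤ a 0, Tendsto (fun n => a n / (n + 1 : ℕ)) atTop (𝓝 l) := by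
  by_cases ht : a 0 = ⊤
  · refine ⟨⊤, ht.ge, tendsto_const_nhds.congr fun n => ?_⟩
    have hn : a n = ⊤ := top_le_iff.1 (ht.ge.trans (h0 n))
    rw [hn, ENNReal.top_div_of_ne_top (ENNReal.natCast_ne_top _)]
  have hfin : ∀ n, a n ≠ ⊤ := fun n =>
    ((le_mul_of_subadditive h n).trans_lt
      (ENNReal.mul_lt_top (ENNReal.natCast_lt_top _) (lt_top_iff_ne_top.2 ht))).ne
  let u : ℕ → ℝ := fun n => if n = 0 then 0 else (a (n - 1)).toReal
  have hu : Subadditive u := by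
    intro m n
    rcases m with _ | m
    · simp [u]
    rcases n with _ | n
    · simp [u]
    have e : m + 1 + (n + 1) - 1 = m + 1 + n := by omega
    simp only [u, if_neg (Nat.succ_ne_zero _), Nat.add_sub_cancel,
      if_neg (show m + 1 + (n + 1) ≠ 0 by omega), e]
    rw [← ENNReal.toReal_add (hfin m) (hfin n)]
    exact ENNReal.toReal_mono (ENNReal.add_ne_top.2 ⟨hfin m, hfin n⟩) (h m n)
  have hb : BddBelow (Set.range fun n => u n / n) := by
    refine ⟨0, ?_⟩
    rintro _ ⟨n, rfl⟩
    refine div_nonneg ?_ n.cast_nonneg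
    simp only [u]
    split_ifs
    exacts [le_rfl, ENNReal.toReal_nonneg]
  have h1 := ENNReal.tendsto_ofReal ((hu.tendsto_lim hb).comp (tendsto_add_atTop_nat 1))
  refine ⟨ENNReal.ofReal hu.lim, ?_, h1.congr fun n => ?_⟩
  · refine ENNReal.ofReal_le_of_le_toReal ?_
    simpa [u] using hu.lim_le_div hb one_ne_zero
  · simp only [Function.comp, u, if_neg (Nat.succ_ne_zero n), Nat.add_sub_cancel]
    rw [ENNReal.ofReal_div_of_pos (by positivity), ENNReal.ofReal_toReal (hfin n),
      ENNReal.ofReal_natCast]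

variable {ι o : Type u} {Φ Δ : OpMap ι o}

/-! ### Tensor powers and the maximal metric -/

theorem reindex_reindex_symm {α β : Type u} (e : β ≃ α) (T : Op β) :
    reindex e (reindex e.symm T) = T := by
  ext x y
  change T (e.symm (e x)) (e.symm (e y)) = T x y
  rw [e.symm_apply_apply, e.symm_apply_apply]

theorem GMax_tensorPow_add_le (hΦ : IsChannel Φ) (m n : ℕ) :
    GMax (tensorPow Φ (m + n)) (tensorDeriv Φ Δ (m + n)) ≤
      GMax (tensorPow Φ m) (tensorDeriv Φ Δ m) + GMax (tensorPow Φ n) (tensorDeriv Φ Δ n) := by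
  obtain ⟨e1, e2⟩ := tensorPow_add Φ Δ m n
  rw [add_comm (GMax _ _)]
  refine (GMax_mono ?_ (isChannel_reindex (powSplit ι m n).symm)
    (isChannel_reindex (powSplit o m n)) (fun ρ _ => ?_) fun ρ _ => ?_).trans
      (GMax_tensor_le (isChannel_tensorPow hΦ n) (isChannel_tensorPow hΦ m))
  · exact (isChannel_tensorPow hΦ n).tensor (isChannel_tensorPow hΦ m)
  · rw [e1, LinearMap.comp_apply, LinearMap.comp_apply, reindex_reindex_symm, reindex_reindex_symm]
  · rw [e2, LinearMap.comp_apply, LinearMap.comp_apply, reindex_reindex_symm, reindex_reindex_symm]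

/-- One of the channels can be fed with a fixed state and its output can be discarded; the tangent
vector does not contribute in this place, as its values have trace zero. -/
theorem GMax_tensorPow_le_succ [Nonempty ι] (hΦ : IsChannel Φ) (hΔ : IsTZ Δ) (n : ℕ) :
    GMax (tensorPow Φ n) (tensorDeriv Φ Δ n) ≤
      GMax (tensorPow Φ (n + 1)) (tensorDeriv Φ Δ (n + 1)) := by
  obtain ⟨ρ₀, hρ₀⟩ := exists_isDensity (α := ι)
  have hE : IsChannel (reindex (Equiv.prodComm ι (Pow ι n)) ∘ₗ append (Pow ι n) ρ₀) :=
    (isChannel_reindex _).comp (isChannel_append _ hρ₀)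
  have hC : IsChannel (ptr (Pow o n) o ∘ₗ reindex (Equiv.prodComm (Pow o n) o)) :=
    (isChannel_ptr _ _).comp (isChannel_reindex _)
  have e : ∀ (A : OpMap ι o) (B : OpMap (Pow ι n) (Pow o n)) (ρ : Op (Pow ι n)),
      (ptr (Pow o n) o ∘ₗ reindex (Equiv.prodComm (Pow o n) o))
        (tensor A B ((reindex (Equiv.prodComm ι (Pow ι n)) ∘ₗ append (Pow ι n) ρ₀) ρ)) =
          trFun o (A ρ₀) • B ρ := by
    intro A B ρ
    have h1 : reindex (Equiv.prodComm ι (Pow ι n)) (append (Pow ι n) ρ₀ ρ) = ρ₀ ⊗ₖ ρ := by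
      ext x y; exact mul_comm _ _
    have h2 : reindex (Equiv.prodComm (Pow o n) o) (A ρ₀ ⊗ₖ B ρ) = B ρ ⊗ₖ A ρ₀ := by
      ext x y; exact mul_comm _ _
    rw [LinearMap.comp_apply, LinearMap.comp_apply, h1, tensor_kron, h2, ptr_kron]
  have hT : trFun o (Φ ρ₀) = 1 := by
    have := hΦ.isDensity hρ₀
    rw [trFun_eq this.1.2, this.2]
  have hT' : trFun o (Δ ρ₀) = 0 := (hΔ.mem_TC hρ₀.1.mem_TC).2
  refine GMax_mono (hΦ.tensor (isChannel_tensorPow hΦ n)) hE hC (fun ρ _ => ?_) fun ρ _ => ?_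
  · exact (e Φ (tensorPow Φ n) ρ).trans (by rw [hT, one_smul])
  · refine (map_add (ptr (Pow o n) o ∘ₗ reindex (Equiv.prodComm (Pow o n) o)) _ _).trans ?_
    refine (congrArg₂ (· + ·) (e Δ (tensorPow Φ n) ρ) (e Φ (tensorDeriv Φ Δ n) ρ)).trans ?_
    rw [hT, hT', zero_smul, one_smul, zero_add]

theorem GMax_le_tensorPow_one (hΦ : IsChannel Φ) :
    GMax Φ Δ ≤ GMax (tensorPow Φ 1) (tensorDeriv Φ Δ 1) := by
  refine GMax_mono (isChannel_tensorPow hΦ 1) (isChannel_reindex (Equiv.prodPUnit ι))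
    (isChannel_reindex (Equiv.prodPUnit o).symm) (fun ρ _ => rfl) fun ρ _ => ?_
  have e : tensorDeriv Φ Δ 1 = tensor Δ (LinearMap.id : OpMap PUnit PUnit) := by
    refine LinearMap.ext fun T => Matrix.ext fun x y => ?_
    change _ + Φ 0 x.1 y.1 = _
    rw [map_zero]; exact add_zero _
  rw [e]; rfl

/-! ### Channels without input states -/

theorem not_isDensity_of_isEmpty {α : Type u} [IsEmpty α] (ρ : Op α) : ¬ IsDensity ρ := fun h =>
  (not_nonempty_iff.2 ‹_›) h.nonempty

/-- The conditions on a simulation concern states only, so that without states the tangent vector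
may be simulated by the zero measure. -/
theorem GMax_of_isEmpty [IsEmpty ι] (hΦ : IsChannel Φ) : GMax Φ Δ = 0 := by
  refine le_antisymm ?_ bot_le
  have h : SimBy (Measure.dirac PUnit.unit) (fun _ : PUnit.{u + 1} => (0 : ℝ)) (fun _ => Φ) Φ Δ :=
    ⟨fun _ => hΦ, fun ρ hρ => absurd hρ (not_isDensity_of_isEmpty ρ)⟩
  simpa using GMax_le (isScore_zero _) h

/-- For at least one use an input state is needed; the supremum over no protocols is zero. -/
theorem reachInfo_of_isEmpty [IsEmpty ι] (hΦ : IsChannel Φ) (n : ℕ) :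
    reachInfo Φ Δ (n + 1) = 0 := by
  refine le_antisymm (sSup_le ?_) bot_le
  rintro j ⟨N, _, σ, δ, f, h, -, rfl⟩
  obtain ⟨κ, σ₀, δ₀, C, h0, -⟩ := h.exists_of_succ
  exact absurd (h0.isDensity hΦ) (not_isDensity_of_isEmpty σ₀)

theorem isEmpty_pow (ι : Type u) [IsEmpty ι] (n : ℕ) : IsEmpty (Pow ι (n + 1)) :=
  inferInstanceAs (IsEmpty (ι × Pow ι n))

/-! ### Existence and comparison of the rates -/

theorem reachInfo_add_succ_le (hΦ : IsChannel Φ) (hΔ : IsTZ Δ) (m n : ℕ) :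
    reachInfo Φ Δ (m + 1) + reachInfo Φ Δ (n + 1) ≤ reachInfo Φ Δ (m + 1 + n + 1) := by
  rcases isEmpty_or_nonempty ι with _ | _
  · simp [reachInfo_of_isEmpty hΦ]
  · exact reachInfo_seq hΦ hΔ (m + 1) (n + 1)

theorem mul_reachInfo_succ_le (hΦ : IsChannel Φ) (hΔ : IsTZ Δ) (m n : ℕ) :
    m * reachInfo Φ Δ (n + 1) ≤ reachInfo (tensorPow Φ m) (tensorDeriv Φ Δ m) (n + 1) := by
  rcases isEmpty_or_nonempty ι with _ | _
  · simp [reachInfo_of_isEmpty hΦ]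
  · exact mul_reachInfo_le hΦ hΔ m (n + 1)

theorem reachInfo_pow_add_succ_le (hΦ : IsChannel Φ) (hΔ : IsTZ Δ) (m n : ℕ) :
    reachInfo (tensorPow Φ (m + 1)) (tensorDeriv Φ Δ (m + 1)) 1 +
      reachInfo (tensorPow Φ (n + 1)) (tensorDeriv Φ Δ (n + 1)) 1 ≤
      reachInfo (tensorPow Φ (m + 1 + n + 1)) (tensorDeriv Φ Δ (m + 1 + n + 1)) 1 := by
  rcases isEmpty_or_nonempty ι with _ | _
  · have := isEmpty_pow ι
    rw [reachInfo_of_isEmpty (isChannel_tensorPow hΦ _) 0,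
      reachInfo_of_isEmpty (isChannel_tensorPow hΦ _) 0, add_zero]
    exact bot_le
  · exact reachInfo_pow_add hΦ hΔ (m + 1) (n + 1)

theorem GMax_le_tensorPow (hΦ : IsChannel Φ) (hΔ : IsTZ Δ) (n : ℕ) :
    GMax Φ Δ ≤ GMax (tensorPow Φ (n + 1)) (tensorDeriv Φ Δ (n + 1)) := by
  rcases isEmpty_or_nonempty ι with _ | _
  · rw [GMax_of_isEmpty hΦ]; exact bot_le
  induction n with
  | zero => exact GMax_le_tensorPow_one hΦ
  | succ n ih => exact ih.trans (GMax_tensorPow_le_succ hΦ hΔ (n + 1))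

theorem GMax_tensorPow_succ_le (hΦ : IsChannel Φ) (n : ℕ) :
    GMax (tensorPow Φ (n + 1)) (tensorDeriv Φ Δ (n + 1)) ≤ GMaxAdaptive Φ Δ n := by
  rcases isEmpty_or_nonempty ι with _ | _
  · have := isEmpty_pow ι n
    rw [GMax_of_isEmpty (isChannel_tensorPow hΦ (n + 1))]; exact bot_le
  · exact GMax_tensorPow_le_GMaxAdaptive hΦ n

theorem reachInfo_le_mul_GMax (hΦ : IsChannel Φ) (n : ℕ) :
    reachInfo Φ Δ (n + 1) ≤ (n + 1 : ℕ) * GMax Φ Δ := by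
  refine (reachInfo_le_GMaxAdaptive hΦ n).trans
    ((le_mul_of_subadditive (GMaxAdaptive_add_le hΦ) n).trans ?_)
  gcongr
  exact GMaxAdaptive_zero_le hΦ

theorem rateMinA_eq (hΦ : IsChannel Φ) :
    rateMinA Φ Δ = fun n => reachInfo Φ Δ (n + 1) / (n + 1 : ℕ) := by
  funext n
  rw [rateMinA, GMinAdaptive_eq_reachInfo hΦ]

theorem rateMinP_eq (hΦ : IsChannel Φ) : rateMinP Φ Δ = fun n =>
    reachInfo (tensorPow Φ (n + 1)) (tensorDeriv Φ Δ (n + 1)) 1 / (n + 1 : ℕ) := by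
  funext n
  rw [rateMinP, GMin_eq_reachInfo (isChannel_tensorPow hΦ _)]

theorem tendsto_rateMinA (hΦ : IsChannel Φ) (hΔ : IsTZ Δ) :
    Tendsto (rateMinA Φ Δ) atTop (𝓝 (GMinA Φ Δ)) ∧
      GMinA Φ Δ = ⨆ n, reachInfo Φ Δ (n + 1) / (n + 1 : ℕ) := by
  have h := tendsto_of_superadditive (reachInfo_add_succ_le hΦ hΔ)
  have e : GMinA Φ Δ = ⨆ n, reachInfo Φ Δ (n + 1) / (n + 1 : ℕ) := by
    rw [GMinA, rateMinA_eq hΦ]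
    exact h.limUnder_eq
  exact ⟨by rw [e, rateMinA_eq hΦ]; exact h, e⟩

theorem tendsto_rateMinP (hΦ : IsChannel Φ) (hΔ : IsTZ Δ) :
    Tendsto (rateMinP Φ Δ) atTop (𝓝 (GMinP Φ Δ)) := by
  have h := tendsto_of_superadditive (reachInfo_pow_add_succ_le hΦ hΔ)
  rw [← rateMinP_eq hΦ] at h
  exact tendsto_nhds_limUnder ⟨_, h⟩

theorem tendsto_rateMaxP (hΦ : IsChannel Φ) (hΔ : IsTZ Δ) :
    Tendsto (rateMaxP Φ Δ) atTop (𝓝 (GMaxP Φ Δ)) := by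
  obtain ⟨l, -, h⟩ := exists_tendsto_of_subadditive
    (a := fun n => GMax (tensorPow Φ (n + 1)) (tensorDeriv Φ Δ (n + 1)))
    (fun m n => GMax_tensorPow_add_le hΦ (m + 1) (n + 1))
    fun n => (GMax_tensorPow_succ_le hΦ 0).trans
      ((GMaxAdaptive_zero_le hΦ).trans (GMax_le_tensorPow hΦ hΔ n))
  exact tendsto_nhds_limUnder ⟨l, h⟩

theorem tendsto_rateMaxA (hΦ : IsChannel Φ) (hΔ : IsTZ Δ) :
    Tendsto (rateMaxA Φ Δ) atTop (𝓝 (GMaxA Φ Δ)) ∧ GMaxA Φ Δ ≤ GMax Φ Δ := by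
  obtain ⟨l, hl, h⟩ := exists_tendsto_of_subadditive (GMaxAdaptive_add_le (Δ := Δ) hΦ)
    fun n => (GMaxAdaptive_zero_le hΦ).trans
      ((GMax_le_tensorPow hΦ hΔ n).trans (GMax_tensorPow_succ_le hΦ n))
  have e : GMaxA Φ Δ = l := h.limUnder_eq
  exact ⟨by rw [e]; exact h, by rw [e]; exact hl.trans (GMaxAdaptive_zero_le hΦ)⟩

theorem GMin_le_GMinP (hΦ : IsChannel Φ) (hΔ : IsTZ Δ) : GMin Φ Δ ≤ GMinP Φ Δ := by
  refine ge_of_tendsto' (tendsto_rateMinP hΦ hΔ) fun n => ?_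
  rw [rateMinP_eq hΦ, GMin_eq_reachInfo hΦ, ENNReal.le_div_iff_mul_le (by simp) (by simp),
    mul_comm]
  exact mul_reachInfo_succ_le hΦ hΔ (n + 1) 0

theorem GMinP_le_GMinA (hΦ : IsChannel Φ) (hΔ : IsTZ Δ) : GMinP Φ Δ ≤ GMinA Φ Δ := by
  refine le_of_tendsto_of_tendsto' (tendsto_rateMinP hΦ hΔ) (tendsto_rateMinA hΦ hΔ).1 fun n => ?_
  rw [rateMinP_eq hΦ, rateMinA_eq hΦ]
  have h := reachInfo_serialize (Φ := Φ) (Δ := Δ) (n + 1) 1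
  rw [one_mul] at h
  exact ENNReal.div_le_div_right h _

theorem GMaxP_le_GMaxA (hΦ : IsChannel Φ) (hΔ : IsTZ Δ) : GMaxP Φ Δ ≤ GMaxA Φ Δ :=
  le_of_tendsto_of_tendsto' (tendsto_rateMaxP hΦ hΔ) (tendsto_rateMaxA hΦ hΔ).1 fun n =>
    ENNReal.div_le_div_right (GMax_tensorPow_succ_le hΦ n) _

/-- Parallel use of `m` copies in each step gains a factor `m`, and can itself be simulated by
adaptive use of the single copies. -/
theorem GMinA_tensorPow (hΦ : IsChannel Φ) (hΔ : IsTZ Δ) {m : ℕ} (hm : 1 ≤ m) :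
    GMinA (tensorPow Φ m) (tensorDeriv Φ Δ m) / m = GMinA Φ Δ := by
  have hΦ' := isChannel_tensorPow hΦ m
  have hΔ' := isTZ_tensorDeriv hΦ hΔ m
  have hm0 : (m : ℝ≥0∞) ≠ 0 := by simp; omega
  have hmt : (m : ℝ≥0∞) ≠ ⊤ := ENNReal.natCast_ne_top m
  apply le_antisymm
  · refine ENNReal.div_le_of_le_mul ?_
    rw [(tendsto_rateMinA hΦ' hΔ').2]
    refine iSup_le fun n => ENNReal.div_le_of_le_mul ((reachInfo_serialize m (n + 1)).trans ?_)
    obtain ⟨k, hk⟩ : ∃ k, (n + 1) * m = k + 1 :=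
      Nat.exists_eq_add_one_of_ne_zero (Nat.mul_ne_zero n.succ_ne_zero (by omega))
    have h1 : reachInfo Φ Δ (k + 1) / (k + 1 : ℕ) ≤ GMinA Φ Δ := by
      rw [(tendsto_rateMinA hΦ hΔ).2]
      exact le_iSup (fun n => reachInfo Φ Δ (n + 1) / ((n + 1 : ℕ) : ℝ≥0∞)) k
    rw [ENNReal.div_le_iff (by simp) (by simp), ← hk] at h1
    refine h1.trans_eq ?_
    push_cast; ring
  · rw [ENNReal.le_div_iff_mul_le (Or.inl hm0) (Or.inl hmt), (tendsto_rateMinA hΦ hΔ).2,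
      ENNReal.iSup_mul]
    refine iSup_le fun n => ?_
    rw [(tendsto_rateMinA hΦ' hΔ').2]
    refine le_trans ?_ (le_iSup (fun n => reachInfo (tensorPow Φ m) (tensorDeriv Φ Δ m) (n + 1) /
      ((n + 1 : ℕ) : ℝ≥0∞)) n)
    rw [mul_comm, ← mul_div_assoc]
    exact ENNReal.div_le_div_right (mul_reachInfo_succ_le hΦ hΔ m n) _

/-- A simulation of `m` copies in parallel bounds every adaptive use of such blocks, and by weak
additivity also every adaptive use of the single copies. -/
theorem GMinA_le_GMaxP (hΦ : IsChannel Φ) (hΔ : IsTZ Δ) : GMinA Φ Δ ≤ GMaxP Φ Δ := by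
  refine ge_of_tendsto' (tendsto_rateMaxP hΦ hΔ) fun m => ?_
  rw [← GMinA_tensorPow hΦ hΔ (Nat.succ_le_succ m.zero_le), rateMaxP]
  refine ENNReal.div_le_div_right ?_ _
  rw [(tendsto_rateMinA (isChannel_tensorPow hΦ _) (isTZ_tensorDeriv hΦ hΔ _)).2]
  refine iSup_le fun n => ENNReal.div_le_of_le_mul' ?_
  exact reachInfo_le_mul_GMax (isChannel_tensorPow hΦ _) n

end

end ChannelMetric

end

theorem mainTheorem4 {ι o : Type u} (Φ Δ : ChannelMetric.OpMap ι o)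
    (hΦ : ChannelMetric.IsChannel Φ) (hΔ : ChannelMetric.IsTangent Δ) :
    (Tendsto (ChannelMetric.rateMinP Φ Δ) atTop (𝓝 (ChannelMetric.GMinP Φ Δ)) ∧
      Tendsto (ChannelMetric.rateMinA Φ Δ) atTop (𝓝 (ChannelMetric.GMinA Φ Δ)) ∧
      Tendsto (ChannelMetric.rateMaxP Φ Δ) atTop (𝓝 (ChannelMetric.GMaxP Φ Δ)) ∧
      Tendsto (ChannelMetric.rateMaxA Φ Δ) atTop (𝓝 (ChannelMetric.GMaxA Φ Δ))) ∧
    (ChannelMetric.GMin Φ Δ ≤ ChannelMetric.GMinP Φ Δ ∧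
      ChannelMetric.GMinP Φ Δ ≤ ChannelMetric.GMinA Φ Δ ∧
      ChannelMetric.GMinA Φ Δ ≤ ChannelMetric.GMaxP Φ Δ ∧
      ChannelMetric.GMaxP Φ Δ ≤ ChannelMetric.GMaxA Φ Δ ∧
      ChannelMetric.GMaxA Φ Δ ≤ ChannelMetric.GMax Φ Δ) ∧
    ∀ m : ℕ, 1 ≤ m →
      Tendsto (ChannelMetric.rateMinA (ChannelMetric.tensorPow Φ m)
          (ChannelMetric.tensorDeriv Φ Δ m)) atTop
        (𝓝 (ChannelMetric.GMinA (ChannelMetric.tensorPow Φ m)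
          (ChannelMetric.tensorDeriv Φ Δ m))) ∧
      ChannelMetric.GMinA (ChannelMetric.tensorPow Φ m)
        (ChannelMetric.tensorDeriv Φ Δ m) / (m : ENNReal) = ChannelMetric.GMinA Φ Δ := by
  have hΔ' := hΔ.isTZ
  exact ⟨⟨ChannelMetric.tendsto_rateMinP hΦ hΔ', (ChannelMetric.tendsto_rateMinA hΦ hΔ').1,
    ChannelMetric.tendsto_rateMaxP hΦ hΔ', (ChannelMetric.tendsto_rateMaxA hΦ hΔ').1⟩,
    ⟨ChannelMetric.GMin_le_GMinP hΦ hΔ', ChannelMetric.GMinP_le_GMinA hΦ hΔ',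
      ChannelMetric.GMinA_le_GMaxP hΦ hΔ', ChannelMetric.GMaxP_le_GMaxA hΦ hΔ',
      (ChannelMetric.tendsto_rateMaxA hΦ hΔ').2⟩,
    fun m hm => ⟨(ChannelMetric.tendsto_rateMinA (ChannelMetric.isChannel_tensorPow hΦ m)
      (ChannelMetric.isTZ_tensorDeriv hΦ hΔ' m)).1, ChannelMetric.GMinA_tensorPow hΦ hΔ' hm⟩⟩
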